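/- **Setting.** Let $\sigma,\delta_\pm^{0}\in\mathbb R$, $\mathbf q_0\in\mathbb C^2\setminus\{0\}$, $q_0=\|\mathbf q_0\|$, $\mathbf q_\pm=\mathbf q_0e^{\mathrm i\delta_\pm^{0}}$, and let $\mathbf q(x,t)\in\mathbb C^2$ be a classical solution (four $x$-derivatives, jointly continuous; differentiable in $t$) of the coupled Lakshmanan–Porsezian–Daniel equation $$\mathrm i\mathbf q_t+\mathbf q_{xx}+2(\|\mathbf q\|^2-q_0^2)\mathbf q+\sigma\big[\mathbf q_{xxxx}+2\|\mathbf q_x\|^2\mathbf q+2(\mathbf q_x^\dagger\mathbf q)\mathbf q_x+6(\mathbf q^\dagger\mathbf q_x)\mathbf q_x+4\|\mathbf q\|^2\mathbf q_{xx}+4(\mathbf q^\dagger\mathbf q_{xx})\mathbf q+2(\mathbf q_{xx}^\dagger\mathbf q)\mathbf q+6(\|\mathbf q\|^4-q_0^4)\mathbf q\big]=0 .$$ For $w\ge0$ let $(\mathrm D_w)$ be the condition that $e^{w|x|}(\mathbf q(\cdot,t)-\mathbf q_\pm)$ is integrable near $\pm\infty$ for every $t$ and that $e^{w|x|}(\mathbf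 q-\mathbf q_\pm)$, $e^{w|x|}\partial_x^m\mathbf q$ $(m=1,2,3)$ tend to $0$ as $x\to\pm\infty$, locally uniformly in $t$. Assume $(\mathrm D_0)$. Put $k=\frac12(z-q_0^2/z)$, $\lambda=\frac12(z+q_0^2/z)$, $\rho=1+q_0^2/z^2$, $\mathcal E=\{0,\mathrm iq_0,-\mathrm iq_0\}$. Let $\mathbf J=\operatorname{diag}(1,-1,-1)$, $\mathbf J_1=\operatorname{diag}(1,0,0)$, $\mathbf Q=\begin{pmatrix}0&\mathbf q^\dagger\\-\mathbf q&\mathbf 0\end{pmatrix}$, $\mathbf A=-\mathrm ik\mathbf J+\mathbf Q$, $$\begin{aligned}\mathbf E={}&2k[\sigma(\mathbf Q_x\mathbf Q-\mathbf Q\mathbf Q_x)-2\sigma\|\mathbf q\|^2\mathbf Q-\sigma\mathbf Q_{xx}-\mathbf Q]+\mathrm iq_0^2\mathbf J+3\mathrm i\sigma q_0^4\mathbf J+4\mathrm ik^2[\mathbf J_1+\sigma\mathbf J(\mathbf Q_x-\mathbf Q^2)]+8\sigma k^3\mathbf Q-8\mathrm i\sigma k^4\mathbf J\\&+3\mathrm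 i\sigma\mathbf J(\mathbf Q_x\mathbf Q^2+\mathbf Q^2\mathbf Q_x)+\mathrm i\sigma\mathbf J(\mathbf Q_{xx}\mathbf Q+\mathbf Q\mathbf Q_{xx}-\mathbf Q_{xxx}-\mathbf Q_x^2)+\mathrm i(1+3\sigma\|\mathbf q\|^2)\mathbf J\mathbf Q^2-\mathrm i\mathbf J\mathbf Q_x,\end{aligned}$$ $\mathbf\Omega=\operatorname{diag}(\delta_1,\delta_2,\delta_3)$ with $\delta_{1}=-\lambda x+2(k^2+k\lambda-4k^3\lambda\sigma+2k\lambda\sigma q_0^2)t$, $\delta_2=kx+(8k^4\sigma-3\sigma q_0^4-q_0^2)t$, $\delta_3=\lambda x+2(k^2-k\lambda+4k^3\lambda\sigma-2k\lambda\sigma q_0^2)t$, and, with $\mathbf v^\perp=(v_2,-v_1)^\dagger$, $$\mathbf Y_\pm=\begin{pmatrix}1&0&-\mathrm iq_0/z\\-\mathrm i\mathbf q_\pm/z&\mathbf q_\pm^\perp/q_0&\mathbf q_\pm/q_0\end{pmatrix}.$$ The column $\psi_{\pm,j}(x,t,z)$ of the Jost eigenfunction $\psi_\pm$ is the simultaneous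 solution of $\psi_x=\mathbf A\psi$, $\psi_t=\mathbf E\psi$ with $e^{-\mathrm i\delta_j}\psi\to(\mathbf Y_\pm)_j$ and $e^{-\mathrm i\mathbf\Omega}\mathbf Y_\pm^{-1}\psi\to\mathbf e_j$ as $x\to\pm\infty$. The column $\tilde\psi_{\pm,j}$ is defined in the same way from $\tilde{\mathbf A}(k)=\mathbf A(k^*)^*$, $\tilde{\mathbf E}(k)=\mathbf E(k^*)^*$, $\tilde{\mathbf Y}_\pm(z)=\mathbf Y_\pm(z^*)^*$ and $-\mathbf\Omega$ (here $^*$ on matrices is entrywise conjugation). Put $\nu_{\pm,j}=\psi_{\pm,j}e^{-\mathrm i\delta_j}$ and $$\mu_1=e^{\mathrm i(\delta_1+\delta_2+\delta_3)}\tilde\psi_{+,1}\times\tilde\psi_{-,2},\quad \mu_2=e^{\mathrm i(\delta_1+\delta_2+\delta_3)}\tilde\psi_{-,1}\times\tilde\psi_{+,2},\quad \mu_3=e^{\mathrm i(\delta_1+\delta_2+\delta_3)}\tilde\psi_{+,2}\times\tilde\psi_{-,3},\quad \mu_4=e^{\mathrm i(\delta_1+\delta_2+\delta_3)}\tilde\psi_{-,2}\times\tilde\psi_{+,3},$$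 $c_1=\mu_1e^{-\mathrm i\delta_3}$, $c_2=\mu_2e^{-\mathrm i\delta_3}$, $c_3=\mu_3e^{-\mathrm i\delta_1}$, $c_4=\mu_4e^{-\mathrm i\delta_1}$. Let $U_1=\{\operatorname{Im}z>0,|z|>q_0\}$, $U_2=\{\operatorname{Im}z<0,|z|>q_0\}$, $U_3=\{\operatorname{Im}z<0,|z|<q_0\}$, $U_4=\{\operatorname{Im}z>0,|z|<q_0\}$, and, with $\mathcal E$ removed, $\Sigma_1=\{z\in\mathbb R,|z|\ge q_0\}$, $\Sigma_2=\{|z|=q_0,\operatorname{Im}z\le0\}$, $\Sigma_3=\{z\in\mathbb R,|z|\le q_0\}$, $\Sigma_4=\{|z|=q_0,\operatorname{Im}z\ge0\}$, $\Sigma=\bigcup_j\Sigma_j$. On $\Sigma$ put $\mathbf S(z)=\psi_+^{-1}\psi_-|_{x=t=0}$, $\mathbf H=\mathbf S^{-1}$, $\alpha_1=s_{21}/s_{11}$, $\alpha_2=s_{31}/s_{11}$, $\alpha_3=s_{32}/s_{22}$. Off $\Sigma$ the diagonal entries are, with $(\rho_1,\rho_2,\rho_3)=(1,\rho,1)$ and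 the bilinear dot product at $x=t=0$, $s_{jj}=\frac{\rho_j}{\rho}\,\tilde\psi_{+,j}\cdot\psi_{-,j}$ and $h_{jj}=\frac{\rho_j}{\rho}\,\tilde\psi_{-,j}\cdot\psi_{+,j}$. Finally let $$\begin{aligned}\mathbf B_1&=(\psi_{-,1},\psi_{+,2},\mu_1)e^{-\mathrm i\mathbf\Omega}\operatorname{diag}(\tfrac1{s_{11}},1,\tfrac1{h_{22}}),&\mathbf B_2&=(\psi_{+,1},\psi_{-,2},\mu_2)e^{-\mathrm i\mathbf\Omega}\operatorname{diag}(1,\tfrac1{s_{22}},\tfrac1{h_{11}}),\\\mathbf B_3&=(\mu_3,\psi_{-,2},\psi_{+,3})e^{-\mathrm i\mathbf\Omega}\operatorname{diag}(\tfrac1{h_{33}},\tfrac1{s_{22}},1),&\mathbf B_4&=(\mu_4,\psi_{+,2},\psi_{-,3})e^{-\mathrm i\mathbf\Omega}\operatorname{diag}(\tfrac1{h_{22}},1,\tfrac1{s_{33}}).\end{aligned}$$ **Lemma.** (i) For $z\in\Sigma$ such that $(\mathrm D_{|\operatorname{Im}z|})$ holds (in particular for every real $z\in\Sigma$), $\psi_-(x,t,z)=\psi_+(x,t,z)\mathbf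 S(z)$ for all $x,t$. (ii) $s_{11},s_{22},s_{33},h_{11},h_{22},h_{33}$ are analytic in $U_1$, $\{\operatorname{Im}z<0\}\setminus\mathcal E$, $U_4$, $U_2$, $\{\operatorname{Im}z>0\}\setminus\mathcal E$, $U_3$ respectively, continuous up to the boundary away from $\mathcal E$, and on the real part of the boundary they are the diagonal entries of $\mathbf S$ and $\mathbf H$. (iii) For all $x,t$, $$\mathbf B_1=\Big[\tfrac{\nu_{-,1}}{s_{11}},\nu_{+,2},\tfrac{c_1}{h_{22}}\Big],\quad\mathbf B_2=\Big[\nu_{+,1},\tfrac{\nu_{-,2}}{s_{22}},\tfrac{c_2}{h_{11}}\Big],\quad\mathbf B_3=\Big[\tfrac{c_3}{h_{33}},\tfrac{\nu_{-,2}}{s_{22}},\nu_{+,3}\Big],\quad\mathbf B_4=\Big[\tfrac{c_4}{h_{22}},\nu_{+,2},\tfrac{\nu_{-,3}}{s_{33}}\Big]$$ in $U_1,\dots,U_4$ respectively; each $\mathbf B_j$ is meromorphic in $U_j$; and at every point of $\partial U_j\setminus\mathcal E$ where the two coefficients in its denominators do not vanish, $\mathbf B_j$ is continuous from within $U_j$.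 (iv) Let $\mathbf B^+=\mathbf B_1$ on $U_1$, $\mathbf B^+=\mathbf B_3$ on $U_3$, $\mathbf B^-=\mathbf B_2$ on $U_2$, $\mathbf B^-=\mathbf B_4$ on $U_4$, with boundary values on $\Sigma_1,\Sigma_2,\Sigma_3,\Sigma_4$ taken from the regions $(U_1,U_2)$, $(U_3,U_2)$, $(U_3,U_4)$, $(U_1,U_4)$ for $(\mathbf B^+,\mathbf B^-)$. Then for all $x,t$ $$\mathbf B^+=\mathbf B^-\big[\mathbf I-e^{\mathrm i\mathbf\Omega}\mathbf L_j(z)e^{-\mathrm i\mathbf\Omega}\big],\qquad z\in\Sigma_j,\ j=1,\dots,4,$$ at every $z$ at which the coefficients in the denominators of the two matrices do not vanish and, for $j=2,4$, $(\mathrm D_{|\operatorname{Im}z|})$ holds. Here $$\mathbf L_1=\begin{pmatrix}\Delta_1&\Delta_2&\Delta_3\\-\alpha_1&0&\rho\chi_3\\\alpha_1\alpha_3-\alpha_2&\alpha_3&-\rho\alpha_3\chi_3\end{pmatrix},\ \mathbf L_2=\begin{pmatrix}\chi_2\hat\chi_2&0&-\chi_2\\0&0&0\\\hat\chi_2&0&0\end{pmatrix},\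 \mathbf L_3=\begin{pmatrix}-\hat\alpha_2\hat\chi_2&\Delta_4&\hat\alpha_2\\\Delta_5&\Delta_6&\Delta_7\\\hat\chi_2&-\alpha_3&0\end{pmatrix},\ \mathbf L_4=\begin{pmatrix}\alpha_2\hat\alpha_2&0&\hat\alpha_2\\\Delta_8&0&\Delta_9\\-\alpha_2&0&0\end{pmatrix},$$ $$\begin{aligned}\Delta_1&=(\alpha_1\alpha_3-\alpha_2)\chi_2+\tfrac{\mathrm iz}{q_0}\alpha_1\hat\alpha_3,\quad\Delta_2=\alpha_3\chi_2+\tfrac{\mathrm iz}{q_0}\hat\alpha_3,\quad\Delta_3=-(1+\rho\alpha_3\chi_3)\chi_2-\tfrac{\mathrm iz\rho}{q_0}\hat\alpha_3\chi_3,\quad\Delta_4=\alpha_3\hat\alpha_2-\tfrac{\mathrm iz}{q_0}\hat\alpha_3,\\\Delta_5&=\tfrac{\mathrm iq_0}z\hat\alpha_1\hat\chi_2+\tfrac{\mathrm iz\rho}{q_0}\hat\chi_3(1+\hat\alpha_2\hat\chi_2),\quad\Delta_6=-\tfrac{\mathrm iq_0}z\alpha_3\hat\alpha_1-\tfrac{z^2\rho}{q_0^2}\hat\alpha_3\hat\chi_3-\tfrac{\mathrm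 iz\rho}{q_0}\alpha_3\hat\alpha_2\hat\chi_3,\quad\Delta_7=-\tfrac{\mathrm iq_0}z\hat\alpha_1-\tfrac{\mathrm iz\rho}{q_0}\hat\alpha_2\hat\chi_3,\\\Delta_8&=\tfrac{\mathrm iz\rho}{q_0}\hat\chi_3(1-\alpha_2\hat\alpha_2)-\tfrac{\mathrm iq_0}z\alpha_2\hat\alpha_1-\alpha_1,\quad\Delta_9=\rho\chi_3-\tfrac{\mathrm iq_0}z\hat\alpha_1-\tfrac{\mathrm iz\rho}{q_0}\hat\alpha_2\hat\chi_3,\end{aligned}$$ with $\alpha_j=\alpha_j(z)$, $\hat\alpha_j=\alpha_j(-q_0^2/z)$, $\chi_j=\alpha_j(z^*)^*$, $\hat\chi_j=\alpha_j(-q_0^2/z^*)^*$. -/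

import Mathlib

open Filter Topology Matrix
open scoped ComplexConjugate

noncomputable section

namespace LPD

/-- Two-component complex vectors, with the Hermitian norm; `inner ℂ u v = u† v`. -/
abbrev Vec2 : Type := EuclideanSpace ℂ (Fin 2)

abbrev Mat3 : Type := Matrix (Fin 3) (Fin 3) ℂ

/-- The data of the scattering problem: the coupling `σ`, the vector `𝐪₀` and the phases `δ₋`, `δ₊`
of the boundary values, and the field `q x t`. -/
structure Data where
  sigma : ℝ
  vec : Vec2
  argM : ℝ
  argP : ℝ
  q : ℝ → ℝ → Vec2

namespace Data

variable (D : Data)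

/-- `q₀ = ‖𝐪₀‖`. -/
def q0 : ℝ := ‖D.vec‖

/-- The boundary value `𝐪₋ = 𝐪₀ e^{iδ₋}`. -/
def qM : Vec2 := Complex.exp (Complex.I * D.argM) • D.vec

/-- The boundary value `𝐪₊ = 𝐪₀ e^{iδ₊}`. -/
def qP : Vec2 := Complex.exp (Complex.I * D.argP) • D.vec

/-- `∂ₓᵐ q (x, t)`. -/
def dx (m : ℕ) (x t : ℝ) : Vec2 := iteratedDeriv m (fun y => D.q y t) x

/-- `q` is a classical solution of the coupled Lakshmanan–Porsezian–Daniel equation. -/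
structure IsSolution : Prop where
  contDiff_x : ∀ t, ContDiff ℝ 4 (fun x => D.q x t)
  continuous_dx : ∀ m ≤ 4, Continuous (fun p : ℝ × ℝ => D.dx m p.1 p.2)
  differentiable_t : ∀ x, Differentiable ℝ (fun t => D.q x t)
  equation : ∀ x t,
    Complex.I • deriv (fun s => D.q x s) t + D.dx 2 x t
      + (2 * (‖D.q x t‖ ^ 2 - D.q0 ^ 2)) • D.q x t
      + D.sigma • (D.dx 4 x t
          + (2 * ‖D.dx 1 x t‖ ^ 2) • D.q x t
          + (2 * inner ℂ (D.dx 1 x t) (D.q x t)) • D.dx 1 x t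
          + (6 * inner ℂ (D.q x t) (D.dx 1 x t)) • D.dx 1 x t
          + (4 * ‖D.q x t‖ ^ 2) • D.dx 2 x t
          + (4 * inner ℂ (D.q x t) (D.dx 2 x t)) • D.q x t
          + (2 * inner ℂ (D.dx 2 x t) (D.q x t)) • D.q x t
          + (6 * (‖D.q x t‖ ^ 4 - D.q0 ^ 4)) • D.q x t) = 0

/-- The boundary conditions, with weight `e^{w|x|}`: `q - q_±` is integrable near `±∞` for every `t`,
and `q - q_±`, `q_x`, `q_xx`, `q_xxx` tend to zero as `x → ±∞`, locally uniformly in `t`. The weight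
`w = 0` gives the usual nonzero boundary conditions. -/
structure Decays (w : ℝ) : Prop where
  integrable_neg : ∀ t a, MeasureTheory.IntegrableOn
    (fun x => Real.exp (w * |x|) • (D.q x t - D.qM)) (Set.Iic a)
  integrable_pos : ∀ t a, MeasureTheory.IntegrableOn
    (fun x => Real.exp (w * |x|) • (D.q x t - D.qP)) (Set.Ici a)
  limit_neg : TendstoLocallyUniformly
    (fun x t => Real.exp (w * |x|) • (D.q x t - D.qM)) (fun _ => 0) atBot
  limit_pos : TendstoLocallyUniformly
    (fun x t => Real.exp (w * |x|) • (D.q x t - D.qP)) (fun _ => 0) atTop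
  limit_dx_neg : ∀ m, 1 ≤ m → m ≤ 3 → TendstoLocallyUniformly
    (fun x t => Real.exp (w * |x|) • D.dx m x t) (fun _ => 0) atBot
  limit_dx_pos : ∀ m, 1 ≤ m → m ≤ 3 → TendstoLocallyUniformly
    (fun x t => Real.exp (w * |x|) • D.dx m x t) (fun _ => 0) atTop

/-! ### The Lax pair -/

def matJ : Mat3 := !![1, 0, 0; 0, -1, 0; 0, 0, -1]

def matJ1 : Mat3 := !![1, 0, 0; 0, 0, 0; 0, 0, 0]

/-- The block matrix with rows `(0, v†)` and `(-v, 0)`. -/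
def blockQ (v : Vec2) : Mat3 :=
  !![0, conj (v 0), conj (v 1); -(v 0), 0, 0; -(v 1), 0, 0]

/-- `∂ₓᵐ Q (x, t)`. -/
def Qx (m : ℕ) (x t : ℝ) : Mat3 := blockQ (D.dx m x t)

/-- The spatial Lax matrix `A(x, t, k)`. -/
def laxA (k : ℂ) (x t : ℝ) : Mat3 := -(Complex.I * k) • matJ + D.Qx 0 x t

/-- The temporal Lax matrix `E(x, t, k)`. -/
def laxE (k : ℂ) (x t : ℝ) : Mat3 :=
  let σ : ℂ := D.sigma
  let q0 : ℂ := D.q0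
  let n : ℂ := (‖D.q x t‖ : ℂ) ^ 2
  let Q := D.Qx 0 x t
  let Q1 := D.Qx 1 x t
  let Q2 := D.Qx 2 x t
  let Q3 := D.Qx 3 x t
  (2 * k) • (σ • (Q1 * Q - Q * Q1) - (2 * σ * n) • Q - σ • Q2 - Q)
    + (Complex.I * q0 ^ 2) • matJ + (3 * Complex.I * σ * q0 ^ 4) • matJ
    + (4 * Complex.I * k ^ 2) • (matJ1 + σ • (matJ * (Q1 - Q ^ 2)))
    + (8 * σ * k ^ 3) • Q - (8 * Complex.I * σ * k ^ 4) • matJ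
    + (3 * Complex.I * σ) • (matJ * (Q1 * Q ^ 2 + Q ^ 2 * Q1))
    + (Complex.I * σ) • (matJ * (Q2 * Q + Q * Q2 - Q3 - Q1 ^ 2))
    + (Complex.I * (1 + 3 * σ * n)) • (matJ * Q ^ 2)
    - Complex.I • (matJ * Q1)

/-- The adjoint Lax matrices: entrywise `Ã(k) = A(k*)*` and `Ẽ(k) = E(k*)*`. -/
def adjA (k : ℂ) (x t : ℝ) : Mat3 := (D.laxA (conj k) x t).map conj

def adjE (k : ℂ) (x t : ℝ) : Mat3 := (D.laxE (conj k) x t).map conj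

/-! ### Uniformization -/

/-- `k = (z - q₀²/z)/2`. -/
def kz (z : ℂ) : ℂ := (z - (D.q0 : ℂ) ^ 2 / z) / 2

/-- `λ = (z + q₀²/z)/2`. -/
def lam (z : ℂ) : ℂ := (z + (D.q0 : ℂ) ^ 2 / z) / 2

/-- `ρ = 1 + q₀²/z²`. -/
def rho (z : ℂ) : ℂ := 1 + (D.q0 : ℂ) ^ 2 / z ^ 2

/-- The involution `z ↦ -q₀²/z`. -/
def hat (z : ℂ) : ℂ := -((D.q0 : ℂ) ^ 2) / z

/-- The phases `δ₁, δ₂, δ₃`, the diagonal entries of `Ω(x, t, z)`. -/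
def phase (z : ℂ) (x t : ℝ) : Fin 3 → ℂ :=
  let σ : ℂ := D.sigma
  let q0 : ℂ := D.q0
  let k := D.kz z
  let l := D.lam z
  ![-l * x + 2 * (k ^ 2 + k * l - 4 * k ^ 3 * l * σ + 2 * k * l * σ * q0 ^ 2) * t,
    k * x + (8 * k ^ 4 * σ - 3 * σ * q0 ^ 4 - q0 ^ 2) * t,
    l * x + 2 * (k ^ 2 - k * l + 4 * k ^ 3 * l * σ - 2 * k * l * σ * q0 ^ 2) * t]

/-- `e^{iΩ}`. -/
def expO (z : ℂ) (x t : ℝ) : Mat3 :=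
  diagonal fun l => Complex.exp (Complex.I * D.phase z x t l)

/-- `e^{-iΩ}`. -/
def expNegO (z : ℂ) (x t : ℝ) : Mat3 :=
  diagonal fun l => Complex.exp (-(Complex.I * D.phase z x t l))

/-- `e^{i(δ₁+δ₂+δ₃)}`. -/
def expSum (z : ℂ) (x t : ℝ) : ℂ := Complex.exp (Complex.I * ∑ l, D.phase z x t l)

/-- The eigenvector matrix belonging to the boundary value `v`; its middle column is `v^⊥/q₀` with
`v^⊥ = (v₂, -v₁)†`. -/
def matY (v : Vec2) (z : ℂ) : Mat3 :=
  let q0 : ℂ := D.q0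
  !![1, 0, -(Complex.I * q0 / z);
     -(Complex.I / z * v 0), conj (v 1) / q0, v 0 / q0;
     -(Complex.I / z * v 1), -conj (v 0) / q0, v 1 / q0]

/-- `Ỹ(z) = Y(z*)*`. -/
def adjY (v : Vec2) (z : ℂ) : Mat3 := (D.matY v (conj z)).map conj

/-! ### Jost eigenfunctions -/

/-- `ψ` is the `j`-th column of the Jost eigenfunction `ψ = Y e^{iθ}(1 + o(1))` at the end `F` of the
line: a simultaneous solution of both parts of the Lax pair `ψ_x = A ψ`, `ψ_t = E ψ` with
`e^{-iθ_j} ψ → Y_j` and `e^{-iθ} Y⁻¹ ψ → e_j`. Where all `θ_l - θ_j` are real the two limits are the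
same condition. If `e^{i(θ_l - θ_j)}` does not decay at `F` the first implies the second; if it does
not grow there, the second implies the first. -/
def IsJost (A E : ℝ → ℝ → Mat3) (Y : Mat3) (θ : ℝ → ℝ → Fin 3 → ℂ) (F : Filter ℝ) (j : Fin 3)
    (ψ : ℝ → ℝ → Fin 3 → ℂ) : Prop :=
  (∀ x t, HasDerivAt (fun y => ψ y t) (A x t *ᵥ ψ x t) x) ∧
  (∀ x t, HasDerivAt (fun s => ψ x s) (E x t *ᵥ ψ x t) t) ∧
  (∀ t, Tendsto (fun x => Complex.exp (-(Complex.I * θ x t j)) • ψ x t) F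
    (𝓝 (fun i => Y i j))) ∧
  (∀ t, Tendsto (fun x => diagonal (fun l => Complex.exp (-(Complex.I * θ x t l))) *ᵥ
    (Y⁻¹ *ᵥ ψ x t)) F (𝓝 (Pi.single j 1)))

/-- The Jost eigenfunction singled out by `IsJost`. -/
def jost (A E : ℝ → ℝ → Mat3) (Y : Mat3) (θ : ℝ → ℝ → Fin 3 → ℂ) (F : Filter ℝ) (j : Fin 3) :
    ℝ → ℝ → Fin 3 → ℂ :=
  Classical.epsilon (IsJost A E Y θ F j)

/-- The column `ψ_{-,j}(x, t, z)`. -/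
def psiM (j : Fin 3) (z : ℂ) : ℝ → ℝ → Fin 3 → ℂ :=
  jost (D.laxA (D.kz z)) (D.laxE (D.kz z)) (D.matY D.qM z) (D.phase z) atBot j

/-- The column `ψ_{+,j}(x, t, z)`. -/
def psiP (j : Fin 3) (z : ℂ) : ℝ → ℝ → Fin 3 → ℂ :=
  jost (D.laxA (D.kz z)) (D.laxE (D.kz z)) (D.matY D.qP z) (D.phase z) atTop j

/-- The adjoint column `ψ̃_{-,j}(x, t, z)`. -/
def adjPsiM (j : Fin 3) (z : ℂ) : ℝ → ℝ → Fin 3 → ℂ :=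
  jost (D.adjA (D.kz z)) (D.adjE (D.kz z)) (D.adjY D.qM z) (fun x t => -D.phase z x t) atBot j

/-- The adjoint column `ψ̃_{+,j}(x, t, z)`. -/
def adjPsiP (j : Fin 3) (z : ℂ) : ℝ → ℝ → Fin 3 → ℂ :=
  jost (D.adjA (D.kz z)) (D.adjE (D.kz z)) (D.adjY D.qP z) (fun x t => -D.phase z x t) atTop j

/-- The modified column `ν_{-,j} = ψ_{-,j} e^{-iδ_j}`. -/
def nuM (j : Fin 3) (z : ℂ) (x t : ℝ) : Fin 3 → ℂ :=
  Complex.exp (-(Complex.I * D.phase z x t j)) • D.psiM j z x t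

/-- The modified column `ν_{+,j} = ψ_{+,j} e^{-iδ_j}`. -/
def nuP (j : Fin 3) (z : ℂ) (x t : ℝ) : Fin 3 → ℂ :=
  Complex.exp (-(Complex.I * D.phase z x t j)) • D.psiP j z x t

/-- The matrix with the given columns. -/
def cols (u v w : Fin 3 → ℂ) : Mat3 := (Matrix.of ![u, v, w])ᵀ

def matPsiM (z : ℂ) (x t : ℝ) : Mat3 := cols (D.psiM 0 z x t) (D.psiM 1 z x t) (D.psiM 2 z x t)

def matPsiP (z : ℂ) (x t : ℝ) : Mat3 := cols (D.psiP 0 z x t) (D.psiP 1 z x t) (D.psiP 2 z x t)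

/-! ### Scattering data -/

/-- The scattering matrix on the continuous spectrum, `ψ₋ = ψ₊ S`. -/
def S (z : ℂ) : Mat3 := (D.matPsiP z 0 0)⁻¹ * D.matPsiM z 0 0

/-- `H = S⁻¹`. -/
def H (z : ℂ) : Mat3 := (D.S z)⁻¹

/-- `ρ_j`. -/
def rhoj (j : Fin 3) (z : ℂ) : ℂ := if j = 1 then D.rho z else 1

/-- The diagonal coefficient `s_jj` as an analytic function off the continuous spectrum, through the
Wronskian `det(ψ_{-,j}, ψ_{+,j+1}, ψ_{+,j+2}) = e^{i(δ₁+δ₂+δ₃)} ρ_j ψ̃_{+,j} · ψ_{-,j}`. -/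
def s (j : Fin 3) (z : ℂ) : ℂ :=
  D.rhoj j z / D.rho z * (D.adjPsiP j z 0 0 ⬝ᵥ D.psiM j z 0 0)

/-- The diagonal coefficient `h_jj` as an analytic function off the continuous spectrum. -/
def h (j : Fin 3) (z : ℂ) : ℂ :=
  D.rhoj j z / D.rho z * (D.adjPsiM j z 0 0 ⬝ᵥ D.psiP j z 0 0)

/-- The reflection coefficient `α₁ = s₂₁/s₁₁`. -/
def alpha1 (z : ℂ) : ℂ := D.S z 1 0 / D.S z 0 0

/-- The reflection coefficient `α₂ = s₃₁/s₁₁`. -/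
def alpha2 (z : ℂ) : ℂ := D.S z 2 0 / D.S z 0 0

/-- The reflection coefficient `α₃ = s₃₂/s₂₂`. -/
def alpha3 (z : ℂ) : ℂ := D.S z 2 1 / D.S z 1 1

/-! ### Auxiliary eigenfunctions -/

def mu1 (z : ℂ) (x t : ℝ) : Fin 3 → ℂ :=
  D.expSum z x t • crossProduct (D.adjPsiP 0 z x t) (D.adjPsiM 1 z x t)

def mu2 (z : ℂ) (x t : ℝ) : Fin 3 → ℂ :=
  D.expSum z x t • crossProduct (D.adjPsiM 0 z x t) (D.adjPsiP 1 z x t)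

def mu3 (z : ℂ) (x t : ℝ) : Fin 3 → ℂ :=
  D.expSum z x t • crossProduct (D.adjPsiP 1 z x t) (D.adjPsiM 2 z x t)

def mu4 (z : ℂ) (x t : ℝ) : Fin 3 → ℂ :=
  D.expSum z x t • crossProduct (D.adjPsiM 1 z x t) (D.adjPsiP 2 z x t)

def c1 (z : ℂ) (x t : ℝ) : Fin 3 → ℂ :=
  Complex.exp (-(Complex.I * D.phase z x t 2)) • D.mu1 z x t

def c2 (z : ℂ) (x t : ℝ) : Fin 3 → ℂ :=
  Complex.exp (-(Complex.I * D.phase z x t 2)) • D.mu2 z x t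

def c3 (z : ℂ) (x t : ℝ) : Fin 3 → ℂ :=
  Complex.exp (-(Complex.I * D.phase z x t 0)) • D.mu3 z x t

def c4 (z : ℂ) (x t : ℝ) : Fin 3 → ℂ :=
  Complex.exp (-(Complex.I * D.phase z x t 0)) • D.mu4 z x t

/-! ### Regions and contours -/

def U1 : Set ℂ := {z | 0 < z.im ∧ D.q0 < ‖z‖}

def U2 : Set ℂ := {z | z.im < 0 ∧ D.q0 < ‖z‖}

def U3 : Set ℂ := {z | z.im < 0 ∧ ‖z‖ < D.q0}

def U4 : Set ℂ := {z | 0 < z.im ∧ ‖z‖ < D.q0}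

/-- The branch points `±iq₀` and the origin. -/
def exceptional : Set ℂ := {0, Complex.I * D.q0, -(Complex.I * D.q0)}

/-- The open upper and lower half planes without the branch points. -/
def upper : Set ℂ := {z | 0 < z.im} \ D.exceptional

def lower : Set ℂ := {z | z.im < 0} \ D.exceptional

/-- `Σ_j` is the common boundary of `U_j` and `U_{j+1}` (indices modulo 4), the exceptional points
removed. -/
def Sigma1 : Set ℂ := {z | z.im = 0 ∧ D.q0 ≤ ‖z‖} \ D.exceptional

def Sigma2 : Set ℂ := {z | ‖z‖ = D.q0 ∧ z.im ≤ 0} \ D.exceptional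

def Sigma3 : Set ℂ := {z | z.im = 0 ∧ ‖z‖ ≤ D.q0} \ D.exceptional

def Sigma4 : Set ℂ := {z | ‖z‖ = D.q0 ∧ 0 ≤ z.im} \ D.exceptional

/-- `Σ = ℝ ∪ C₀` without the exceptional points. -/
def Sigma : Set ℂ := {z | z.im = 0 ∨ ‖z‖ = D.q0} \ D.exceptional

/-- `g` is analytic on `U`, extends continuously to the boundary away from the exceptional points,
and agrees with `f` on the real part of the boundary. -/
def Continues (f g : ℂ → ℂ) (U : Set ℂ) : Prop :=
  AnalyticOnNhd ℂ g U ∧ ContinuousOn g (closure U \ D.exceptional) ∧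
    ∀ z ∈ closure U \ D.exceptional, z.im = 0 → g z = f z

/-! ### The sectionally meromorphic matrix -/

def Psi1 (z : ℂ) (x t : ℝ) : Mat3 := cols (D.psiM 0 z x t) (D.psiP 1 z x t) (D.mu1 z x t)

def Psi2 (z : ℂ) (x t : ℝ) : Mat3 := cols (D.psiP 0 z x t) (D.psiM 1 z x t) (D.mu2 z x t)

def Psi3 (z : ℂ) (x t : ℝ) : Mat3 := cols (D.mu3 z x t) (D.psiM 1 z x t) (D.psiP 2 z x t)

def Psi4 (z : ℂ) (x t : ℝ) : Mat3 := cols (D.mu4 z x t) (D.psiP 1 z x t) (D.psiM 2 z x t)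

def B1 (x t : ℝ) (z : ℂ) : Mat3 :=
  D.Psi1 z x t * D.expNegO z x t * diagonal ![1 / D.s 0 z, 1, 1 / D.h 1 z]

def B2 (x t : ℝ) (z : ℂ) : Mat3 :=
  D.Psi2 z x t * D.expNegO z x t * diagonal ![1, 1 / D.s 1 z, 1 / D.h 0 z]

def B3 (x t : ℝ) (z : ℂ) : Mat3 :=
  D.Psi3 z x t * D.expNegO z x t * diagonal ![1 / D.h 2 z, 1 / D.s 1 z, 1]

def B4 (x t : ℝ) (z : ℂ) : Mat3 :=
  D.Psi4 z x t * D.expNegO z x t * diagonal ![1 / D.h 1 z, 1, 1 / D.s 2 z]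

/-! ### The jump matrices -/

/-- `χ_j(z) = α_j(z*)*`. -/
def chi (a : ℂ → ℂ) (z : ℂ) : ℂ := conj (a (conj z))

/-- `α̂_j(z) = α_j(-q₀²/z)`. -/
def hatted (a : ℂ → ℂ) (z : ℂ) : ℂ := a (D.hat z)

/-- `χ̂_j(z) = α_j(-q₀²/z*)*`. -/
def hatChi (a : ℂ → ℂ) (z : ℂ) : ℂ := conj (a (D.hat (conj z)))

def L1 (z : ℂ) : Mat3 :=
  let ρ := D.rho z
  let c := Complex.I * z / D.q0
  let a1 := D.alpha1 z
  let a2 := D.alpha2 z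
  let a3 := D.alpha3 z
  let a3' := D.hatted D.alpha3 z
  let χ2 := chi D.alpha2 z
  let χ3 := chi D.alpha3 z
  !![(a1 * a3 - a2) * χ2 + c * a1 * a3', a3 * χ2 + c * a3',
       -(1 + ρ * a3 * χ3) * χ2 - c * ρ * a3' * χ3;
     -a1, 0, ρ * χ3;
     a1 * a3 - a2, a3, -ρ * a3 * χ3]

def L2 (z : ℂ) : Mat3 :=
  let χ2 := chi D.alpha2 z
  let χ2' := D.hatChi D.alpha2 z
  !![χ2 * χ2', 0, -χ2; 0, 0, 0; χ2', 0, 0]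

def L3 (z : ℂ) : Mat3 :=
  let ρ := D.rho z
  let c := Complex.I * z / D.q0
  let d := Complex.I * D.q0 / z
  let a3 := D.alpha3 z
  let a1' := D.hatted D.alpha1 z
  let a2' := D.hatted D.alpha2 z
  let a3' := D.hatted D.alpha3 z
  let χ2' := D.hatChi D.alpha2 z
  let χ3' := D.hatChi D.alpha3 z
  !![-a2' * χ2', a3 * a2' - c * a3', a2';
     d * a1' * χ2' + c * ρ * χ3' * (1 + a2' * χ2'),
       -d * a3 * a1' - z ^ 2 * ρ / (D.q0 : ℂ) ^ 2 * a3' * χ3' - c * ρ * a3 * a2' * χ3',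
       -d * a1' - c * ρ * a2' * χ3';
     χ2', -a3, 0]

def L4 (z : ℂ) : Mat3 :=
  let ρ := D.rho z
  let c := Complex.I * z / D.q0
  let d := Complex.I * D.q0 / z
  let a1 := D.alpha1 z
  let a2 := D.alpha2 z
  let a1' := D.hatted D.alpha1 z
  let a2' := D.hatted D.alpha2 z
  let χ3 := chi D.alpha3 z
  let χ3' := D.hatChi D.alpha3 z
  !![a2 * a2', 0, a2';
     c * ρ * χ3' * (1 - a2 * a2') - d * a2 * a1' - a1, 0, ρ * χ3 - d * a1' - c * ρ * a2' * χ3';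
     -a2, 0, 0]

end Data

end LPD

end

noncomputable section
open MeasureTheory Set

namespace LPD

/-! ### Volterra equations on a half line -/

/-! At either end of the line the Lax matrices tend to constant matrices that `Y` diagonalizes
simultaneously, with eigenvalues given by the coefficients of `x` and `t` in the phases `δ_j`
(`bdryA_mul_matY`, `bdryE_mul_matY`). After the substitution `ψ = Y e^{iγ} w` the spatial equation
becomes `w' = d w + B w` with `B` integrable towards the end. The reflection `y = εx` moves that end
to `-∞`. If `Re d ≤ 0`, the Volterra equation for `w` is solved by a Neumann series that contracts
by 1/2 in a weighted norm. The same contraction gives uniqueness, and the uniform geometric bound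
gives continuity and holomorphy in `z`.

There are two gauges. Removing the single phase `δ_j` needs no weight, but requires `δ_j` to be
extremal; this is the case in the regions where the column is analytic. Removing all phases makes `d
= 0`, but the perturbation is conjugated by growing exponentials, which the weight `e^{|Im z||x|}`
has to absorb. The second gauge supplies the missing columns on the circle `|z| = q₀`; at real `z`
weight zero is enough.

A spatial solution at time zero is continued along `ψ_t = Eψ`. The differential equation is
equivalent to zero curvature off the diagonal blocks, and zero curvature makes the spatial equation
persist (`hasDerivAt_of_zero_curvature`). The normalization persists because `e_j` is stationary for
the limiting evolution (`tendsto_of_evolution`). By uniqueness the joint solution at each `t` is the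
Volterra solution for that `t`, so its dependence on `z` can be studied at fixed `x, t`.

Since `Ã = -Aᵗ` and `Ẽ = -Eᵗ`, the bilinear pairing of an adjoint with a direct solution is
constant. For solutions normalized at the same end its value is `diag(ρ, 1, ρ)`. This inverts `Ψ`,
gives the scattering relation, and identifies the diagonal entries of `S` and `H` with the pairings
that define `s_jj` and `h_jj`. Those pairings are analytic wherever both of their factors are.

For the jumps, `det Ψ = ρ e^{i(δ₁+δ₂+δ₃)}` turns cross products of adjoint columns into combinations
of columns of `Ψ₊` with entries of `H` as coefficients. Hence `B_j = Ψ₊ M_j e^{-iΩ}` with an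
explicit `M_j`, and a jump relation reduces to `M = M'(I - L)`. Conjugation (`S(z*)*` is `Hᵗ` up to
weights) and the involution `z ↦ -q₀²/z` (which exchanges the indices 1 and 3) express all
reflection coefficients through `S(z)` and `H(z)`. As `det S = 1`, `H` is the adjugate of `S`, and
what is left are rational identities in the entries of `S`. -/

theorem continuous_integral_Iic {f : ℝ → ℂ} (hf : ∀ a, IntegrableOn f (Iic a)) :
    Continuous fun x => ∫ y in Iic x, f y := by
  have h : (fun x => ∫ y in Iic x, f y) = fun x => (∫ y in Iic 0, f y) + ∫ y in (0:ℝ)..x, f y := by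
    funext x
    rw [← intervalIntegral.integral_Iic_sub_Iic (hf 0) (hf x)]; ring
  rw [h]
  refine continuous_const.add (intervalIntegral.continuous_primitive (fun a b => ?_) 0)
  exact ((hf (max a b)).mono_set fun y hy => hy.2).intervalIntegrable

theorem hasDerivAt_integral_Iic {E : Type*} [NormedAddCommGroup E] [NormedSpace ℝ E]
    [CompleteSpace E] {f : ℝ → E} (hf : ∀ a, IntegrableOn f (Iic a))
    (hc : Continuous f) (x : ℝ) : HasDerivAt (fun x => ∫ y in Iic x, f y) (f x) x := by
  have h : (fun x => ∫ y in Iic x, f y) = fun x => (∫ y in Iic 0, f y) + ∫ y in (0:ℝ)..x, f y := by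
    funext x
    rw [← intervalIntegral.integral_Iic_sub_Iic (hf 0) (hf x)]; abel
  rw [h]
  exact (intervalIntegral.integral_hasDerivAt_right (hc.intervalIntegrable _ _)
    (hc.stronglyMeasurableAtFilter _ _) hc.continuousAt).const_add _

/-- The weight `exp (2 ∫_{-∞}^x b)`. -/
def expWeight (b : ℝ → ℝ) (x : ℝ) : ℝ := Real.exp (2 * ∫ y in Iic x, b y)

/-- Integrability is asked on left half lines only, so the weight is finite at every point but may
be unbounded towards `+∞`. -/
structure IsMajorant (b : ℝ → ℝ) : Prop where
  nonneg : ∀ y, 0 ≤ b y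
  cont : Continuous b
  integrable : ∀ a, IntegrableOn b (Iic a)

namespace IsMajorant
variable {b : ℝ → ℝ}

theorem monotone_weight (hb : IsMajorant b) : Monotone (expWeight b) := fun x y hxy => by
  refine Real.exp_le_exp.2 (mul_le_mul_of_nonneg_left ?_ zero_le_two)
  exact setIntegral_mono_set (hb.integrable y) (ae_of_all _ hb.nonneg)
    (Iic_subset_Iic.2 hxy).eventuallyLE

theorem continuous_weight (hb : IsMajorant b) : Continuous (expWeight b) :=
  Real.continuous_exp.comp (continuous_const.mul
    (continuous_iff_continuousAt.2 fun x => 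
      (hasDerivAt_integral_Iic hb.integrable hb.cont x).continuousAt))

theorem one_le_weight (hb : IsMajorant b) (x : ℝ) : 1 ≤ expWeight b x :=
  Real.one_le_exp (mul_nonneg zero_le_two (setIntegral_nonneg measurableSet_Iic fun y _ => hb.nonneg y))

theorem integrableOn_mul_weight (hb : IsMajorant b) (a : ℝ) : IntegrableOn (fun y => b y * expWeight b y) (Iic a) := by
  refine Integrable.mono' ((hb.integrable a).mul_const (expWeight b a))
    (hb.cont.mul hb.continuous_weight).aestronglyMeasurable ?_
  refine ae_restrict_of_forall_mem measurableSet_Iic fun y hy => ?_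
  rw [Real.norm_of_nonneg (mul_nonneg (hb.nonneg y) (zero_le_one.trans (hb.one_le_weight y)))]
  exact mul_le_mul_of_nonneg_left (hb.monotone_weight hy) (hb.nonneg y)

/-- With `W = expWeight b` one has `W' = 2bW` and `W → 1` at `-∞`, so the integral is `(W(x) -
1)/2`. The 2 in the exponent of the weight is there to produce this factor 1/2, the contraction
constant of the Volterra operator. -/
theorem integral_mul_weight_le (hb : IsMajorant b) (x : ℝ) :
    ∫ y in Iic x, b y * expWeight b y ≤ expWeight b x / 2 := by
  have h1 : ∀ y ∈ Iic x, HasDerivAt (fun y => expWeight b y / 2) (b y * expWeight b y) y := by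
    intro y _
    have := (((hasDerivAt_integral_Iic hb.integrable hb.cont y).const_mul 2).exp).div_const 2
    refine this.congr_deriv ?_
    simp only [expWeight]; ring
  have h2 : Tendsto (fun y => expWeight b y / 2) atBot (𝓝 (1 / 2)) := by
    have := tendsto_integral_Iic_zero (μ := volume) (f := b) tendsto_id
    have := ((this.const_mul 2).rexp).div_const 2
    simpa [expWeight] using this
  rw [integral_Iic_of_hasDerivAt_of_tendsto' h1 (hb.integrableOn_mul_weight x) h2]
  linarith

end IsMajorant

variable {ι : Type*} [Fintype ι]

theorem norm_exp_mul_ofReal (a : ℂ) (x : ℝ) : ‖Complex.exp (a * x)‖ = Real.exp (a.re * x) := by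
  rw [Complex.norm_exp]; simp

/-- `b` dominates the coefficient `B` of the equation `w' = d w + B w`, whose unperturbed part `d`
does not decay at `-∞`. -/
structure Dominates (b : ℝ → ℝ) (d : ι → ℂ) (B : ℝ → Matrix ι ι ℂ) : Prop extends IsMajorant b where
  re_nonpos : ∀ i, (d i).re ≤ 0
  meas : ∀ i j, Measurable fun y => B y i j
  bound : ∀ y v, ‖B y *ᵥ v‖ ≤ b y * ‖v‖

def volterraStep (d : ι → ℂ) (B : ℝ → Matrix ι ι ℂ) (w : ℝ → ι → ℂ) (x : ℝ) : ι → ℂ :=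
  fun i => ∫ y in Iic x, Complex.exp (d i * (x - y : ℝ)) * (B y *ᵥ w y) i

def volterraTerm (d : ι → ℂ) (B : ℝ → Matrix ι ι ℂ) (c : ι → ℂ) : ℕ → ℝ → ι → ℂ
  | 0 => fun _ => c
  | n + 1 => volterraStep d B (volterraTerm d B c n)

/-- The Neumann series of the Volterra equation `w(x) = c + ∫_{-∞}^x e^{d(x-y)} B(y) w(y) dy`. -/
def volterra (d : ι → ℂ) (B : ℝ → Matrix ι ι ℂ) (c : ι → ℂ) (x : ℝ) : ι → ℂ :=
  fun i => ∑' n, volterraTerm d B c n x i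

namespace Dominates
variable {b : ℝ → ℝ} {d : ι → ℂ} {B : ℝ → Matrix ι ι ℂ}

theorem norm_kernel_le (hB : Dominates b d B) {x y : ℝ} (hy : y ≤ x) {v : ι → ℂ} {M : ℝ} (hv : ‖v‖ ≤ M) (i : ι) :
    ‖Complex.exp (d i * (x - y : ℝ)) * (B y *ᵥ v) i‖ ≤ b y * M := by
  rw [norm_mul, norm_exp_mul_ofReal]
  have h1 : Real.exp ((d i).re * (x - y)) ≤ 1 :=
    Real.exp_le_one_iff.2 (mul_nonpos_of_nonpos_of_nonneg (hB.re_nonpos i) (sub_nonneg.2 hy))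
  have h2 : ‖(B y *ᵥ v) i‖ ≤ b y * M :=
    (norm_le_pi_norm _ i).trans ((hB.bound y v).trans (mul_le_mul_of_nonneg_left hv (hB.nonneg y)))
  calc _ ≤ 1 * ‖(B y *ᵥ v) i‖ := mul_le_mul_of_nonneg_right h1 (norm_nonneg _)
    _ ≤ _ := by rw [one_mul]; exact h2

/-- In the norm `sup ‖w‖/W` the Volterra operator has norm at most 1/2, however large `b` is. The
operator is causal, so a bound on `w` to the left of `x` suffices. -/
theorem norm_step_le (hB : Dominates b d B) {w : ℝ → ι → ℂ} {M x : ℝ} (hM : 0 ≤ M)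
    (hw : ∀ y ≤ x, ‖w y‖ ≤ M * expWeight b y) :
    ‖volterraStep d B w x‖ ≤ M / 2 * expWeight b x := by
  have h0 := zero_le_one.trans (hB.one_le_weight x)
  refine (pi_norm_le_iff_of_nonneg (by positivity)).2 fun i => ?_
  have h1 : ‖volterraStep d B w x i‖ ≤ ∫ y in Iic x, M * (b y * expWeight b y) := by
    refine norm_integral_le_of_norm_le ((hB.integrableOn_mul_weight x).const_mul M) ?_
    refine ae_restrict_of_forall_mem measurableSet_Iic fun y hy => ?_
    refine (hB.norm_kernel_le hy (hw y hy) i).trans (le_of_eq (by ring))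
  rw [integral_const_mul] at h1
  refine h1.trans ((mul_le_mul_of_nonneg_left (hB.integral_mul_weight_le x) hM).trans ?_)
  exact le_of_eq (by ring)

theorem measurable_mulVec (hB : Dominates b d B) {w : ℝ → ι → ℂ} (hw : Continuous w) (i : ι) :
    Measurable fun y => (B y *ᵥ w y) i := by
  simp only [mulVec, dotProduct]
  exact Finset.measurable_sum _ fun j _ =>
    (hB.meas i j).mul ((continuous_apply j).comp hw).measurable

theorem integrableOn_kernel (hB : Dominates b d B) {w : ℝ → ι → ℂ} (hw : Continuous w) {M : ℝ}
    (hM : ∀ y, ‖w y‖ ≤ M * expWeight b y) (i : ι) (x a : ℝ) :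
    IntegrableOn (fun y => Complex.exp (d i * (x - y : ℝ)) * (B y *ᵥ w y) i) (Iic a) := by
  refine Integrable.mono'
    (((hB.integrableOn_mul_weight a).const_mul M).const_mul ‖Complex.exp (d i * (x - a : ℝ))‖) ?_ ?_
  · exact (Measurable.mul (by fun_prop) (hB.measurable_mulVec hw i)).aestronglyMeasurable
  · refine ae_restrict_of_forall_mem measurableSet_Iic fun y hy => ?_
    have h1 : Complex.exp (d i * (x - y : ℝ)) =
        Complex.exp (d i * (x - a : ℝ)) * Complex.exp (d i * (a - y : ℝ)) := by
      rw [← Complex.exp_add]; congr 1; push_cast; ring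
    rw [h1, mul_assoc, norm_mul]
    refine mul_le_mul_of_nonneg_left ?_ (norm_nonneg _)
    exact (hB.norm_kernel_le hy (hM y) i).trans (le_of_eq (by ring))

/-- Once `e^{dx}` is pulled out, the integral is a primitive of a function that does not involve
`x`. Continuity and differentiability of the step follow from those of the primitive. -/
theorem step_eq (w : ℝ → ι → ℂ) (x : ℝ) (i : ι) : volterraStep d B w x i = Complex.exp (d i * x) *
    ∫ y in Iic x, Complex.exp (d i * (0 - y : ℝ)) * (B y *ᵥ w y) i := by
  rw [volterraStep, ← integral_const_mul]
  refine integral_congr_ae (ae_of_all _ fun y => ?_)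
  simp only [← mul_assoc, ← Complex.exp_add]
  congr 2; push_cast; ring

theorem continuous_step (hB : Dominates b d B) {w : ℝ → ι → ℂ} (hw : Continuous w) {M : ℝ}
    (hM : ∀ y, ‖w y‖ ≤ M * expWeight b y) : Continuous (volterraStep d B w) := by
  refine continuous_pi fun i => ?_
  simp only [step_eq]
  exact (by fun_prop : Continuous fun x : ℝ => Complex.exp (d i * x)).mul
    (continuous_integral_Iic fun a => hB.integrableOn_kernel hw hM i 0 a)

theorem term_spec (hB : Dominates b d B) (c : ι → ℂ) (n : ℕ) : Continuous (volterraTerm d B c n) ∧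
    ∀ x, ‖volterraTerm d B c n x‖ ≤ ‖c‖ * (1 / 2) ^ n * expWeight b x := by
  induction n with
  | zero =>
    refine ⟨continuous_const, fun x => ?_⟩
    simpa [volterraTerm] using le_mul_of_one_le_right (norm_nonneg c) (hB.one_le_weight x)
  | succ n ih =>
    refine ⟨hB.continuous_step ih.1 ih.2, fun x => ?_⟩
    refine (hB.norm_step_le (by positivity) fun y _ => ih.2 y).trans (le_of_eq ?_)
    rw [pow_succ]; ring

theorem norm_term_le (hB : Dominates b d B) (c : ι → ℂ) (n : ℕ) (i : ι) {x a : ℝ} (h : x ≤ a) :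
    ‖volterraTerm d B c n x i‖ ≤ ‖c‖ * (1 / 2) ^ n * expWeight b a :=
  (norm_le_pi_norm _ i).trans (((hB.term_spec c n).2 x).trans
    (mul_le_mul_of_nonneg_left (hB.monotone_weight h) (by positivity)))

theorem summable_majorant (c : ι → ℂ) (r : ℝ) : Summable fun n : ℕ => ‖c‖ * (1 / 2) ^ n * r :=
  (summable_geometric_two.mul_left ‖c‖).mul_right r

theorem hasSum_term (hB : Dominates b d B) (c : ι → ℂ) (x : ℝ) (i : ι) :
    HasSum (fun n => volterraTerm d B c n x i) (volterra d B c x i) :=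
  (Summable.of_norm_bounded (summable_majorant c (expWeight b x))
    fun n => hB.norm_term_le c n i le_rfl).hasSum

theorem continuous_volterra (hB : Dominates b d B) (c : ι → ℂ) : Continuous (volterra d B c) := by
  refine continuous_pi fun i => continuous_iff_continuousAt.2 fun x => ?_
  have : ContinuousOn (fun x => volterra d B c x i) (Iic (x + 1)) :=
    continuousOn_tsum (fun n => ((continuous_apply i).comp (hB.term_spec c n).1).continuousOn)
      (summable_majorant c (expWeight b (x + 1))) fun n y hy => hB.norm_term_le c n i hy
  exact this.continuousAt (Iic_mem_nhds (lt_add_one x))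

theorem norm_volterra_le (hB : Dominates b d B) (c : ι → ℂ) (x : ℝ) : ‖volterra d B c x‖ ≤ 2 * ‖c‖ * expWeight b x := by
  have h0 := zero_le_one.trans (hB.one_le_weight x)
  refine (pi_norm_le_iff_of_nonneg (by positivity)).2 fun i => ?_
  refine tsum_of_norm_bounded (g := fun n : ℕ => ‖c‖ * (1 / 2) ^ n * expWeight b x) ?_
    fun n => hB.norm_term_le c n i le_rfl
  have := (hasSum_geometric_two.mul_left ‖c‖).mul_right (expWeight b x)
  rwa [mul_comm ‖c‖ 2] at this

/-- The sum and the integral may be exchanged because the `L¹` norms of the summands on `Iic x` are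
dominated by a geometric series. -/
theorem volterra_eq (hB : Dominates b d B) (c : ι → ℂ) (x : ℝ) :
    volterra d B c x = c + volterraStep d B (volterra d B c) x := by
  funext i
  have h1 : ∀ y, HasSum (fun n => Complex.exp (d i * (x - y : ℝ)) * (B y *ᵥ volterraTerm d B c n y) i)
      (Complex.exp (d i * (x - y : ℝ)) * (B y *ᵥ volterra d B c y) i) := fun y => by
    refine HasSum.mul_left _ ?_
    simp only [mulVec, dotProduct]
    exact hasSum_sum fun j _ => (hB.hasSum_term c y j).mul_left _
  have h2 : HasSum (fun n => volterraTerm d B c (n + 1) x i)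
      (volterraStep d B (volterra d B c) x i) := by
    have := hasSum_integral_of_summable_integral_norm (μ := volume.restrict (Iic x))
      (F := fun n y => Complex.exp (d i * (x - y : ℝ)) * (B y *ᵥ volterraTerm d B c n y) i)
      (fun n => hB.integrableOn_kernel (hB.term_spec c n).1 (hB.term_spec c n).2 i x x) ?_
    · have h5 : (fun y : ℝ => ∑' n, Complex.exp (d i * (x - y : ℝ)) *
          (B y *ᵥ volterraTerm d B c n y) i) =
          fun y => Complex.exp (d i * (x - y : ℝ)) * (B y *ᵥ volterra d B c y) i :=
        funext fun y => (h1 y).tsum_eq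
      rw [h5] at this
      exact this
    · refine Summable.of_nonneg_of_le (fun n => integral_nonneg fun y => norm_nonneg _) (fun n => ?_)
        (summable_majorant c (expWeight b x / 2))
      have hi := (hB.integrableOn_mul_weight x).const_mul (‖c‖ * (1 / 2) ^ n)
      refine (integral_mono_of_nonneg (ae_of_all _ fun y => norm_nonneg _) hi
        (ae_restrict_of_forall_mem measurableSet_Iic fun y hy =>
          (hB.norm_kernel_le hy ((hB.term_spec c n).2 y) i).trans (le_of_eq (by ring)))).trans ?_
      rw [integral_const_mul]
      exact mul_le_mul_of_nonneg_left (hB.integral_mul_weight_le x) (by positivity)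
  have h3 := (hasSum_nat_add_iff' (f := fun n => volterraTerm d B c n x i) 1).2 (hB.hasSum_term c x i)
  have h4 := h3.unique h2
  simp only [Finset.range_one, Finset.sum_singleton] at h4
  rw [Pi.add_apply, ← h4]
  simp [volterraTerm]

/-- For bounded `w` the step is at most a constant times the tail `∫_{-∞}^x b`. -/
theorem tendsto_step (hB : Dominates b d B) {w : ℝ → ι → ℂ} {M a : ℝ} (hM : ∀ y ≤ a, ‖w y‖ ≤ M) :
    Tendsto (volterraStep d B w) atBot (𝓝 0) := by
  have h : Tendsto (fun x => (∫ y in Iic x, b y) * M) atBot (𝓝 0) := by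
    simpa using (tendsto_integral_Iic_zero (μ := volume) (f := b) tendsto_id).mul_const M
  refine squeeze_zero_norm' ?_ h
  filter_upwards [Iic_mem_atBot a] with x hx
  have hM0 : 0 ≤ M := (norm_nonneg _).trans (hM x hx)
  refine (pi_norm_le_iff_of_nonneg (mul_nonneg (setIntegral_nonneg measurableSet_Iic
    fun y _ => hB.nonneg y) hM0)).2 fun i => ?_
  rw [← integral_mul_const]
  refine norm_integral_le_of_norm_le ((hB.integrable x).mul_const M) ?_
  exact ae_restrict_of_forall_mem measurableSet_Iic fun y hy =>
    hB.norm_kernel_le hy (hM y (le_trans hy hx)) i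

theorem tendsto_volterra (hB : Dominates b d B) (c : ι → ℂ) : Tendsto (volterra d B c) atBot (𝓝 c) := by
  have := hB.tendsto_step (w := volterra d B c) (a := 0) (M := 2 * ‖c‖ * expWeight b 0) fun y hy =>
    (hB.norm_volterra_le c y).trans
      (mul_le_mul_of_nonneg_left (hB.monotone_weight hy) (by positivity))
  have := this.const_add c
  rw [add_zero] at this
  exact this.congr fun x => (hB.volterra_eq c x).symm

theorem hasDerivAt_exp_mul (a : ℂ) (x : ℝ) :
    HasDerivAt (fun x : ℝ => Complex.exp (a * x)) (a * Complex.exp (a * x)) x := by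
  have := ((Complex.ofRealCLM.hasDerivAt (x := x)).const_mul a).cexp
  simpa [mul_comm] using this

/-- The inhomogeneity of the Volterra equation is the constant `c`, not `e^{dx} c`. It solves `w' =
d w` exactly when `d_i c_i = 0`, which is the role of `hc`. -/
theorem hasDerivAt_volterra (hB : Dominates b d B) (hBc : Continuous B) (c : ι → ℂ) (hc : ∀ i, d i * c i = 0) (x : ℝ) :
    HasDerivAt (volterra d B c)
      (fun i => d i * volterra d B c x i + (B x *ᵥ volterra d B c x) i) x := by
  refine hasDerivAt_pi.2 fun i => ?_
  have hcont := hB.continuous_volterra c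
  have h1 : (fun x => volterra d B c x i) = fun x : ℝ => c i + Complex.exp (d i * x) *
      ∫ y in Iic x, Complex.exp (d i * (0 - y : ℝ)) * (B y *ᵥ volterra d B c y) i := by
    funext x
    rw [hB.volterra_eq c x, Pi.add_apply, step_eq]
  have h2 := hasDerivAt_integral_Iic (fun a => hB.integrableOn_kernel hcont
    (hB.norm_volterra_le c) i 0 a) (Continuous.mul (by fun_prop)
      ((continuous_apply i).comp (hBc.matrix_mulVec hcont))) x
  have h3 := ((hasDerivAt_exp_mul (d i) x).mul h2).const_add (c i)
  have h5 : Complex.exp (d i * x) * Complex.exp (d i * (0 - x : ℝ)) = 1 := by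
    rw [← Complex.exp_add, ← Complex.exp_zero]; congr 1; push_cast; ring
  rw [h1]
  refine h3.congr_deriv ?_
  have h4 := congrFun h1 x
  rw [h4]
  linear_combination (B x *ᵥ volterra d B c x) i * h5 + (-1) * hc i

/-- A solution of `w' = d w + B w` that vanishes at `-∞` is zero. -/
theorem eq_zero_of_tendsto (hB : Dominates b d B) {w : ℝ → ι → ℂ}
    (hw : ∀ x, HasDerivAt w (fun i => d i * w x i + (B x *ᵥ w x) i) x)
    (h0 : Tendsto w atBot (𝓝 0)) (x : ℝ) : w x = 0 := by
  have hcont : Continuous w := continuous_iff_continuousAt.2 fun x => (hw x).continuousAt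
  -- Bounded near `-∞` by the limit, and by compactness on the remaining interval.
  obtain ⟨M, hM⟩ : ∃ M, ∀ y ≤ x, ‖w y‖ ≤ M := by
    obtain ⟨a, ha⟩ := mem_atBot_sets.1 (h0.norm.eventually (gt_mem_nhds (by simp : ‖(0 : ι → ℂ)‖ < 1)))
    obtain ⟨C, hC⟩ := isCompact_Icc.exists_bound_of_continuousOn (s := Icc a x) hcont.continuousOn
    refine ⟨max 1 C, fun y hy => ?_⟩
    rcases le_total y a with h | h
    · exact (le_of_lt (ha y h)).trans (le_max_left _ _)
    · exact (hC y ⟨h, hy⟩).trans (le_max_right _ _)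
  have hM0 : 0 ≤ M := (norm_nonneg _).trans (hM x le_rfl)
  -- Variation of constants: `e^{d(y-u)} w(u)` is integrated over `u ≤ y`. The boundary term at `-∞`
  -- vanishes because the exponential has modulus at most 1.
  have hfix : ∀ y ≤ x, w y = volterraStep d B w y := by
    intro y hy
    funext i
    have e : ∀ u : ℝ, HasDerivAt (fun u : ℝ => Complex.exp (d i * (y - u : ℝ)) * w u i)
        (Complex.exp (d i * (y - u : ℝ)) * (B u *ᵥ w u) i) u := by
      intro u
      have h1 : HasDerivAt (fun u : ℝ => Complex.exp (d i * (y - u : ℝ)))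
          (-(d i) * Complex.exp (d i * (y - u : ℝ))) u := by
        have := (((hasDerivAt_id u).const_sub y).ofReal_comp.const_mul (d i)).cexp
        refine this.congr_deriv ?_
        simp; ring
      refine (h1.mul (hasDerivAt_pi.1 (hw u) i)).congr_deriv ?_
      ring
    have hint : IntegrableOn (fun u : ℝ => Complex.exp (d i * (y - u : ℝ)) * (B u *ᵥ w u) i)
        (Iic y) := by
      refine Integrable.mono' ((hB.integrable y).mul_const M)
        (Measurable.mul (by fun_prop) (hB.measurable_mulVec hcont i)).aestronglyMeasurable ?_
      exact ae_restrict_of_forall_mem measurableSet_Iic fun u hu =>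
        hB.norm_kernel_le hu (hM u (le_trans hu hy)) i
    have hlim : Tendsto (fun u : ℝ => Complex.exp (d i * (y - u : ℝ)) * w u i) atBot (𝓝 0) := by
      refine squeeze_zero_norm' ?_ (by simpa using h0.norm)
      filter_upwards [Iic_mem_atBot y] with u hu
      rw [norm_mul, norm_exp_mul_ofReal]
      refine (mul_le_mul_of_nonneg_right (Real.exp_le_one_iff.2 (mul_nonpos_of_nonpos_of_nonneg
        (hB.re_nonpos i) (sub_nonneg.2 hu))) (norm_nonneg _)).trans ?_
      rw [one_mul]; exact norm_le_pi_norm _ i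
    have := integral_Iic_of_hasDerivAt_of_tendsto' (fun u _ => e u) hint hlim
    rw [volterraStep, this]; simp
  -- Since `w` is a fixed point of the step, each application of the contraction halves the bound.
  have hn : ∀ n : ℕ, ∀ y ≤ x, ‖w y‖ ≤ M * (1 / 2) ^ n * expWeight b y := by
    intro n
    induction n with
    | zero =>
      intro y hy
      refine (hM y hy).trans ?_
      simpa using le_mul_of_one_le_right hM0 (hB.one_le_weight y)
    | succ n ih =>
      intro y hy
      rw [hfix y hy]
      refine (hB.norm_step_le (by positivity) fun u hu => ih u (le_trans hu hy)).trans (le_of_eq ?_)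
      rw [pow_succ]; ring
  have hl : Tendsto (fun n : ℕ => M * (1 / 2) ^ n * expWeight b x) atTop (𝓝 0) := by
    simpa using ((tendsto_pow_atTop_nhds_zero_of_lt_one (r := (1 / 2 : ℝ)) (by norm_num)
      (by norm_num)).const_mul M).mul_const (expWeight b x)
  exact norm_le_zero_iff.1 (ge_of_tendsto' hl fun n => hn n x le_rfl)

end Dominates

end LPD

namespace LPD

/-! ### Dependence on a parameter -/

/-- A bound on the integrand alone suffices: by Cauchy's estimate it controls the derivative on a
smaller disc, and differentiation under the integral sign applies. -/
theorem differentiableOn_integral {α : Type*} [MeasurableSpace α] {μ : Measure α} {K : Set ℂ}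
    (hK : IsOpen K) {f : ℂ → α → ℂ} {g : α → ℝ}
    (hmeas : ∀ z ∈ K, AEStronglyMeasurable (f z) μ) (hg : Integrable g μ)
    (hbound : ∀ᵐ y ∂μ, ∀ z ∈ K, ‖f z y‖ ≤ g y)
    (hf : ∀ y, DifferentiableOn ℂ (fun z => f z y) K) :
    DifferentiableOn ℂ (fun z => ∫ y, f z y ∂μ) K := by
  intro z₀ hz₀
  obtain ⟨r, hr, hrK⟩ := Metric.isOpen_iff.1 hK z₀ hz₀
  have hderiv : ∀ y, ∀ z ∈ Metric.ball z₀ r, HasDerivAt (fun z => f z y) (deriv (fun z => f z y) z) z :=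
    fun y z hz => ((hf y).differentiableAt (hK.mem_nhds (hrK hz))).hasDerivAt
  have hmem : ∀ z ∈ Metric.ball z₀ (r / 2), Metric.closedBall z (r / 2 / 2) ⊆ K := by
    intro z hz w hw
    refine hrK ?_
    have h1 := Metric.mem_ball.1 hz
    have h2 := Metric.mem_closedBall.1 hw
    refine Metric.mem_ball.2 ((dist_triangle w z z₀).trans_lt ?_)
    linarith
  -- Measurability is assumed for the values only. The derivative inherits it as a limit of
  -- difference quotients along the sequence `u n → 0`.
  have hmd : AEStronglyMeasurable (fun y => deriv (fun z => f z y) z₀) μ := by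
    let u : ℕ → ℂ := fun n => ((r / 2 / (n + 1) : ℝ) : ℂ)
    have hu : ∀ n, z₀ + u n ∈ Metric.ball z₀ r := by
      intro n
      have : ‖u n‖ = r / 2 / (n + 1) := by
        rw [Complex.norm_real, Real.norm_of_nonneg (by positivity)]
      rw [Metric.mem_ball, dist_eq_norm, add_sub_cancel_left, this]
      refine (div_le_self (by positivity) ?_).trans_lt (by linarith)
      have : (0 : ℝ) ≤ n := n.cast_nonneg
      linarith
    have hu0 : ∀ n, u n ≠ 0 := fun n => by
      simp only [u, ne_eq, Complex.ofReal_eq_zero]; positivity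
    have hlim : Tendsto u atTop (𝓝[≠] 0) := by
      refine tendsto_nhdsWithin_iff.2 ⟨?_, Eventually.of_forall hu0⟩
      have : Tendsto (fun n : ℕ => r / 2 / ((n : ℝ) + 1)) atTop (𝓝 0) :=
        tendsto_const_nhds.div_atTop (tendsto_natCast_atTop_atTop.atTop_add tendsto_const_nhds)
      simpa [u, Function.comp_def] using (Complex.continuous_ofReal.tendsto 0).comp this
    refine aestronglyMeasurable_of_tendsto_ae atTop
      (f := fun n y => (u n)⁻¹ • (f (z₀ + u n) y - f z₀ y)) (fun n => ?_) (ae_of_all _ fun y => ?_)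
    · exact ((hmeas _ (hrK (hu n))).sub (hmeas _ hz₀)).const_smul (u n)⁻¹
    · exact ((hasDerivAt_iff_tendsto_slope_zero.1 (hderiv y z₀ (Metric.mem_ball_self hr))).comp hlim)
  -- Every point of the ball of radius `r/2` is the centre of a closed disc of radius `r/4` inside
  -- `K`; Cauchy's estimate on that disc bounds the derivative by `g/(r/4)`.
  refine (hasDerivAt_integral_of_dominated_loc_of_deriv_le (bound := fun y => g y / (r / 2 / 2))
    (F' := fun z y => deriv (fun z => f z y) z) (Metric.ball_mem_nhds z₀ (half_pos hr)) ?_ ?_ hmd ?_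
    (hg.div_const _) (ae_of_all _ fun y z hz => hderiv y z
      (Metric.ball_subset_ball (by linarith) hz))).2.differentiableAt.differentiableWithinAt
  · filter_upwards [hK.mem_nhds hz₀] with z hz using hmeas z hz
  · refine Integrable.mono' hg (hmeas z₀ hz₀) ?_
    filter_upwards [hbound] with y hy using hy z₀ hz₀
  · filter_upwards [hbound] with y hy z hz
    have hs := hmem z hz
    refine Complex.norm_deriv_le_of_forall_mem_sphere_norm_le (by positivity) ?_
      fun w hw => hy w (hs (Metric.sphere_subset_closedBall hw))
    refine ((hf y).mono hs).diffContOnCl_ball (c := z) (R := r / 2 / 2) subset_rfl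

section Parameter
variable {ι : Type*} [Fintype ι] {b : ℝ → ℝ} {K : Set ℂ} {d : ℂ → ι → ℂ}
  {B : ℂ → ℝ → Matrix ι ι ℂ}

/-- One majorant `b` serves all `z ∈ K`. Each term of the Neumann series is then continuous by
dominated convergence, and the series converges uniformly on `K`. -/
theorem continuousOn_volterra_param (hB : ∀ z ∈ K, Dominates b (d z) (B z))
    (hd : ∀ i, ContinuousOn (fun z => d z i) K)
    (hBz : ∀ y i j, ContinuousOn (fun z => B z y i j) K) (c : ι → ℂ) (x : ℝ) (i : ι) :
    ContinuousOn (fun z => volterra (d z) (B z) c x i) K := by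
  rcases K.eq_empty_or_nonempty with rfl | hne
  · exact continuousOn_empty _
  have hterm : ∀ n x i, ContinuousOn (fun z => volterraTerm (d z) (B z) c n x i) K := by
    intro n
    induction n with
    | zero => intro x i; exact continuousOn_const
    | succ n ih =>
      intro x i
      refine continuousOn_of_dominated (bound := fun y => ‖c‖ * (1 / 2) ^ n * (b y * expWeight b y))
        (fun z hz => ?_) (fun z hz => ?_) ?_ (ae_of_all _ fun y => ?_)
      · exact (Measurable.mul (by fun_prop)
          ((hB z hz).measurable_mulVec ((hB z hz).term_spec c n).1 i)).aestronglyMeasurable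
      · refine ae_restrict_of_forall_mem measurableSet_Iic fun y hy => ?_
        exact ((hB z hz).norm_kernel_le hy (((hB z hz).term_spec c n).2 y) i).trans
          (le_of_eq (by ring))
      · exact ((hB _ hne.some_mem).integrableOn_mul_weight x).const_mul _
      · refine ContinuousOn.mul ?_ ?_
        · exact ((hd i).mul continuousOn_const).cexp
        · simp only [mulVec, dotProduct]
          exact continuousOn_finsetSum _ fun j _ => (hBz y i j).mul (ih y j)
  exact continuousOn_tsum (hterm · x i) (Dominates.summable_majorant c (expWeight b x))
    fun n z hz => (hB z hz).norm_term_le c n i le_rfl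

/-- As for continuity, with holomorphy of integrals for the single terms and Weierstrass's theorem
for the sum. -/
theorem differentiableOn_volterra_param (hK : IsOpen K) (hB : ∀ z ∈ K, Dominates b (d z) (B z))
    (hd : ∀ i, DifferentiableOn ℂ (fun z => d z i) K)
    (hBz : ∀ y i j, DifferentiableOn ℂ (fun z => B z y i j) K) (c : ι → ℂ) (x : ℝ) (i : ι) :
    DifferentiableOn ℂ (fun z => volterra (d z) (B z) c x i) K := by
  rcases K.eq_empty_or_nonempty with rfl | hne
  · exact differentiableOn_empty
  have hterm : ∀ n x i, DifferentiableOn ℂ (fun z => volterraTerm (d z) (B z) c n x i) K := by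
    intro n
    induction n with
    | zero => intro x i; exact differentiableOn_const _
    | succ n ih =>
      intro x i
      refine differentiableOn_integral hK
        (g := fun y => ‖c‖ * (1 / 2) ^ n * (b y * expWeight b y))
        (fun z hz => ?_) ?_ ?_ fun y => ?_
      · exact (Measurable.mul (by fun_prop)
          ((hB z hz).measurable_mulVec ((hB z hz).term_spec c n).1 i)).aestronglyMeasurable
      · exact ((hB _ hne.some_mem).integrableOn_mul_weight x).const_mul _
      · refine ae_restrict_of_forall_mem measurableSet_Iic fun y hy z hz => ?_
        exact ((hB z hz).norm_kernel_le hy (((hB z hz).term_spec c n).2 y) i).trans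
          (le_of_eq (by ring))
      · refine DifferentiableOn.mul ?_ ?_
        · exact ((hd i).mul (differentiableOn_const _)).cexp
        · simp only [mulVec, dotProduct]
          exact DifferentiableOn.fun_sum fun j _ => (hBz y i j).mul (ih y j)
  exact Complex.differentiableOn_tsum_of_summable_norm (Dominates.summable_majorant c (expWeight b x)) (hterm · x i) hK
    fun n z hz => (hB z hz).norm_term_le c n i le_rfl

end Parameter

/-! ### Linear equations on the line -/

section Linear
variable {ι : Type*} [Fintype ι]

theorem norm_mulVec_le_sum (M : Matrix ι ι ℂ) (v : ι → ℂ) :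
    ‖M *ᵥ v‖ ≤ (∑ i, ∑ j, ‖M i j‖) * ‖v‖ := by
  refine (pi_norm_le_iff_of_nonneg (by positivity)).2 fun i => ?_
  simp only [mulVec, dotProduct]
  calc ‖∑ j, M i j * v j‖ ≤ ∑ j, ‖M i j‖ * ‖v‖ := by
        refine norm_sum_le_of_le _ fun j _ => ?_
        rw [norm_mul]
        exact mul_le_mul_of_nonneg_left (norm_le_pi_norm v j) (norm_nonneg _)
    _ = (∑ j, ‖M i j‖) * ‖v‖ := by rw [Finset.sum_mul]
    _ ≤ _ := mul_le_mul_of_nonneg_right (Finset.single_le_sum (f := fun i => ∑ j, ‖M i j‖)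
        (fun i _ => by positivity) (Finset.mem_univ i)) (norm_nonneg _)

/-- The initial value problem on `[0, ∞)` is a Volterra equation from `-∞` with `d = 0`, once the
coefficient is switched off for negative times. The solution is therefore global with no further
argument. -/
theorem exists_forward_solution {E : ℝ → Matrix ι ι ℂ} (hE : Continuous E) (c : ι → ℂ) :
    ∃ y : ℝ → ι → ℂ, Continuous y ∧
      ∀ t, 0 ≤ t → ∀ i, y t i = c i + ∫ s in (0:ℝ)..t, (E s *ᵥ y s) i := by
  let B : ℝ → Matrix ι ι ℂ := fun s => if 0 < s then E s else 0
  -- The majorant has to be continuous and integrable at `-∞`, although `B` jumps to zero at the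
  -- origin. The factor `e^{min(s,0)}` is 1 for positive `s` and supplies the decay for negative
  -- `s`.
  let b : ℝ → ℝ := fun s => Real.exp (min s 0) * ∑ i, ∑ j, ‖E (max s 0) i j‖
  have hEij : ∀ i j, Continuous fun s => E s i j := fun i j => hE.matrix_elem i j
  have hbc : Continuous b := by
    refine (by fun_prop : Continuous fun s : ℝ => Real.exp (min s 0)).mul ?_
    exact continuous_finsetSum _ fun i _ => continuous_finsetSum _ fun j _ =>
      ((hEij i j).comp (by fun_prop : Continuous fun s : ℝ => max s 0)).norm
  have hB : Dominates b 0 B := by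
    refine ⟨⟨fun s => by positivity, hbc, fun a => ?_⟩, fun i => by simp, fun i j => ?_, fun s v => ?_⟩
    · have h1 : IntegrableOn b (Iic 0) := by
        refine IntegrableOn.congr_fun ((integrableOn_exp_Iic 0).mul_const (∑ i, ∑ j, ‖E 0 i j‖))
          (fun s hs => ?_) measurableSet_Iic
        simp only [b, min_eq_left (mem_Iic.1 hs), max_eq_right (mem_Iic.1 hs)]
      refine (h1.union (hbc.continuousOn.integrableOn_Icc (a := 0) (b := a))).mono_set fun s hs => ?_
      rcases le_total s 0 with h | h
      · exact Or.inl h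
      · exact Or.inr ⟨h, hs⟩
    · have : (fun s => B s i j) = fun s => if 0 < s then E s i j else 0 := by
        funext s; simp only [B]; split_ifs <;> rfl
      rw [this]
      exact Measurable.ite measurableSet_Ioi (hEij i j).measurable measurable_const
    · simp only [B]
      split_ifs with h
      · have := norm_mulVec_le_sum (E s) v
        simpa [b, min_eq_right h.le, max_eq_left h.le] using this
      · rw [zero_mulVec, norm_zero]; positivity
  refine ⟨volterra 0 B c, hB.continuous_volterra c, fun t ht i => ?_⟩
  have h1 := congrFun (hB.volterra_eq c t) i
  rw [Pi.add_apply] at h1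
  rw [h1]
  congr 1
  have h2 : ∀ s, Complex.exp ((0 : ι → ℂ) i * (t - s : ℝ)) * (B s *ᵥ volterra 0 B c s) i =
      (Ioi (0:ℝ)).indicator (fun s => (E s *ᵥ volterra 0 B c s) i) s := by
    intro s
    by_cases h : 0 < s
    · rw [indicator_of_mem (mem_Ioi.2 h)]; simp [B, h]
    · rw [indicator_of_notMem (by simpa using h)]; simp [B, h]
  rw [volterraStep]
  simp only [h2]
  rw [setIntegral_indicator measurableSet_Ioi, intervalIntegral.integral_of_le ht]
  congr 2
  ext s; simp [and_comm]

/-- The forward solution and the time reversal of a forward solution for `-E(-s)` are glued at 0.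
The glued function satisfies a single integral equation, which makes it differentiable at 0 as well.
-/
theorem exists_linear_solution {E : ℝ → Matrix ι ι ℂ} (hE : Continuous E) (c : ι → ℂ) :
    ∃ y : ℝ → ι → ℂ, y 0 = c ∧ ∀ t, HasDerivAt y (E t *ᵥ y t) t := by
  obtain ⟨u, hu, hu'⟩ := exists_forward_solution hE c
  obtain ⟨v, hv, hv'⟩ := exists_forward_solution
    (E := fun s => -E (-s)) ((hE.comp continuous_neg).neg) c
  let y : ℝ → ι → ℂ := fun t => if t ≤ 0 then v (-t) else u t
  have hu0 : u 0 = c := by funext i; simpa using hu' 0 le_rfl i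
  have hv0 : v 0 = c := by funext i; simpa using hv' 0 le_rfl i
  have hyc : Continuous y := by
    refine Continuous.if_le (hv.comp continuous_neg) hu continuous_id continuous_const ?_
    rintro t rfl
    simp [hu0, hv0]
  have hEy : Continuous fun s => E s *ᵥ y s := hE.matrix_mulVec hyc
  have key : ∀ t i, y t i = c i + ∫ s in (0:ℝ)..t, (E s *ᵥ y s) i := by
    intro t i
    rcases le_or_gt t 0 with h | h
    · simp only [y, if_pos h]
      rw [hv' (-t) (by linarith) i]
      congr 1
      have := intervalIntegral.integral_comp_neg (a := 0) (b := -t)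
        (fun s => (-E s *ᵥ v (-s)) i)
      simp only [neg_neg, neg_zero] at this
      rw [this, intervalIntegral.integral_symm, ← intervalIntegral.integral_neg]
      refine intervalIntegral.integral_congr fun s hs => ?_
      rw [uIcc_of_ge h] at hs
      simp [hs.2, neg_mulVec]
    · simp only [y, if_neg (not_le.2 h)]
      rw [hu' t h.le i]
      congr 1
      refine intervalIntegral.integral_congr_ae (ae_of_all _ fun s hs => ?_)
      rw [uIoc_of_le h.le] at hs
      simp [not_le.2 hs.1]
  refine ⟨y, by simp [y, hv0], fun t => hasDerivAt_pi.2 fun i => ?_⟩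
  have hci : Continuous fun s => (E s *ᵥ y s) i := (continuous_apply i).comp hEy
  have h1 : (fun t => y t i) = fun t => c i + ∫ s in (0:ℝ)..t, (E s *ᵥ y s) i := funext fun t => key t i
  rw [h1]
  exact (intervalIntegral.integral_hasDerivAt_right (hci.intervalIntegrable _ _)
    (hci.stronglyMeasurableAtFilter _ _) hci.continuousAt).const_add _

end Linear

end LPD

namespace LPD

/-! ### Evolution of linear systems -/

section Evolution
variable {ι : Type*} [Fintype ι]

/-- The sum of the norms of the entries of a matrix. -/
def entrySum (M : Matrix ι ι ℂ) : ℝ := ∑ i, ∑ j, ‖M i j‖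

theorem entrySum_nonneg (M : Matrix ι ι ℂ) : 0 ≤ entrySum M :=
  Finset.sum_nonneg fun _ _ => Finset.sum_nonneg fun _ _ => norm_nonneg _

theorem norm_mulVec_le (M : Matrix ι ι ℂ) (v : ι → ℂ) : ‖M *ᵥ v‖ ≤ entrySum M * ‖v‖ :=
  norm_mulVec_le_sum M v

theorem continuous_entrySum : Continuous (entrySum : Matrix ι ι ℂ → ℝ) :=
  continuous_finsetSum _ fun i _ => continuous_finsetSum _ fun j _ =>
    (continuous_id.matrix_elem i j).norm

/-- Gronwall's inequality in both time directions; negative times follow by reflection. -/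
theorem norm_le_of_norm_deriv_le {E : Type*} [NormedAddCommGroup E] [NormedSpace ℝ E]
    {f f' : ℝ → E} {K ε T : ℝ} (hK : 0 < K) (hε : 0 ≤ ε)
    (hf : ∀ s, HasDerivAt f (f' s) s) (hb : ∀ s ∈ Icc (-T) T, ‖f' s‖ ≤ K * ‖f s‖ + ε)
    {t : ℝ} (ht : t ∈ Icc (-T) T) : ‖f t‖ ≤ (‖f 0‖ + ε / K) * Real.exp (K * T) := by
  have main : ∀ {g g' : ℝ → E}, (∀ s, HasDerivAt g (g' s) s) →
      (∀ s ∈ Icc (-T) T, ‖g' s‖ ≤ K * ‖g s‖ + ε) → ∀ t, 0 ≤ t → t ≤ T →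
      ‖g t‖ ≤ (‖g 0‖ + ε / K) * Real.exp (K * T) := by
    intro g g' hg hb t h0 hT
    have h1 := norm_le_gronwallBound_of_norm_deriv_right_le (f := g) (f' := g') (δ := ‖g 0‖)
      (K := K) (ε := ε) (a := 0) (b := T) (fun s _ => (hg s).continuousAt.continuousWithinAt)
      (fun s _ => (hg s).hasDerivWithinAt) le_rfl (fun s hs => hb s ⟨by linarith [hs.1], hs.2.le⟩)
      t ⟨h0, hT⟩
    rw [gronwallBound_of_K_ne_0 hK.ne', sub_zero] at h1
    refine h1.trans ?_
    have h2 : Real.exp (K * t) ≤ Real.exp (K * T) :=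
      Real.exp_le_exp.2 (mul_le_mul_of_nonneg_left hT hK.le)
    have h3 : 0 ≤ ε / K := by positivity
    nlinarith [norm_nonneg (g 0)]
  rcases le_total 0 t with h | h
  · exact main hf hb t h ht.2
  · have := main (g := fun s => f (-s)) (g' := fun s => -f' (-s))
      (fun s => by simpa [Function.comp_def] using (hf (-s)).scomp s (hasDerivAt_neg s))
      (fun s hs => by rw [norm_neg]; exact hb (-s) ⟨by linarith [hs.2], by linarith [hs.1]⟩)
      (-t) (by linarith) (by linarith [ht.1])
    simpa using this

/-- A limit at one end of the line persists in time. -/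
theorem tendsto_of_evolution {F : Filter ℝ} {D : Matrix ι ι ℂ} {R : ℝ → ℝ → Matrix ι ι ℂ}
    {w : ℝ → ℝ → ι → ℂ} {c : ι → ℂ} (hc : D *ᵥ c = 0)
    (hR : ∀ T, ∀ ε > 0, ∀ᶠ x in F, ∀ s ∈ Icc (-T) T, entrySum (R x s) ≤ ε)
    (hw : ∀ x t, HasDerivAt (fun s => w x s) (D *ᵥ w x t + R x t *ᵥ w x t) t)
    (h0 : Tendsto (fun x => w x 0) F (𝓝 c)) (t : ℝ) : Tendsto (fun x => w x t) F (𝓝 c) := by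
  -- The summand 1 absorbs the perturbation `R`, whose entry sum is eventually at most `ε ≤ 1` on
  -- the time interval.
  set K : ℝ := entrySum D + 1 with hKdef
  have hK : 0 < K := by have := entrySum_nonneg D; positivity
  have key : ∀ ε > 0, ε ≤ 1 → ∀ᶠ x in F, ‖w x t - c‖ ≤
      (‖w x 0 - c‖ + ε * ‖c‖ / K) * Real.exp (K * |t|) := by
    intro ε hε hε1
    filter_upwards [hR |t| ε hε] with x hx
    refine norm_le_of_norm_deriv_le (f := fun s => w x s - c) hK (by positivity)
      (fun s => (hw x s).sub_const c) (fun s hs => ?_) ⟨neg_abs_le t, le_abs_self t⟩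
    -- Since `D c = 0`, the deviation `w - c` solves the same equation with the small forcing `R c`.
    have h1 : D *ᵥ w x s + R x s *ᵥ w x s = D *ᵥ (w x s - c) + R x s *ᵥ (w x s - c) + R x s *ᵥ c := by
      rw [mulVec_sub, mulVec_sub, hc]; abel
    rw [h1]
    have h2 := norm_mulVec_le D (w x s - c)
    have h3 := norm_mulVec_le (R x s) (w x s - c)
    have h4 := norm_mulVec_le (R x s) c
    have h5 := mul_le_mul_of_nonneg_right ((hx s hs).trans hε1) (norm_nonneg (w x s - c))
    have h6 := mul_le_mul_of_nonneg_right (hx s hs) (norm_nonneg c)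
    refine (norm_add_le _ _).trans ?_
    have h7 := norm_add_le (D *ᵥ (w x s - c)) (R x s *ᵥ (w x s - c))
    rw [hKdef, add_mul]
    linarith
  rw [tendsto_iff_norm_sub_tendsto_zero] at h0 ⊢
  refine Metric.tendsto_nhds.2 fun η hη => ?_
  have hlim : Tendsto (fun p : ℝ × ℝ => (p.1 + p.2 * ‖c‖ / K) * Real.exp (K * |t|))
      (𝓝 (0, 0)) (𝓝 0) := by
    have : Continuous fun p : ℝ × ℝ => (p.1 + p.2 * ‖c‖ / K) * Real.exp (K * |t|) := by fun_prop
    simpa using this.tendsto (0, 0)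
  obtain ⟨δ, hδ, hball⟩ := Metric.eventually_nhds_iff.1 (hlim.eventually (gt_mem_nhds hη))
  have hm : 0 < min (δ / 2) 1 := by positivity
  filter_upwards [key (min (δ / 2) 1) hm (min_le_right _ _),
    h0.eventually (gt_mem_nhds hδ)] with x hx1 hx2
  rw [Real.dist_eq, sub_zero, abs_of_nonneg (norm_nonneg _)]
  refine hx1.trans_lt (hball (y := (‖w x 0 - c‖, min (δ / 2) 1)) ?_)
  rw [Prod.dist_eq, Real.dist_eq, Real.dist_eq, sub_zero, sub_zero, abs_of_nonneg (norm_nonneg _),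
    abs_of_pos hm]
  exact max_lt hx2 ((min_le_left _ _).trans_lt (by linarith))

/-- The first-order Taylor remainder in `x` is `o(h)` uniformly for times in a compact interval: the
mean value inequality together with continuity of `E'` on a compact set. -/
theorem eventually_entrySum_remainder_le {E E' : ℝ → ℝ → Matrix ι ι ℂ}
    (hE' : Continuous fun p : ℝ × ℝ => E' p.1 p.2)
    (hderiv : ∀ x t i j, HasDerivAt (fun y => E y t i j) (E' x t i j) x)
    (x T : ℝ) {ε : ℝ} (hε : 0 < ε) :
    ∀ᶠ h in 𝓝 (0:ℝ), ∀ s ∈ Icc (-T) T,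
      entrySum (E (x + h) s - E x s - (h : ℂ) • E' x s) ≤ ε * |h| := by
  have hcard : 0 < (Fintype.card ι : ℝ) * Fintype.card ι + 1 := by positivity
  set η := ε / ((Fintype.card ι : ℝ) * Fintype.card ι + 1) with hη
  have hη0 : 0 < η := by positivity
  have h1 : ∀ i j, ∀ᶠ h in 𝓝 (0:ℝ), ∀ s ∈ Icc (-T) T, ‖E' (x + h) s i j - E' x s i j‖ < η := by
    intro i j
    refine isCompact_Icc.eventually_forall_of_forall_eventually fun s _ => ?_
    have hc : Continuous fun p : ℝ × ℝ => ‖E' (x + p.1) p.2 i j - E' x p.2 i j‖ := by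
      have e1 : Continuous fun p : ℝ × ℝ => E' (x + p.1) p.2 i j :=
        (hE'.comp (by fun_prop : Continuous fun p : ℝ × ℝ => (x + p.1, p.2))).matrix_elem i j
      have e2 : Continuous fun p : ℝ × ℝ => E' x p.2 i j :=
        (hE'.comp (by fun_prop : Continuous fun p : ℝ × ℝ => (x, p.2))).matrix_elem i j
      exact (e1.sub e2).norm
    have := hc.tendsto (0, s)
    simp only [add_zero, sub_self, norm_zero] at this
    exact this.eventually (gt_mem_nhds hη0)
  have h2 : ∀ i j, ∀ᶠ h in 𝓝 (0:ℝ), ∀ s ∈ Icc (-T) T,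
      ‖(E (x + h) s - E x s - (h : ℂ) • E' x s) i j‖ ≤ η * |h| := by
    intro i j
    obtain ⟨δ, hδ, hball⟩ := Metric.eventually_nhds_iff.1 (h1 i j)
    filter_upwards [Metric.ball_mem_nhds 0 hδ] with h hh s hs
    have hsub : ∀ y ∈ segment ℝ 0 h, dist y 0 < δ := fun y hy =>
      (convex_ball (0:ℝ) δ).segment_subset (Metric.mem_ball_self hδ) hh hy
    have hd : ∀ y ∈ segment ℝ 0 h, HasDerivWithinAt
        (fun y : ℝ => E (x + y) s i j - (y : ℂ) * E' x s i j)
        (E' (x + y) s i j - E' x s i j) (segment ℝ 0 h) y := by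
      intro y _
      have e1 : HasDerivAt (fun y : ℝ => E (x + y) s i j) (E' (x + y) s i j) y := by
        simpa using (hderiv (x + y) s i j).comp_const_add x y
      have e2 : HasDerivAt (fun y : ℝ => (y : ℂ) * E' x s i j) (E' x s i j) y := by
        simpa using (Complex.ofRealCLM.hasDerivAt (x := y)).mul_const (E' x s i j)
      exact (e1.sub e2).hasDerivWithinAt
    have := (convex_segment (0:ℝ) h).norm_image_sub_le_of_norm_hasDerivWithin_le hd
      (fun y hy => (hball (hsub y hy) s hs).le) (left_mem_segment ℝ 0 h) (right_mem_segment ℝ 0 h)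
    simp only [add_zero, Complex.ofReal_zero, zero_mul, sub_zero, Real.norm_eq_abs] at this
    refine le_trans (le_of_eq ?_) this
    rw [Matrix.sub_apply, Matrix.sub_apply, Matrix.smul_apply, smul_eq_mul]
    congr 1; ring
  filter_upwards [eventually_all.2 fun i => eventually_all.2 fun j => h2 i j] with h hh s hs
  calc entrySum _ ≤ ∑ _i : ι, ∑ _j : ι, η * |h| :=
        Finset.sum_le_sum fun i _ => Finset.sum_le_sum fun j _ => hh i j s hs
    _ = (Fintype.card ι : ℝ) * Fintype.card ι * η * |h| := by
        simp only [Finset.sum_const, Finset.card_univ, nsmul_eq_mul]; ring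
    _ ≤ ε * |h| := by
        refine mul_le_mul_of_nonneg_right ?_ (abs_nonneg h)
        have : ε = ((Fintype.card ι : ℝ) * Fintype.card ι + 1) * η := by rw [hη]; field_simp
        rw [this]
        exact mul_le_mul_of_nonneg_right (by linarith) hη0.le

/-- The equation `ψ_x = A ψ` at time zero propagates along `ψ_t = E ψ` when `A_t - E_x + [A, E] = 0`. -/
theorem hasDerivAt_of_zero_curvature {A A' E E' : ℝ → ℝ → Matrix ι ι ℂ} {ψ : ℝ → ℝ → ι → ℂ}
    (hEc : Continuous fun p : ℝ × ℝ => E p.1 p.2) (hE'c : Continuous fun p : ℝ × ℝ => E' p.1 p.2)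
    (hAc : ∀ x, Continuous (A x))
    (hA : ∀ x t i j, HasDerivAt (fun s => A x s i j) (A' x t i j) t)
    (hE : ∀ x t i j, HasDerivAt (fun y => E y t i j) (E' x t i j) x)
    (hzc : ∀ x t, E' x t + E x t * A x t = A' x t + A x t * E x t)
    (hψt : ∀ x t, HasDerivAt (fun s => ψ x s) (E x t *ᵥ ψ x t) t)
    (hψ0 : ∀ x, HasDerivAt (fun y => ψ y 0) (A x 0 *ᵥ ψ x 0) x) (x t : ℝ) :
    HasDerivAt (fun y => ψ y t) (A x t *ᵥ ψ x t) x := by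
  have hψc : ∀ x, Continuous (ψ x) := fun x =>
    continuous_iff_continuousAt.2 fun t => (hψt x t).continuousAt
  set T := |t|
  have hcompact : IsCompact (Icc (x - 1) (x + 1) ×ˢ Icc (-T) T) := isCompact_Icc.prod isCompact_Icc
  obtain ⟨K₀, hK₀⟩ := hcompact.exists_bound_of_continuousOn
    (f := fun p : ℝ × ℝ => entrySum (E p.1 p.2)) (continuous_entrySum.comp hEc).continuousOn
  set K := |K₀| + 1
  have hK : 0 < K := by positivity
  obtain ⟨M₀, hM₀⟩ := (isCompact_Icc (a := -T) (b := T)).exists_bound_of_continuousOn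
    (f := fun s => ψ x s) (hψc x).continuousOn
  obtain ⟨M₁, hM₁⟩ := (isCompact_Icc (a := -T) (b := T)).exists_bound_of_continuousOn
    (f := fun s => A x s *ᵥ ψ x s) ((hAc x).matrix_mulVec (hψc x)).continuousOn
  have hM₀' : 0 ≤ |M₀| := abs_nonneg _
  -- Differentiability of `ψ` in `x` at times other than zero is not known in advance, so the
  -- candidate remainder `ψ(x+h) - ψ(x) - hAψ` is followed in time. It obeys `g_s = E(x+h) g` plus a
  -- forcing of size `o(h)`, and starts at `o(h)`; Gronwall then gives `o(h)` at time `t`.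
  have hg : ∀ h s, HasDerivAt (fun s => ψ (x + h) s - ψ x s - (h : ℂ) • (A x s *ᵥ ψ x s))
      (E (x + h) s *ᵥ (ψ (x + h) s - ψ x s - (h : ℂ) • (A x s *ᵥ ψ x s)) +
        ((E (x + h) s - E x s - (h : ℂ) • E' x s) *ᵥ ψ x s +
          (h : ℂ) • ((E (x + h) s - E x s) *ᵥ (A x s *ᵥ ψ x s)))) s := by
    intro h s
    have e1 : HasDerivAt (fun s => A x s *ᵥ ψ x s)
        (A' x s *ᵥ ψ x s + A x s *ᵥ (E x s *ᵥ ψ x s)) s := by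
      refine hasDerivAt_pi.2 fun i => ?_
      simp only [mulVec, dotProduct, Pi.add_apply]
      rw [← Finset.sum_add_distrib]
      exact HasDerivAt.fun_sum fun j _ => (hA x s i j).mul (hasDerivAt_pi.1 (hψt x s) j)
    refine (((hψt (x + h) s).sub (hψt x s)).sub (e1.const_smul (h : ℂ))).congr_deriv ?_
    -- Zero curvature enters here. It replaces `(Aψ)_t` by `E_x ψ + EAψ`, so the terms of first
    -- order in `h` combine with `E(x+h) - E(x)` into a Taylor remainder.
    have e2 : A' x s *ᵥ ψ x s + A x s *ᵥ (E x s *ᵥ ψ x s) =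
        E' x s *ᵥ ψ x s + E x s *ᵥ (A x s *ᵥ ψ x s) := by
      rw [mulVec_mulVec, mulVec_mulVec, ← add_mulVec, ← add_mulVec, hzc]
    rw [e2]
    simp only [mulVec_sub, sub_mulVec, mulVec_smul, smul_mulVec, smul_add, smul_sub]
    abel
  rw [hasDerivAt_iff_isLittleO_nhds_zero]
  refine Asymptotics.isLittleO_iff.2 fun {η} hη => ?_
  set C := Real.exp (K * T)
  have hC : 0 < C := Real.exp_pos _
  obtain ⟨ε, hε, hεη⟩ : ∃ ε > 0, (ε + ε * (|M₀| + |M₁|) / K) * C ≤ η := by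
    refine ⟨η / ((1 + (|M₀| + |M₁|) / K) * C), by positivity, le_of_eq ?_⟩
    field_simp
  have h0 := Asymptotics.isLittleO_iff.1 (hasDerivAt_iff_isLittleO_nhds_zero.1 (hψ0 x)) hε
  have h1 := eventually_entrySum_remainder_le hE'c hE x T hε
  have h2 : ∀ᶠ h in 𝓝 (0:ℝ), ∀ s ∈ Icc (-T) T, entrySum (E (x + h) s - E x s) < ε := by
    refine isCompact_Icc.eventually_forall_of_forall_eventually fun s _ => ?_
    have hc : Continuous fun p : ℝ × ℝ => entrySum (E (x + p.1) p.2 - E x p.2) :=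
      continuous_entrySum.comp
        ((hEc.comp (by fun_prop : Continuous fun p : ℝ × ℝ => (x + p.1, p.2))).sub
        (hEc.comp (by fun_prop : Continuous fun p : ℝ × ℝ => (x, p.2))))
    have := hc.tendsto (0, s)
    have hz : entrySum (0 : Matrix ι ι ℂ) = 0 := by simp [entrySum]
    simp only [add_zero, sub_self, hz] at this
    exact this.eventually (gt_mem_nhds hε)
  filter_upwards [h0, h1, h2, Metric.ball_mem_nhds (0:ℝ) one_pos] with h hh0 hh1 hh2 hh3
  have hh3' : |h| < 1 := by simpa using hh3
  have habs := abs_lt.1 hh3'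
  have hsm : ∀ v : ι → ℂ, h • v = (h : ℂ) • v := fun v => (Complex.coe_smul h v).symm
  simp only [hsm] at hh0 ⊢
  have hfin := norm_le_of_norm_deriv_le (T := T) (ε := ε * (|M₀| + |M₁|) * |h|) hK (by positivity)
    (hg h) (fun s hs => ?_) (t := t) ⟨neg_abs_le t, le_abs_self t⟩
  · refine hfin.trans ?_
    have e1 : (‖ψ (x + h) 0 - ψ x 0 - (h : ℂ) • (A x 0 *ᵥ ψ x 0)‖ +
        ε * (|M₀| + |M₁|) * |h| / K) * C ≤ (ε * |h| + ε * (|M₀| + |M₁|) * |h| / K) * C :=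
      by
      rw [Real.norm_eq_abs] at hh0
      exact mul_le_mul_of_nonneg_right (by gcongr) hC.le
    refine e1.trans ?_
    have e2 : (ε * |h| + ε * (|M₀| + |M₁|) * |h| / K) * C =
        (ε + ε * (|M₀| + |M₁|) / K) * C * |h| := by ring
    rw [e2, Real.norm_eq_abs]
    exact mul_le_mul_of_nonneg_right hεη (abs_nonneg h)
  · have f1 := norm_mulVec_le (E (x + h) s) (ψ (x + h) s - ψ x s - (h : ℂ) • (A x s *ᵥ ψ x s))
    have f2 : entrySum (E (x + h) s) ≤ K := by
      have := hK₀ (x + h, s) ⟨⟨by linarith [habs.1], by linarith [habs.2]⟩, hs⟩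
      have := (le_abs_self _).trans this
      simp only [K]
      linarith [le_abs_self K₀]
    have f3 := norm_mulVec_le (E (x + h) s - E x s - (h : ℂ) • E' x s) (ψ x s)
    have f4 := norm_mulVec_le (E (x + h) s - E x s) (A x s *ᵥ ψ x s)
    have f5 : ‖ψ x s‖ ≤ |M₀| := (hM₀ s hs).trans (le_abs_self _)
    have f6 : ‖A x s *ᵥ ψ x s‖ ≤ |M₁| := (hM₁ s hs).trans (le_abs_self _)
    have f7 := mul_le_mul (hh1 s hs) f5 (norm_nonneg _) (by positivity)
    have f8 := mul_le_mul (hh2 s hs).le f6 (norm_nonneg _) hε.le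
    have f9 := mul_le_mul_of_nonneg_right f2
      (norm_nonneg (ψ (x + h) s - ψ x s - (h : ℂ) • (A x s *ᵥ ψ x s)))
    refine (norm_add_le _ _).trans (add_le_add (f1.trans f9) ((norm_add_le _ _).trans ?_))
    rw [norm_smul, Complex.norm_real, Real.norm_eq_abs]
    have f10 := mul_le_mul_of_nonneg_left (f4.trans f8) (abs_nonneg h)
    calc _ ≤ ε * |h| * |M₀| + |h| * (ε * |M₁|) := add_le_add (f3.trans f7) f10
      _ = _ := by ring

end Evolution

end LPD

namespace LPD

/-! ### The Lax pair as a polynomial in the jet of the field -/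

/-- The block matrix with rows `(0, a')` and `(-a, 0)`. -/
def blk (a a' : Fin 2 → ℂ) : Mat3 := !![0, a' 0, a' 1; -(a 0), 0, 0; -(a 1), 0, 0]

def dot2 (a a' : Fin 2 → ℂ) : ℂ := a' 0 * a 0 + a' 1 * a 1

/-- `E` as a polynomial in the matrices `∂ₓᵐ Q` and `n = ‖q‖²`. -/
def polyE (k σ q0 n : ℂ) (Q Q1 Q2 Q3 : Mat3) : Mat3 :=
  (2 * k) • (σ • (Q1 * Q - Q * Q1) - (2 * σ * n) • Q - σ • Q2 - Q)
    + (Complex.I * q0 ^ 2) • Data.matJ + (3 * Complex.I * σ * q0 ^ 4) • Data.matJ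
    + (4 * Complex.I * k ^ 2) • (Data.matJ1 + σ • (Data.matJ * (Q1 - Q ^ 2)))
    + (8 * σ * k ^ 3) • Q - (8 * Complex.I * σ * k ^ 4) • Data.matJ
    + (3 * Complex.I * σ) • (Data.matJ * (Q1 * Q ^ 2 + Q ^ 2 * Q1))
    + (Complex.I * σ) • (Data.matJ * (Q2 * Q + Q * Q2 - Q3 - Q1 ^ 2))
    + (Complex.I * (1 + 3 * σ * n)) • (Data.matJ * Q ^ 2)
    - Complex.I • (Data.matJ * Q1)

section Entries
variable (k σ q0 : ℂ) (a b c d e a' b' c' d' e' : Fin 2 → ℂ)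

/-- The letters `a, b, c, d, e` stand for the field and its `x`-derivatives up to order four, the
primed letters for their conjugates. Treating the conjugates as independent variables, with `dot2`
in place of the Hermitian product, makes every identity below polynomial. -/
def topE : ℂ := 2 * k * σ * (dot2 b a' - dot2 a b') + Complex.I * (q0 ^ 2 + 3 * σ * q0 ^ 4
  + 4 * k ^ 2 * (1 + σ * dot2 a a') - 8 * σ * k ^ 4 + σ * (dot2 b b' - dot2 a c' - dot2 c a')
  - (1 + 3 * σ * dot2 a a') * dot2 a a')

def rowE (j : Fin 2) : ℂ := 2 * k * ((4 * σ * k ^ 2 - 2 * σ * dot2 a a' - 1) * a' j - σ * c' j)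
  + Complex.I * ((4 * k ^ 2 * σ - 1 - 3 * σ * dot2 a a') * b' j - 3 * σ * (dot2 a b' * a' j)
  - σ * d' j)

def colE (i : Fin 2) : ℂ := -(2 * k * ((4 * σ * k ^ 2 - 2 * σ * dot2 a a' - 1) * a i - σ * c i))
  + Complex.I * ((4 * k ^ 2 * σ - 1 - 3 * σ * dot2 a a') * b i - 3 * σ * (dot2 b a' * a i) - σ * d i)

def blockE (i j : Fin 2) : ℂ := 2 * k * σ * (a i * b' j - b i * a' j)
  + Complex.I * ((1 + 3 * σ * dot2 a a' - 4 * k ^ 2 * σ) * (a i * a' j)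
  + σ * (c i * a' j + a i * c' j - b i * b' j))

def diagE : ℂ := Complex.I * (8 * σ * k ^ 4 - q0 ^ 2 - 3 * σ * q0 ^ 4)

/-- The matrix `E` by its entries. -/
def entE : Mat3 :=
  !![topE k σ q0 a b c a' b' c', rowE k σ a a' b' c' d' 0, rowE k σ a a' b' c' d' 1;
     colE k σ a b c d a' 0, diagE k σ q0 + blockE k σ a b c a' b' c' 0 0,
       blockE k σ a b c a' b' c' 0 1;
     colE k σ a b c d a' 1, blockE k σ a b c a' b' c' 1 0,
       diagE k σ q0 + blockE k σ a b c a' b' c' 1 1]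

def topE' : ℂ := 2 * k * σ * ((dot2 c a' + dot2 b b') - (dot2 b b' + dot2 a c'))
  + Complex.I * (4 * k ^ 2 * (σ * (dot2 b a' + dot2 a b'))
  + σ * ((dot2 c b' + dot2 b c') - (dot2 b c' + dot2 a d') - (dot2 d a' + dot2 c b'))
  - (3 * σ * (dot2 b a' + dot2 a b') * dot2 a a'
    + (1 + 3 * σ * dot2 a a') * (dot2 b a' + dot2 a b')))

def rowE' (j : Fin 2) : ℂ := 2 * k * (-(2 * σ * (dot2 b a' + dot2 a b')) * a' j
    + (4 * σ * k ^ 2 - 2 * σ * dot2 a a' - 1) * b' j - σ * d' j)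
  + Complex.I * (-(3 * σ * (dot2 b a' + dot2 a b')) * b' j
    + (4 * k ^ 2 * σ - 1 - 3 * σ * dot2 a a') * c' j
    - 3 * σ * ((dot2 b b' + dot2 a c') * a' j + dot2 a b' * b' j) - σ * e' j)

def colE' (i : Fin 2) : ℂ := -(2 * k * (-(2 * σ * (dot2 b a' + dot2 a b')) * a i
    + (4 * σ * k ^ 2 - 2 * σ * dot2 a a' - 1) * b i - σ * d i))
  + Complex.I * (-(3 * σ * (dot2 b a' + dot2 a b')) * b i
    + (4 * k ^ 2 * σ - 1 - 3 * σ * dot2 a a') * c i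
    - 3 * σ * ((dot2 c a' + dot2 b b') * a i + dot2 b a' * b i) - σ * e i)

def blockE' (i j : Fin 2) : ℂ :=
  2 * k * σ * ((b i * b' j + a i * c' j) - (c i * a' j + b i * b' j))
  + Complex.I * (3 * σ * (dot2 b a' + dot2 a b') * (a i * a' j)
    + (1 + 3 * σ * dot2 a a' - 4 * k ^ 2 * σ) * (b i * a' j + a i * b' j)
    + σ * ((d i * a' j + c i * b' j) + (b i * c' j + a i * d' j) - (c i * b' j + b i * c' j)))

/-- The derivative of `entE` along the jet. -/
def entE' : Mat3 :=
  !![topE' k σ a b c d a' b' c' d', rowE' k σ a b a' b' c' d' e' 0,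
       rowE' k σ a b a' b' c' d' e' 1;
     colE' k σ a b c d e a' b' 0, blockE' k σ a b c d a' b' c' d' 0 0,
       blockE' k σ a b c d a' b' c' d' 0 1;
     colE' k σ a b c d e a' b' 1, blockE' k σ a b c d a' b' c' d' 1 0,
       blockE' k σ a b c d a' b' c' d' 1 1]

end Entries

theorem hasDerivAt_dot2 {a a' : ℝ → Fin 2 → ℂ} {b b' : Fin 2 → ℂ} {x : ℝ}
    (ha : ∀ i, HasDerivAt (fun y => a y i) (b i) x)
    (ha' : ∀ i, HasDerivAt (fun y => a' y i) (b' i) x) :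
    HasDerivAt (fun y => dot2 (a y) (a' y)) (dot2 b (a' x) + dot2 (a x) b') x := by
  refine (((ha' 0).mul (ha 0)).add ((ha' 1).mul (ha 1))).congr_deriv ?_
  simp only [dot2]; ring

theorem hasDerivAt_entE (k σ q0 : ℂ) {a b c d a' b' c' d' : ℝ → Fin 2 → ℂ} {e e' : Fin 2 → ℂ} {x : ℝ}
    (ha : ∀ i, HasDerivAt (fun y => a y i) (b x i) x)
    (hb : ∀ i, HasDerivAt (fun y => b y i) (c x i) x)
    (hc : ∀ i, HasDerivAt (fun y => c y i) (d x i) x)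
    (hd : ∀ i, HasDerivAt (fun y => d y i) (e i) x)
    (ha' : ∀ i, HasDerivAt (fun y => a' y i) (b' x i) x)
    (hb' : ∀ i, HasDerivAt (fun y => b' y i) (c' x i) x)
    (hc' : ∀ i, HasDerivAt (fun y => c' y i) (d' x i) x)
    (hd' : ∀ i, HasDerivAt (fun y => d' y i) (e' i) x) (i j : Fin 3) :
    HasDerivAt (fun y => entE k σ q0 (a y) (b y) (c y) (d y) (a' y) (b' y) (c' y) (d' y) i j)
      (entE' k σ (a x) (b x) (c x) (d x) e (a' x) (b' x) (c' x) (d' x) e' i j) x := by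
  have m := hasDerivAt_dot2 ha ha'
  have htop : HasDerivAt (fun y => topE k σ q0 (a y) (b y) (c y) (a' y) (b' y) (c' y))
      (topE' k σ (a x) (b x) (c x) (d x) (a' x) (b' x) (c' x) (d' x)) x := by
    refine ((((hasDerivAt_dot2 hb ha').sub (hasDerivAt_dot2 ha hb')).const_mul (2 * k * σ)).add
      ((((((((m.const_mul σ).const_add 1).const_mul (4 * k ^ 2)).const_add (q0 ^ 2 + 3 * σ * q0 ^ 4)
      ).sub_const (8 * σ * k ^ 4)).add ((((hasDerivAt_dot2 hb hb').sub (hasDerivAt_dot2 ha hc')).sub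
      (hasDerivAt_dot2 hc ha')).const_mul σ)).sub
      (((m.const_mul (3 * σ)).const_add 1).mul m)).const_mul Complex.I)).congr_deriv ?_
    simp only [topE']
  have hrow : ∀ j, HasDerivAt (fun y => rowE k σ (a y) (a' y) (b' y) (c' y) (d' y) j)
      (rowE' k σ (a x) (b x) (a' x) (b' x) (c' x) (d' x) e' j) x := by
    intro j
    refine (((((((m.const_mul (2 * σ)).const_sub (4 * σ * k ^ 2)).sub_const 1).mul (ha' j)).sub
      ((hc' j).const_mul σ)).const_mul (2 * k)).add
      ((((((m.const_mul (3 * σ)).const_sub (4 * k ^ 2 * σ - 1)).mul (hb' j)).sub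
      (((hasDerivAt_dot2 ha hb').mul (ha' j)).const_mul (3 * σ))).sub
      ((hd' j).const_mul σ)).const_mul Complex.I)).congr_deriv ?_
    simp only [rowE']
  have hcol : ∀ j, HasDerivAt (fun y => colE k σ (a y) (b y) (c y) (d y) (a' y) j)
      (colE' k σ (a x) (b x) (c x) (d x) e (a' x) (b' x) j) x := by
    intro j
    refine (((((((m.const_mul (2 * σ)).const_sub (4 * σ * k ^ 2)).sub_const 1).mul (ha j)).sub
      ((hc j).const_mul σ)).const_mul (2 * k)).neg.add
      ((((((m.const_mul (3 * σ)).const_sub (4 * k ^ 2 * σ - 1)).mul (hb j)).sub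
      (((hasDerivAt_dot2 hb ha').mul (ha j)).const_mul (3 * σ))).sub
      ((hd j).const_mul σ)).const_mul Complex.I)).congr_deriv ?_
    simp only [colE']
  have hblk : ∀ i j, HasDerivAt (fun y => blockE k σ (a y) (b y) (c y) (a' y) (b' y) (c' y) i j)
      (blockE' k σ (a x) (b x) (c x) (d x) (a' x) (b' x) (c' x) (d' x) i j) x := by
    intro i j
    refine (((((ha i).mul (hb' j)).sub ((hb i).mul (ha' j))).const_mul (2 * k * σ)).add
      (((((((m.const_mul (3 * σ)).const_add 1).sub_const (4 * k ^ 2 * σ)).mul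
      ((ha i).mul (ha' j))).add (((((hc i).mul (ha' j)).add ((ha i).mul (hc' j))).sub
      ((hb i).mul (hb' j))).const_mul σ)).const_mul Complex.I))).congr_deriv ?_
    simp only [blockE', Pi.mul_apply]
  fin_cases i <;> fin_cases j
  exacts [htop, hrow 0, hrow 1, hcol 0, (hblk 0 0).const_add _, hblk 0 1, hcol 1, hblk 1 0,
    (hblk 1 1).const_add _]

theorem blk_mul_blk (a a' b b' : Fin 2 → ℂ) : blk a a' * blk b b' =
    !![-(dot2 b a'), 0, 0; 0, -(a 0 * b' 0), -(a 0 * b' 1); 0, -(a 1 * b' 0), -(a 1 * b' 1)] := by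
  ext i j
  fin_cases i <;> fin_cases j <;> simp [blk, dot2, Matrix.mul_apply, Fin.sum_univ_three]
  ring

theorem polyE_eq (k σ q0 : ℂ) (a b c d a' b' c' d' : Fin 2 → ℂ) :
    polyE k σ q0 (dot2 a a') (blk a a') (blk b b') (blk c c') (blk d d') =
      entE k σ q0 a b c d a' b' c' d' := by
  simp only [polyE, pow_two (blk _ _), blk_mul_blk]
  simp only [blk, Data.matJ, Data.matJ1, entE, topE, rowE, colE, blockE, diagE]
  ext i j
  simp only [Matrix.add_apply, Matrix.sub_apply, Matrix.smul_apply, Matrix.mul_apply,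
    Fin.sum_univ_three, smul_eq_mul]
  fin_cases i <;> fin_cases j <;>
  · simp [dot2]
    ring

set_option maxHeartbeats 2000000 in
-- The `(1,1)` entry and the lower `2×2` block vanish identically. The first column and the first
-- row reproduce the equation and its conjugate, times `-i`. The multiples of `hI` collect what
-- remains from `i² = -1`.
theorem zero_curvature_poly {k σ q0 : ℂ} {a b c d e a' b' c' d' e' r r' : Fin 2 → ℂ}
    (h : ∀ i, Complex.I * r i + c i + 2 * (dot2 a a' - q0 ^ 2) * a i + σ * (e i
      + 2 * dot2 b b' * a i + 2 * dot2 a b' * b i + 6 * dot2 b a' * b i + 4 * dot2 a a' * c i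
      + 4 * dot2 c a' * a i + 2 * dot2 a c' * a i + 6 * (dot2 a a' ^ 2 - q0 ^ 4) * a i) = 0)
    (h' : ∀ i, -Complex.I * r' i + c' i + 2 * (dot2 a a' - q0 ^ 2) * a' i + σ * (e' i
      + 2 * dot2 b b' * a' i + 2 * dot2 b a' * b' i + 6 * dot2 a b' * b' i + 4 * dot2 a a' * c' i
      + 4 * dot2 a c' * a' i + 2 * dot2 c a' * a' i + 6 * (dot2 a a' ^ 2 - q0 ^ 4) * a' i) = 0) :
    entE' k σ a b c d e a' b' c' d' e' + entE k σ q0 a b c d a' b' c' d'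
        * (-(Complex.I * k) • Data.matJ + blk a a') =
      blk r r' + (-(Complex.I * k) • Data.matJ + blk a a') * entE k σ q0 a b c d a' b' c' d' := by
  have h0 := h 0
  have h1 := h 1
  have h0' := h' 0
  have h1' := h' 1
  simp only [dot2] at h0 h1 h0' h1'
  have hI := Complex.I_sq
  simp only [blk, Data.matJ, entE, entE', topE, rowE, colE, blockE, diagE, topE', rowE', colE', blockE']
  ext i j
  simp only [Matrix.add_apply, Matrix.smul_apply, Matrix.mul_apply, Fin.sum_univ_three, smul_eq_mul]
  fin_cases i <;> fin_cases j
  · simp [dot2]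
    ring
  · simp [dot2]
    linear_combination (-Complex.I) * h0' + (-r' 0 + 2 * k * (4 * k ^ 2 * σ * b' 0
      + 3 * σ * (-(b' 0 * a 0 + b' 1 * a 1) * a' 0 - (a' 0 * a 0 + a' 1 * a 1) * b' 0)
      - σ * d' 0 - b' 0)) * hI
  · simp [dot2]
    linear_combination (-Complex.I) * h1' + (-r' 1 + 2 * k * (4 * k ^ 2 * σ * b' 1
      + 3 * σ * (-(b' 0 * a 0 + b' 1 * a 1) * a' 1 - (a' 0 * a 0 + a' 1 * a 1) * b' 1)
      - σ * d' 1 - b' 1)) * hI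
  · simp [dot2]
    linear_combination (-Complex.I) * h0 + (r 0 - 2 * k * (4 * k ^ 2 * σ * b 0
      - 3 * σ * ((a' 0 * a 0 + a' 1 * a 1) * b 0 + a 0 * (a' 0 * b 0 + a' 1 * b 1))
      - σ * d 0 - b 0)) * hI
  · simp [dot2]
    ring
  · simp [dot2]
    ring
  · simp [dot2]
    linear_combination (-Complex.I) * h1 + (r 1 - 2 * k * (4 * k ^ 2 * σ * b 1
      - 3 * σ * ((a' 0 * a 0 + a' 1 * a 1) * b 1 + a 1 * (a' 0 * b 0 + a' 1 * b 1))
      - σ * d 1 - b 1)) * hI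
  · simp [dot2]
    ring
  · simp [dot2]
    ring

end LPD

namespace LPD

/-! ### Eigenvectors at the ends of the line -/

theorem mulVec_three (M : Mat3) (v : Fin 3 → ℂ) (i : Fin 3) :
    (M *ᵥ v) i = M i 0 * v 0 + M i 1 * v 1 + M i 2 * v 2 := by
  simp [mulVec, dotProduct, Fin.sum_univ_three]

/-- Squaring the eigenvalue equation shows that the rank-one matrix with entries `v i * w j` acts on
the lower part of `y` as `μ² - k² = q₀²`. On such `y` the matrix `E` of a constant field coincides
with `pA + 2ik²`, where `p = 2k(4σk² - 2σq₀² - 1)`. -/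
theorem entE_mulVec_of_eigenvector {k σ q0 μ : ℂ} {v w : Fin 2 → ℂ} {y : Fin 3 → ℂ}
    (hn : dot2 v w = q0 ^ 2) (hμ : μ ^ 2 = k ^ 2 + q0 ^ 2)
    (hy : (-(Complex.I * k) • Data.matJ + blk v w) *ᵥ y = (Complex.I * μ) • y) :
    entE k σ q0 v 0 0 0 w 0 0 0 *ᵥ y =
      (Complex.I * (2 * k * (4 * σ * k ^ 2 - 2 * σ * q0 ^ 2 - 1) * μ + 2 * k ^ 2)) • y := by
  have h0 := congrFun hy 0
  have h1 := congrFun hy 1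
  have h2 := congrFun hy 2
  simp only [mulVec_three] at h0 h1 h2
  simp [Data.matJ, blk] at h0 h1 h2
  have hI := Complex.I_sq
  have hz : dot2 0 w = 0 := by simp [dot2]
  have hz' : dot2 v 0 = 0 := by simp [dot2]
  have hz'' : dot2 0 0 = 0 := by simp [dot2]
  funext i
  rw [mulVec_three]
  fin_cases i <;> simp [entE, topE, rowE, colE, blockE, diagE, hn, hz, hz', hz'', -mul_eq_mul_left_iff]
  · linear_combination (2 * k * (4 * σ * k ^ 2 - 2 * σ * q0 ^ 2 - 1)) * h0
  · linear_combination (2 * k * (4 * σ * k ^ 2 - 2 * σ * q0 ^ 2 - 1)) * h1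
      + Complex.I * (1 + 3 * σ * q0 ^ 2 - 4 * k ^ 2 * σ) * (v 0 * h0 - Complex.I * (μ + k) * h1)
      + (Complex.I * (1 + 3 * σ * q0 ^ 2 - 4 * k ^ 2 * σ) * (k ^ 2 - μ ^ 2) * y 1) * hI
      + (Complex.I * (1 + 3 * σ * q0 ^ 2 - 4 * k ^ 2 * σ) * y 1) * hμ
  · linear_combination (2 * k * (4 * σ * k ^ 2 - 2 * σ * q0 ^ 2 - 1)) * h2
      + Complex.I * (1 + 3 * σ * q0 ^ 2 - 4 * k ^ 2 * σ) * (v 1 * h0 - Complex.I * (μ + k) * h2)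
      + (Complex.I * (1 + 3 * σ * q0 ^ 2 - 4 * k ^ 2 * σ) * (k ^ 2 - μ ^ 2) * y 2) * hI
      + (Complex.I * (1 + 3 * σ * q0 ^ 2 - 4 * k ^ 2 * σ) * y 2) * hμ

namespace Data
variable (D : Data)

/-- The coordinates of `∂ₓᵐ q`. -/
def jet (m : ℕ) (x t : ℝ) : Fin 2 → ℂ := fun i => D.dx m x t i

/-- The coordinates of the conjugate of `∂ₓᵐ q`. -/
def jetc (m : ℕ) (x t : ℝ) : Fin 2 → ℂ := fun i => conj (D.dx m x t i)

theorem norm_sq_eq_dot2 (v : Vec2) : (‖v‖ : ℂ) ^ 2 = dot2 v (fun i => conj (v i)) := by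
  have h := EuclideanSpace.norm_sq_eq v
  rw [Fin.sum_univ_two] at h
  simp only [dot2]
  rw [← Complex.ofReal_pow, h]
  push_cast
  rw [← Complex.conj_mul', ← Complex.conj_mul']

theorem dx_zero (x t : ℝ) : D.dx 0 x t = D.q x t := by simp [dx]

theorem laxA_eq (k : ℂ) (x t : ℝ) :
    D.laxA k x t = -(Complex.I * k) • matJ + blk (D.jet 0 x t) (D.jetc 0 x t) := rfl

theorem laxE_eq (k : ℂ) (x t : ℝ) :
    D.laxE k x t = entE k D.sigma D.q0 (D.jet 0 x t) (D.jet 1 x t) (D.jet 2 x t) (D.jet 3 x t)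
      (D.jetc 0 x t) (D.jetc 1 x t) (D.jetc 2 x t) (D.jetc 3 x t) := by
  rw [← polyE_eq]
  have : dot2 (D.jet 0 x t) (D.jetc 0 x t) = (‖D.q x t‖ : ℂ) ^ 2 := by
    rw [norm_sq_eq_dot2, ← dx_zero]; rfl
  rw [this]; rfl

/-- The coefficients of `x` in the phases. -/
def freq (z : ℂ) : Fin 3 → ℂ := ![-D.lam z, D.kz z, D.lam z]

/-- The coefficients of `t` in the phases. -/
def disp (z : ℂ) : Fin 3 → ℂ :=
  let σ : ℂ := D.sigma
  let q0 : ℂ := D.q0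
  let k := D.kz z
  let l := D.lam z
  ![2 * (k ^ 2 + k * l - 4 * k ^ 3 * l * σ + 2 * k * l * σ * q0 ^ 2),
    8 * k ^ 4 * σ - 3 * σ * q0 ^ 4 - q0 ^ 2,
    2 * (k ^ 2 - k * l + 4 * k ^ 3 * l * σ - 2 * k * l * σ * q0 ^ 2)]

theorem phase_eq (z : ℂ) (x t : ℝ) (j : Fin 3) :
    D.phase z x t j = D.freq z j * x + D.disp z j * t := by
  fin_cases j <;> simp [phase, freq, disp]

variable {D}

theorem q0_pos (hvec : D.vec ≠ 0) : 0 < D.q0 := norm_pos_iff.2 hvec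

theorem q0_ne (hvec : D.vec ≠ 0) : (D.q0 : ℂ) ≠ 0 :=
  Complex.ofReal_ne_zero.2 (q0_pos hvec).ne'

theorem norm_qM : ‖D.qM‖ = D.q0 := by
  rw [qM, norm_smul, Complex.norm_exp]; simp [q0]

theorem norm_qP : ‖D.qP‖ = D.q0 := by
  rw [qP, norm_smul, Complex.norm_exp]; simp [q0]

theorem ne_zero_of_not_exceptional {z : ℂ} (hz : z ∉ D.exceptional) : z ≠ 0 := by
  rintro rfl; exact hz (by simp [exceptional])

theorem rho_ne_zero {z : ℂ} (hz : z ∉ D.exceptional) : D.rho z ≠ 0 := by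
  have h0 := ne_zero_of_not_exceptional hz
  intro h
  have h1 : (z - Complex.I * D.q0) * (z + Complex.I * D.q0) = 0 := by
    have : z ^ 2 * D.rho z = z ^ 2 + D.q0 ^ 2 := by rw [rho]; field_simp
    rw [h, mul_zero] at this
    linear_combination -this - (D.q0 : ℂ) ^ 2 * Complex.I_sq
  rcases mul_eq_zero.1 h1 with h2 | h2
  · exact hz (by simp [exceptional, sub_eq_zero.1 h2])
  · exact hz (by simp [exceptional, eq_neg_of_add_eq_zero_left h2])

theorem lam_sq {z : ℂ} (hz : z ≠ 0) : D.lam z ^ 2 = D.kz z ^ 2 + (D.q0 : ℂ) ^ 2 := by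
  rw [lam, kz]; field_simp; ring

variable {v : Vec2} {z : ℂ}

theorem det_matY (hv : ‖v‖ = D.q0) (hvec : D.vec ≠ 0) (hz : z ≠ 0) :
    (D.matY v z).det = D.rho z := by
  have h := norm_sq_eq_dot2 v
  rw [hv] at h
  simp only [dot2] at h
  have h0 := q0_ne hvec
  rw [det_fin_three]
  simp [matY, rho]
  field_simp
  linear_combination (-(z ^ 2) - (D.q0 : ℂ) ^ 2 ) * h + (D.q0 : ℂ) ^ 2 * (conj (v 0) * v 0 + conj (v 1) * v 1) * (-1) * Complex.I_sq

theorem bdryA_mul_matY (hv : ‖v‖ = D.q0) (hvec : D.vec ≠ 0) (hz : z ≠ 0) :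
    (-(Complex.I * D.kz z) • matJ + blockQ v) * D.matY v z =
      D.matY v z * diagonal (fun j => Complex.I * D.freq z j) := by
  have h := norm_sq_eq_dot2 v
  rw [hv] at h
  simp only [dot2] at h
  have h0 := q0_ne hvec
  have hI := Complex.I_sq
  ext i j
  rw [mul_diagonal, Matrix.mul_apply, Fin.sum_univ_three]
  fin_cases i <;> fin_cases j <;> simp [matY, freq, blockQ, matJ, lam, kz] <;> field_simp
  · linear_combination 2 * h
  · simp
  · linear_combination 2 * z ^ 2 * (D.q0 : ℂ) ^ 2 * hI - 2 * z ^ 2 * h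
  · linear_combination -2 * z ^ 2 * v 0 * hI
  · ring
  · linear_combination -2 * z ^ 2 * v 1 * hI
  · ring

theorem mulVec_col (M N : Mat3) (j : Fin 3) : M *ᵥ N.col j = (M * N).col j := rfl

theorem bdryA_mulVec_col (hv : ‖v‖ = D.q0) (hvec : D.vec ≠ 0) (hz : z ≠ 0) (j : Fin 3) :
    (-(Complex.I * D.kz z) • matJ + blockQ v) *ᵥ (D.matY v z).col j =
      (Complex.I * D.freq z j) • (D.matY v z).col j := by
  rw [mulVec_col, bdryA_mul_matY hv hvec hz]
  funext i
  simp [mul_diagonal, mul_comm]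

/-- The limit of `E` at an end of the line with boundary value `v`. -/
def bdryE (D : Data) (v : Vec2) (k : ℂ) : Mat3 :=
  entE k D.sigma D.q0 v 0 0 0 (fun i => conj (v i)) 0 0 0

theorem bdryE_mul_matY (hv : ‖v‖ = D.q0) (hvec : D.vec ≠ 0) (hz : z ≠ 0) :
    D.bdryE v (D.kz z) * D.matY v z = D.matY v z * diagonal (fun j => Complex.I * D.disp z j) := by
  have hn : dot2 v (fun i => conj (v i)) = (D.q0 : ℂ) ^ 2 := by rw [← norm_sq_eq_dot2, hv]
  have hl := lam_sq (D := D) hz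
  have h0 := q0_ne hvec
  suffices h : ∀ j, D.bdryE v (D.kz z) *ᵥ (D.matY v z).col j =
      (Complex.I * D.disp z j) • (D.matY v z).col j by
    ext i j
    have := congrFun (h j) i
    rw [mulVec_col] at this
    rw [mul_diagonal]
    simpa [mul_comm] using this
  intro j
  fin_cases j
  · have := entE_mulVec_of_eigenvector (k := D.kz z) (σ := D.sigma) (μ := -D.lam z) hn
      (by rw [neg_sq, hl]) (bdryA_mulVec_col hv hvec hz 0)
    refine this.trans ?_
    congr 1
    simp [disp]; ring
  -- The middle eigenvalue `ik` violates `μ² = k² + q₀²`, so this column is computed directly; `v^⊥`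
  -- is annihilated by `v†`.
  · funext i
    have hz1 : dot2 0 (fun i => conj (v i)) = 0 := by simp [dot2]
    have hz2 : dot2 v 0 = 0 := by simp [dot2]
    have hz3 : dot2 0 0 = 0 := by simp [dot2]
    rw [mulVec_three]
    fin_cases i <;>
    · simp [bdryE, entE, topE, rowE, colE, blockE, diagE, hn, hz1, hz2, hz3, matY, disp,
        -mul_eq_mul_left_iff, -mul_eq_mul_right_iff]
      field_simp
      ring
  · have := entE_mulVec_of_eigenvector (k := D.kz z) (σ := D.sigma) (μ := D.lam z) hn hl
      (bdryA_mulVec_col hv hvec hz 2)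
    refine this.trans ?_
    congr 1
    simp [disp]; ring

/-! ### The adjoint problem and traces -/

/-- Because `Q† = -Q`, one has `A(k*)† = -A(k)`. Together with the same fact for `E`, this makes the
bilinear pairing of adjoint and direct solutions constant in `x` and `t`. -/
theorem adjA_eq (k : ℂ) (x t : ℝ) : D.adjA k x t = -(D.laxA k x t)ᵀ := by
  ext i j
  fin_cases i <;> fin_cases j <;> simp [adjA, laxA_eq, blk, matJ, jet, jetc]

theorem adjE_eq (k : ℂ) (x t : ℝ) : D.adjE k x t = -(D.laxE k x t)ᵀ := by
  ext i j
  simp only [adjE, laxE_eq]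
  fin_cases i <;> fin_cases j <;>
  · simp [entE, topE, rowE, colE, blockE, diagE, dot2, jet, jetc, Complex.conj_ofNat]
    ring

theorem sum_freq (z : ℂ) : ∑ j, D.freq z j = D.kz z := by
  simp [freq, Fin.sum_univ_three]

theorem trace_laxA (z : ℂ) (x t : ℝ) :
    (D.laxA (D.kz z) x t).trace = Complex.I * ∑ j, D.freq z j := by
  rw [sum_freq, laxA_eq, trace_fin_three]
  simp [blk, matJ]

/-- The value of the pairing matrix at an end of the line, and the source of the factors `ρ_j/ρ` in
the scattering coefficients. -/
theorem adjY_transpose_mul_matY (hv : ‖v‖ = D.q0) (hvec : D.vec ≠ 0) (hz : z ≠ 0) :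
    (D.adjY v z)ᵀ * D.matY v z = diagonal ![D.rho z, 1, D.rho z] := by
  have h := norm_sq_eq_dot2 v
  rw [hv] at h
  simp only [dot2] at h
  have h0 := q0_ne hvec
  have hI := Complex.I_sq
  ext i j
  rw [Matrix.mul_apply, Fin.sum_univ_three]
  fin_cases i <;> fin_cases j <;> simp [adjY, matY, rho] <;> field_simp
  · linear_combination -(conj (v 0) * v 0 + conj (v 1) * v 1) * hI - h
  · ring
  · linear_combination -Complex.I * h
  · ring
  · linear_combination -h
  · ring
  · linear_combination Complex.I * h
  · ring
  · linear_combination -(D.q0 : ℂ) ^ 4 * hI - z ^ 2 * h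

theorem kz_conj (z : ℂ) : D.kz (conj z) = conj (D.kz z) := by simp [kz, Complex.conj_ofNat]

theorem lam_conj (z : ℂ) : D.lam (conj z) = conj (D.lam z) := by simp [lam, Complex.conj_ofNat]

theorem rho_conj (z : ℂ) : D.rho (conj z) = conj (D.rho z) := by simp [rho]

theorem phase_conj (z : ℂ) (x t : ℝ) (j : Fin 3) :
    D.phase (conj z) x t j = conj (D.phase z x t j) := by
  fin_cases j <;> simp [phase, kz_conj, lam_conj, Complex.conj_ofNat]

theorem kz_hat (hvec : D.vec ≠ 0) (hz : z ≠ 0) : D.kz (D.hat z) = D.kz z := by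
  have h0 := q0_ne hvec
  rw [kz, kz, hat]; field_simp; ring

theorem lam_hat (hvec : D.vec ≠ 0) (hz : z ≠ 0) : D.lam (D.hat z) = -D.lam z := by
  have h0 := q0_ne hvec
  rw [lam, lam, hat]; field_simp; ring

/-- The symmetry factor of `z ↦ -q₀²/z`. -/
def flip (D : Data) (z : ℂ) : Mat3 :=
  !![0, 0, Complex.I * z / D.q0; 0, 1, 0; Complex.I * z / D.q0, 0, 0]

theorem matY_hat (hvec : D.vec ≠ 0) (hz : z ≠ 0) :
    D.matY v (D.hat z) = D.matY v z * D.flip z := by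
  have h0 := q0_ne hvec
  have hI := Complex.I_sq
  ext i j
  rw [Matrix.mul_apply, Fin.sum_univ_three]
  fin_cases i <;> fin_cases j <;> simp [matY, hat, flip] <;> field_simp
  · linear_combination hI
  · linear_combination v 0 * hI
  · linear_combination v 1 * hI

theorem phase_hat (hvec : D.vec ≠ 0) (hz : z ≠ 0) (x t : ℝ) :
    D.phase (D.hat z) x t = ![D.phase z x t 2, D.phase z x t 1, D.phase z x t 0] := by
  funext j
  fin_cases j <;> simp [phase, kz_hat hvec hz, lam_hat hvec hz] <;> left <;> ring

end Data
end LPD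

namespace LPD

/-! ### Regularity of `E` along the field -/

section Regularity
variable {X : Type*}

theorem continuous_entE [TopologicalSpace X] (k σ q0 : ℂ) {a b c d a' b' c' d' : X → Fin 2 → ℂ}
    (ha : ∀ i, Continuous fun y => a y i) (hb : ∀ i, Continuous fun y => b y i)
    (hc : ∀ i, Continuous fun y => c y i) (hd : ∀ i, Continuous fun y => d y i)
    (ha' : ∀ i, Continuous fun y => a' y i) (hb' : ∀ i, Continuous fun y => b' y i)
    (hc' : ∀ i, Continuous fun y => c' y i) (hd' : ∀ i, Continuous fun y => d' y i) :
    Continuous fun y => entE k σ q0 (a y) (b y) (c y) (d y) (a' y) (b' y) (c' y) (d' y) := by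
  refine continuous_matrix fun i j => ?_
  fin_cases i <;> fin_cases j <;> simp [entE, topE, rowE, colE, blockE, dot2] <;> fun_prop

theorem continuous_entE' [TopologicalSpace X] (k σ : ℂ) {a b c d e a' b' c' d' e' : X → Fin 2 → ℂ}
    (ha : ∀ i, Continuous fun y => a y i) (hb : ∀ i, Continuous fun y => b y i)
    (hc : ∀ i, Continuous fun y => c y i) (hd : ∀ i, Continuous fun y => d y i)
    (he : ∀ i, Continuous fun y => e y i)
    (ha' : ∀ i, Continuous fun y => a' y i) (hb' : ∀ i, Continuous fun y => b' y i)
    (hc' : ∀ i, Continuous fun y => c' y i) (hd' : ∀ i, Continuous fun y => d' y i)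
    (he' : ∀ i, Continuous fun y => e' y i) :
    Continuous fun y =>
      entE' k σ (a y) (b y) (c y) (d y) (e y) (a' y) (b' y) (c' y) (d' y) (e' y) := by
  refine continuous_matrix fun i j => ?_
  fin_cases i <;> fin_cases j <;> simp [entE', topE', rowE', colE', blockE', dot2] <;> fun_prop

theorem differentiable_entE [NormedAddCommGroup X] [NormedSpace ℝ X] (k σ q0 : ℂ)
    {a b c d a' b' c' d' : X → Fin 2 → ℂ}
    (ha : ∀ i, Differentiable ℝ fun y => a y i) (hb : ∀ i, Differentiable ℝ fun y => b y i)
    (hc : ∀ i, Differentiable ℝ fun y => c y i) (hd : ∀ i, Differentiable ℝ fun y => d y i)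
    (ha' : ∀ i, Differentiable ℝ fun y => a' y i) (hb' : ∀ i, Differentiable ℝ fun y => b' y i)
    (hc' : ∀ i, Differentiable ℝ fun y => c' y i) (hd' : ∀ i, Differentiable ℝ fun y => d' y i)
    (i j : Fin 3) : Differentiable ℝ fun y =>
      entE k σ q0 (a y) (b y) (c y) (d y) (a' y) (b' y) (c' y) (d' y) i j := by
  fin_cases i <;> fin_cases j <;> simp [entE, topE, rowE, colE, blockE, dot2] <;> fun_prop

end Regularity

namespace Data
variable {D : Data}

/-- The conjugate coordinates of a vector. -/
def cc (v : Vec2) : Fin 2 → ℂ := fun i => conj (v i)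

theorem continuous_coord (i : Fin 2) : Continuous fun v : Vec2 => v i := by fun_prop

theorem continuous_cc (i : Fin 2) : Continuous fun v : Vec2 => cc v i :=
  Complex.continuous_conj.comp (continuous_coord i)

theorem differentiable_coord (i : Fin 2) : Differentiable ℝ fun v : Vec2 => v i := by fun_prop

theorem differentiable_cc (i : Fin 2) : Differentiable ℝ fun v : Vec2 => cc v i :=
  Complex.conjCLE.differentiable.comp (differentiable_coord i)

/-- `E` as a function of the jet `(q, q_x, q_xx, q_xxx)`. -/
def jetE (D : Data) (k : ℂ) (p : Vec2 × Vec2 × Vec2 × Vec2) : Mat3 :=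
  entE k D.sigma D.q0 p.1 p.2.1 p.2.2.1 p.2.2.2 (cc p.1) (cc p.2.1) (cc p.2.2.1) (cc p.2.2.2)

theorem laxE_eq_jetE (k : ℂ) (x t : ℝ) :
    D.laxE k x t = D.jetE k (D.dx 0 x t, D.dx 1 x t, D.dx 2 x t, D.dx 3 x t) := laxE_eq D k x t

theorem bdryE_eq_jetE (v : Vec2) (k : ℂ) : D.bdryE v k = D.jetE k (v, 0, 0, 0) := by
  have h : cc 0 = 0 := by funext i; simp [cc]
  simp only [bdryE, jetE, h]; rfl

/-- `E` is polynomial in the jet and its conjugate, hence real differentiable. A linear bound is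
wanted, rather than mere continuity, so that exponentially weighted decay of the jet passes to `E`.
-/
theorem jetE_lipschitz (k : ℂ) (p₀ : Vec2 × Vec2 × Vec2 × Vec2) : ∃ C > 0, ∃ δ > 0, ∀ p,
    ‖p - p₀‖ < δ → entrySum (D.jetE k p - D.jetE k p₀) ≤ C * ‖p - p₀‖ := by
  have h1 : ∀ i j, (fun p => D.jetE k p i j - D.jetE k p₀ i j) =O[𝓝 p₀] fun p => p - p₀ := by
    intro i j
    refine (differentiable_entE k D.sigma D.q0 (X := Vec2 × Vec2 × Vec2 × Vec2)
      (fun i => (differentiable_coord i).comp ?_) (fun i => (differentiable_coord i).comp ?_)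
      (fun i => (differentiable_coord i).comp ?_) (fun i => (differentiable_coord i).comp ?_)
      (fun i => (differentiable_cc i).comp ?_) (fun i => (differentiable_cc i).comp ?_)
      (fun i => (differentiable_cc i).comp ?_) (fun i => (differentiable_cc i).comp ?_)
      i j p₀).isBigO_sub <;> fun_prop
  have h2 : (fun p => entrySum (D.jetE k p - D.jetE k p₀)) =O[𝓝 p₀] fun p => p - p₀ :=
    Asymptotics.IsBigO.fun_sum fun i _ => Asymptotics.IsBigO.fun_sum fun j _ => (h1 i j).norm_left
  obtain ⟨C, hC, hb⟩ := h2.exists_pos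
  obtain ⟨δ, hδ, hball⟩ := Metric.eventually_nhds_iff.1 hb.bound
  refine ⟨C, hC, δ, hδ, fun p hp => ?_⟩
  have := hball (y := p) (by rwa [dist_eq_norm])
  exact (le_abs_self _).trans this

/-! ### Consequences of the differential equation -/

theorem jet_hasDerivAt (hsol : D.IsSolution) {m : ℕ} (hm : m ≤ 3) (x t : ℝ) (i : Fin 2) :
    HasDerivAt (fun y => D.jet m y t i) (D.jet (m + 1) x t i) x := by
  have h1 : HasDerivAt (fun y => D.dx m y t) (D.dx (m + 1) x t) x := by
    have hd : Differentiable ℝ (iteratedDeriv m fun y => D.q y t) :=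
      (hsol.contDiff_x t).differentiable_iteratedDeriv m (by
        have : m < 4 := by omega
        exact_mod_cast this)
    have := (hd x).hasDerivAt
    rwa [← iteratedDeriv_succ] at this
  have h2 := ((EuclideanSpace.proj (𝕜 := ℂ) i).restrictScalars ℝ).hasFDerivAt.comp_hasDerivAt x h1
  exact h2

theorem jetc_hasDerivAt (hsol : D.IsSolution) {m : ℕ} (hm : m ≤ 3) (x t : ℝ) (i : Fin 2) :
    HasDerivAt (fun y => D.jetc m y t i) (D.jetc (m + 1) x t i) x :=
  Complex.conjCLE.hasFDerivAt.comp_hasDerivAt x (jet_hasDerivAt hsol hm x t i)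

/-- The time derivative of the field in coordinates. -/
def qt (D : Data) (x t : ℝ) : Fin 2 → ℂ := fun i => (deriv (fun s => D.q x s) t) i

def qtc (D : Data) (x t : ℝ) : Fin 2 → ℂ := fun i => conj ((deriv (fun s => D.q x s) t) i)

theorem jet_zero_hasDerivAt (hsol : D.IsSolution) (x t : ℝ) (i : Fin 2) :
    HasDerivAt (fun s => D.jet 0 x s i) (D.qt x t i) t := by
  have h1 := (hsol.differentiable_t x t).hasDerivAt
  have h2 := ((EuclideanSpace.proj (𝕜 := ℂ) i).restrictScalars ℝ).hasFDerivAt.comp_hasDerivAt t h1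
  simp only [jet, dx_zero]
  exact h2

theorem jetc_zero_hasDerivAt (hsol : D.IsSolution) (x t : ℝ) (i : Fin 2) :
    HasDerivAt (fun s => D.jetc 0 x s i) (D.qtc x t i) t :=
  Complex.conjCLE.hasFDerivAt.comp_hasDerivAt t (jet_zero_hasDerivAt hsol x t i)

theorem inner_eq_dot2 (u v : Vec2) : inner ℂ u v = dot2 v (cc u) := by
  rw [PiLp.inner_apply, Fin.sum_univ_two]
  simp [dot2, cc, mul_comm]

theorem continuous_jet (hsol : D.IsSolution) {m : ℕ} (hm : m ≤ 4) (i : Fin 2) :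
    Continuous fun p : ℝ × ℝ => D.jet m p.1 p.2 i :=
  (continuous_coord i).comp (hsol.continuous_dx m hm)

theorem continuous_jetc (hsol : D.IsSolution) {m : ℕ} (hm : m ≤ 4) (i : Fin 2) :
    Continuous fun p : ℝ × ℝ => D.jetc m p.1 p.2 i :=
  (continuous_cc i).comp (hsol.continuous_dx m hm)

theorem equation_coord (hsol : D.IsSolution) (x t : ℝ) (i : Fin 2) :
    let a := D.jet 0 x t; let b := D.jet 1 x t; let c := D.jet 2 x t; let e := D.jet 4 x t
    let a' := D.jetc 0 x t; let b' := D.jetc 1 x t; let c' := D.jetc 2 x t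
    let σ : ℂ := D.sigma; let q0 : ℂ := D.q0
    Complex.I * D.qt x t i + c i + 2 * (dot2 a a' - q0 ^ 2) * a i + σ * (e i
      + 2 * dot2 b b' * a i + 2 * dot2 a b' * b i + 6 * dot2 b a' * b i + 4 * dot2 a a' * c i
      + 4 * dot2 c a' * a i + 2 * dot2 a c' * a i + 6 * (dot2 a a' ^ 2 - q0 ^ 4) * a i) = 0 := by
  intro a b c e a' b' c' σ q0
  have h := congrArg (fun v : Vec2 => v i) (hsol.equation x t)
  have n0 : (‖D.dx 0 x t‖ : ℂ) ^ 2 = dot2 a a' := norm_sq_eq_dot2 _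
  have n1 : (‖D.dx 1 x t‖ : ℂ) ^ 2 = dot2 b b' := norm_sq_eq_dot2 _
  have i1 : inner ℂ (D.dx 1 x t) (D.dx 0 x t) = dot2 a b' := inner_eq_dot2 _ _
  have i2 : inner ℂ (D.dx 0 x t) (D.dx 1 x t) = dot2 b a' := inner_eq_dot2 _ _
  have i3 : inner ℂ (D.dx 0 x t) (D.dx 2 x t) = dot2 c a' := inner_eq_dot2 _ _
  have i4 : inner ℂ (D.dx 2 x t) (D.dx 0 x t) = dot2 a c' := inner_eq_dot2 _ _
  rw [← dx_zero] at h
  simp only [i1, i2, i3, i4, PiLp.add_apply, PiLp.smul_apply, smul_eq_mul, Complex.real_smul,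
    PiLp.zero_apply] at h
  push_cast at h
  have n2 : (‖D.dx 0 x t‖ : ℂ) ^ 4 = dot2 a a' ^ 2 := by rw [← n0]; ring
  rw [n2, n0, n1] at h
  exact h

theorem conj_dot2 (u v : Vec2) : conj (dot2 u (cc v)) = dot2 v (cc u) := by
  simp [dot2, cc, mul_comm]

theorem equation_coord_conj (hsol : D.IsSolution) (x t : ℝ) (i : Fin 2) :
    let a := D.jet 0 x t; let b := D.jet 1 x t; let c := D.jet 2 x t
    let a' := D.jetc 0 x t; let b' := D.jetc 1 x t; let c' := D.jetc 2 x t; let e' := D.jetc 4 x t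
    let σ : ℂ := D.sigma; let q0 : ℂ := D.q0;
    -Complex.I * D.qtc x t i + c' i + 2 * (dot2 a a' - q0 ^ 2) * a' i + σ * (e' i
      + 2 * dot2 b b' * a' i + 2 * dot2 b a' * b' i + 6 * dot2 a b' * b' i + 4 * dot2 a a' * c' i
      + 4 * dot2 a c' * a' i + 2 * dot2 c a' * a' i + 6 * (dot2 a a' ^ 2 - q0 ^ 4) * a' i) = 0 := by
  intro a b c a' b' c' e' σ q0
  have h := congrArg conj (equation_coord hsol x t i)
  have hd : ∀ m n, conj (dot2 (D.jet m x t) (D.jetc n x t)) = dot2 (D.jet n x t) (D.jetc m x t) :=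
    fun m n => conj_dot2 _ _
  simp only [map_add, map_mul, map_sub, map_pow, hd, Complex.conj_I, Complex.conj_ofReal,
    Complex.conj_ofNat, map_zero] at h
  exact h

/-- The compatibility condition of the Lax pair. -/
theorem zero_curvature (hsol : D.IsSolution) (k : ℂ) (x t : ℝ) :
    entE' k D.sigma (D.jet 0 x t) (D.jet 1 x t) (D.jet 2 x t) (D.jet 3 x t) (D.jet 4 x t)
        (D.jetc 0 x t) (D.jetc 1 x t) (D.jetc 2 x t) (D.jetc 3 x t) (D.jetc 4 x t)
      + D.laxE k x t * D.laxA k x t =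
    blk (D.qt x t) (D.qtc x t) + D.laxA k x t * D.laxE k x t := by
  rw [laxE_eq, laxA_eq]
  exact zero_curvature_poly (fun i => equation_coord hsol x t i)
    (fun i => equation_coord_conj hsol x t i)

theorem continuous_laxE (hsol : D.IsSolution) (k : ℂ) :
    Continuous fun p : ℝ × ℝ => D.laxE k p.1 p.2 := by
  simp only [laxE_eq]
  exact continuous_entE _ _ _ (continuous_jet hsol (by norm_num)) (continuous_jet hsol (by norm_num))
    (continuous_jet hsol (by norm_num)) (continuous_jet hsol (by norm_num))
    (continuous_jetc hsol (by norm_num)) (continuous_jetc hsol (by norm_num))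
    (continuous_jetc hsol (by norm_num)) (continuous_jetc hsol (by norm_num))

theorem continuous_blk {X : Type*} [TopologicalSpace X] {a a' : X → Fin 2 → ℂ}
    (ha : ∀ i, Continuous fun y => a y i) (ha' : ∀ i, Continuous fun y => a' y i) :
    Continuous fun y => blk (a y) (a' y) := by
  refine continuous_matrix fun i j => ?_
  fin_cases i <;> fin_cases j <;> simp [blk] <;> fun_prop

theorem continuous_laxA (hsol : D.IsSolution) (k : ℂ) :
    Continuous fun p : ℝ × ℝ => D.laxA k p.1 p.2 := by
  simp only [laxA_eq]
  exact continuous_const.add (continuous_blk (continuous_jet hsol (by norm_num))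
    (continuous_jetc hsol (by norm_num)))

theorem hasDerivAt_blk {a a' : ℝ → Fin 2 → ℂ} {b b' : Fin 2 → ℂ} {x : ℝ}
    (ha : ∀ i, HasDerivAt (fun y => a y i) (b i) x)
    (ha' : ∀ i, HasDerivAt (fun y => a' y i) (b' i) x) (i j : Fin 3) :
    HasDerivAt (fun y => blk (a y) (a' y) i j) (blk b b' i j) x := by
  fin_cases i <;> fin_cases j
  exacts [hasDerivAt_const _ _, ha' 0, ha' 1, (ha 0).neg, hasDerivAt_const _ _, hasDerivAt_const _ _,
    (ha 1).neg, hasDerivAt_const _ _, hasDerivAt_const _ _]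

/-- A solution of the temporal equation that solves the spatial one at time zero solves it always. -/
theorem hasDerivAt_space_of_time (hsol : D.IsSolution) (k : ℂ) {ψ : ℝ → ℝ → Fin 3 → ℂ}
    (hψt : ∀ x t, HasDerivAt (fun s => ψ x s) (D.laxE k x t *ᵥ ψ x t) t)
    (hψ0 : ∀ x, HasDerivAt (fun y => ψ y 0) (D.laxA k x 0 *ᵥ ψ x 0) x) (x t : ℝ) :
    HasDerivAt (fun y => ψ y t) (D.laxA k x t *ᵥ ψ x t) x := by
  refine hasDerivAt_of_zero_curvature (A' := fun x t => blk (D.qt x t) (D.qtc x t))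
    (E' := fun x t => entE' k D.sigma (D.jet 0 x t) (D.jet 1 x t) (D.jet 2 x t) (D.jet 3 x t)
      (D.jet 4 x t) (D.jetc 0 x t) (D.jetc 1 x t) (D.jetc 2 x t) (D.jetc 3 x t) (D.jetc 4 x t))
    (continuous_laxE hsol k) ?_ (fun x => (continuous_laxA hsol k).comp (by fun_prop :
      Continuous fun t : ℝ => (x, t))) ?_ ?_ (zero_curvature hsol k) hψt hψ0 x t
  · exact continuous_entE' _ _ (continuous_jet hsol (by norm_num)) (continuous_jet hsol (by norm_num))
      (continuous_jet hsol (by norm_num)) (continuous_jet hsol (by norm_num))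
      (continuous_jet hsol (by norm_num))
      (continuous_jetc hsol (by norm_num)) (continuous_jetc hsol (by norm_num))
      (continuous_jetc hsol (by norm_num)) (continuous_jetc hsol (by norm_num))
      (continuous_jetc hsol (by norm_num))
  · intro x t i j
    simp only [laxA_eq]
    exact (hasDerivAt_blk (jet_zero_hasDerivAt hsol x t) (jetc_zero_hasDerivAt hsol x t)
      i j).const_add _
  · intro x t i j
    simp only [laxE_eq]
    exact hasDerivAt_entE _ _ _ (jet_hasDerivAt hsol (by norm_num) x t)
      (jet_hasDerivAt hsol (by norm_num) x t) (jet_hasDerivAt hsol (by norm_num) x t)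
      (jet_hasDerivAt hsol (by norm_num) x t) (jetc_hasDerivAt hsol (by norm_num) x t)
      (jetc_hasDerivAt hsol (by norm_num) x t) (jetc_hasDerivAt hsol (by norm_num) x t)
      (jetc_hasDerivAt hsol (by norm_num) x t) i j

end Data
end LPD

namespace LPD

/-! ### Diagonalization at an end of the line -/

/-- `e^{-iγ} Y⁻¹ ψ`. -/
def gauged (Y : Mat3) (γ ψ : Fin 3 → ℂ) : Fin 3 → ℂ :=
  fun l => Complex.exp (-(Complex.I * γ l)) * (Y⁻¹ *ᵥ ψ) l

/-- `Y e^{iγ} w`. -/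
def ungauged (Y : Mat3) (γ w : Fin 3 → ℂ) : Fin 3 → ℂ :=
  Y *ᵥ fun l => Complex.exp (Complex.I * γ l) * w l

/-- `e^{-iγ} Y⁻¹ N Y e^{iγ}`. -/
def gaugeConj (Y : Mat3) (γ : Fin 3 → ℂ) (N : Mat3) : Mat3 :=
  of fun l m => Complex.exp (-(Complex.I * γ l)) * (Y⁻¹ * N * Y) l m * Complex.exp (Complex.I * γ m)

section Gauge
variable {Y : Mat3} {γ : Fin 3 → ℂ}

theorem exp_neg_mul_exp (a : ℂ) : Complex.exp (-a) * Complex.exp a = 1 := by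
  rw [← Complex.exp_add, neg_add_cancel, Complex.exp_zero]

theorem gauged_ungauged (hY : IsUnit Y.det) (w : Fin 3 → ℂ) : gauged Y γ (ungauged Y γ w) = w := by
  funext l
  simp only [gauged, ungauged]
  rw [mulVec_mulVec, nonsing_inv_mul _ hY, one_mulVec, ← mul_assoc, exp_neg_mul_exp, one_mul]

theorem ungauged_gauged (hY : IsUnit Y.det) (ψ : Fin 3 → ℂ) : ungauged Y γ (gauged Y γ ψ) = ψ := by
  simp only [gauged, ungauged, ← mul_assoc, mul_comm (Complex.exp (Complex.I * _)) (Complex.exp (-_)),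
    exp_neg_mul_exp, one_mul]
  rw [mulVec_mulVec, mul_nonsing_inv _ hY, one_mulVec]

/-- In the gauge `Y e^{iγ}` the matrix `M` splits into the diagonal part `iω` of its limit `M₀` and
the conjugated perturbation `M - M₀`. Both directions of the gauge transformation, in `x` and in
`t`, rest on this identity. -/
theorem exp_mul_inv_mulVec (hY : IsUnit Y.det) {M M₀ : Mat3} {ω : Fin 3 → ℂ}
    (hM : M₀ * Y = Y * diagonal fun j => Complex.I * ω j) (ψ : Fin 3 → ℂ) (l : Fin 3) :
    Complex.exp (-(Complex.I * γ l)) * (Y⁻¹ *ᵥ (M *ᵥ ψ)) l =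
      Complex.I * ω l * gauged Y γ ψ l + (gaugeConj Y γ (M - M₀) *ᵥ gauged Y γ ψ) l := by
  have h1 : Y⁻¹ *ᵥ (M *ᵥ ψ) = (diagonal (fun j => Complex.I * ω j) + Y⁻¹ * (M - M₀) * Y) *ᵥ
      (Y⁻¹ *ᵥ ψ) := by
    have h2 : Y⁻¹ * M = (diagonal (fun j => Complex.I * ω j) + Y⁻¹ * (M - M₀) * Y) * Y⁻¹ := by
      have h3 : diagonal (fun j => Complex.I * ω j) = Y⁻¹ * M₀ * Y := by
        rw [mul_assoc, hM, ← mul_assoc, nonsing_inv_mul _ hY, one_mul]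
      rw [h3, ← add_mul, ← mul_add, add_sub_cancel, mul_assoc, mul_nonsing_inv _ hY, mul_one]
    rw [mulVec_mulVec, mulVec_mulVec, h2]
  rw [h1, add_mulVec, Pi.add_apply, mulVec_diagonal, mul_add]
  congr 1
  · simp only [gauged]; ring
  · simp only [mulVec, dotProduct, gaugeConj, of_apply, gauged]
    rw [Finset.mul_sum]
    refine Finset.sum_congr rfl fun m _ => ?_
    have := exp_neg_mul_exp (Complex.I * γ m)
    linear_combination (-Complex.exp (-(Complex.I * γ l)) * (Y⁻¹ * (M - M₀) * Y) l m *
      ∑ x, Y⁻¹ m x * ψ x) * this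

theorem hasDerivAt_gauged (hY : IsUnit Y.det) {M M₀ : Mat3} {ω g : Fin 3 → ℂ} {γ ψ : ℝ → Fin 3 → ℂ}
    {s : ℝ} (hM : M₀ * Y = Y * diagonal fun j => Complex.I * ω j)
    (hγ : ∀ l, HasDerivAt (fun s => γ s l) (g l) s) (hψ : HasDerivAt ψ (M *ᵥ ψ s) s) :
    HasDerivAt (fun s => gauged Y (γ s) (ψ s)) (fun l => Complex.I * (ω l - g l) *
      gauged Y (γ s) (ψ s) l + (gaugeConj Y (γ s) (M - M₀) *ᵥ gauged Y (γ s) (ψ s)) l) s := by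
  refine hasDerivAt_pi.2 fun l => ?_
  have h1 : HasDerivAt (fun s => (Y⁻¹ *ᵥ ψ s) l) ((Y⁻¹ *ᵥ (M *ᵥ ψ s)) l) s := by
    simp only [mulVec, dotProduct] at hψ ⊢
    exact HasDerivAt.fun_sum fun j _ => (hasDerivAt_pi.1 hψ j).const_mul _
  have h2 := (((hγ l).const_mul Complex.I).neg.cexp).mul h1
  refine h2.congr_deriv ?_
  have h3 := exp_mul_inv_mulVec (γ := γ s) (M := M) hY hM (ψ s) l
  simp only [Pi.neg_apply] at h3 ⊢
  rw [h3]
  simp only [gauged]; ring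

theorem hasDerivAt_ungauged (hY : IsUnit Y.det) {M M₀ : Mat3} {ω g : Fin 3 → ℂ}
    {γ w : ℝ → Fin 3 → ℂ} {s : ℝ} (hM : M₀ * Y = Y * diagonal fun j => Complex.I * ω j)
    (hγ : ∀ l, HasDerivAt (fun s => γ s l) (g l) s)
    (hw : HasDerivAt w (fun l => Complex.I * (ω l - g l) * w s l +
      (gaugeConj Y (γ s) (M - M₀) *ᵥ w s) l) s) :
    HasDerivAt (fun s => ungauged Y (γ s) (w s)) (M *ᵥ ungauged Y (γ s) (w s)) s := by
  have h1 : ∀ l, HasDerivAt (fun s => Complex.exp (Complex.I * γ s l) * w s l)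
      ((Y⁻¹ *ᵥ (M *ᵥ ungauged Y (γ s) (w s))) l) s := by
    intro l
    refine ((((hγ l).const_mul Complex.I).cexp).mul (hasDerivAt_pi.1 hw l)).congr_deriv ?_
    have h3 := exp_mul_inv_mulVec (γ := γ s) (M := M) hY hM (ungauged Y (γ s) (w s)) l
    rw [gauged_ungauged hY] at h3
    have h4 := exp_neg_mul_exp (Complex.I * γ s l)
    linear_combination (-Complex.exp (Complex.I * γ s l)) * h3 +
      (Y⁻¹ *ᵥ (M *ᵥ ungauged Y (γ s) (w s))) l * h4
  have h2 : M *ᵥ ungauged Y (γ s) (w s) = Y *ᵥ (Y⁻¹ *ᵥ (M *ᵥ ungauged Y (γ s) (w s))) := by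
    rw [mulVec_mulVec _ Y, mul_nonsing_inv _ hY, one_mulVec]
  rw [h2]
  refine hasDerivAt_pi.2 fun i => ?_
  simp only [ungauged]
  simp only [mulVec, dotProduct] at h1 ⊢
  exact HasDerivAt.fun_sum fun j _ => (h1 j).const_mul _

theorem entrySum_mul_le (M N : Mat3) : entrySum (M * N) ≤ entrySum M * entrySum N := by
  have h : ∀ i j, ‖(M * N) i j‖ ≤ ∑ k, ‖M i k‖ * ‖N k j‖ := fun i j => by
    rw [Matrix.mul_apply]
    exact norm_sum_le_of_le _ fun k _ => (norm_mul _ _).le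
  simp only [entrySum]
  calc ∑ i, ∑ j, ‖(M * N) i j‖ ≤ ∑ i, ∑ j, ∑ k, ‖M i k‖ * ‖N k j‖ :=
        Finset.sum_le_sum fun i _ => Finset.sum_le_sum fun j _ => h i j
    _ = ∑ i, ∑ k, ‖M i k‖ * ∑ j, ‖N k j‖ := by
        refine Finset.sum_congr rfl fun i _ => ?_
        rw [Finset.sum_comm]
        simp only [Finset.mul_sum]
    _ ≤ ∑ i, ∑ k, ‖M i k‖ * ∑ k, ∑ j, ‖N k j‖ := by
        refine Finset.sum_le_sum fun i _ => Finset.sum_le_sum fun k _ =>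
          mul_le_mul_of_nonneg_left ?_ (norm_nonneg _)
        exact Finset.single_le_sum (f := fun k => ∑ j, ‖N k j‖)
          (fun k _ => Finset.sum_nonneg fun j _ => norm_nonneg _) (Finset.mem_univ k)
    _ = _ := by simp only [Finset.sum_mul]

theorem entrySum_gaugeConj_le {G : ℝ} (hG : ∀ l m,
    ‖Complex.exp (-(Complex.I * γ l)) * Complex.exp (Complex.I * γ m)‖ ≤ G) (N : Mat3) :
    entrySum (gaugeConj Y γ N) ≤ G * (entrySum Y⁻¹ * entrySum Y) * entrySum N := by
  have hG0 : 0 ≤ G := (norm_nonneg _).trans (hG 0 0)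
  have h1 : entrySum (gaugeConj Y γ N) ≤ G * entrySum (Y⁻¹ * N * Y) := by
    simp only [entrySum, Finset.mul_sum]
    refine Finset.sum_le_sum fun i _ => Finset.sum_le_sum fun j _ => ?_
    have : gaugeConj Y γ N i j = (Complex.exp (-(Complex.I * γ i)) * Complex.exp (Complex.I * γ j)) *
        (Y⁻¹ * N * Y) i j := by simp only [gaugeConj, of_apply]; ring
    rw [this, norm_mul]
    exact mul_le_mul_of_nonneg_right (hG i j) (norm_nonneg _)
  have h2 := (entrySum_mul_le (Y⁻¹ * N) Y).trans
    (mul_le_mul_of_nonneg_right (entrySum_mul_le Y⁻¹ N) (entrySum_nonneg Y))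
  refine h1.trans ((mul_le_mul_of_nonneg_left h2 hG0).trans (le_of_eq (by ring)))

end Gauge

namespace Data
variable {D : Data}

/-! ### The two ends of the line -/

/-- `F` is the end of the line at `-ε∞`, with boundary value `v`. -/
def IsEnd (D : Data) (ε : ℝ) (F : Filter ℝ) (v : Vec2) : Prop :=
  (ε = 1 ∧ F = atBot ∧ v = D.qM) ∨ (ε = -1 ∧ F = atTop ∧ v = D.qP)

theorem isEnd_neg (D : Data) : D.IsEnd 1 atBot D.qM := Or.inl ⟨rfl, rfl, rfl⟩

theorem isEnd_pos (D : Data) : D.IsEnd (-1) atTop D.qP := Or.inr ⟨rfl, rfl, rfl⟩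

namespace IsEnd
variable {ε : ℝ} {F : Filter ℝ} {v : Vec2} {w : ℝ}

theorem norm_eq (h : D.IsEnd ε F v) : ‖v‖ = D.q0 := by
  rcases h with ⟨-, -, rfl⟩ | ⟨-, -, rfl⟩
  · exact norm_qM
  · exact norm_qP

theorem mul_self (h : D.IsEnd ε F v) : ε * ε = 1 := by
  rcases h with ⟨rfl, -, -⟩ | ⟨rfl, -, -⟩ <;> norm_num

theorem abs_mul (h : D.IsEnd ε F v) (x : ℝ) : |ε * x| = |x| := by
  rcases h with ⟨rfl, -, -⟩ | ⟨rfl, -, -⟩ <;> simp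

theorem tendsto_mul (h : D.IsEnd ε F v) : Tendsto (fun x => ε * x) F atBot := by
  rcases h with ⟨rfl, rfl, -⟩ | ⟨rfl, rfl, -⟩
  · simp only [one_mul]; exact tendsto_id
  · simpa using tendsto_neg_atTop_atBot

theorem tendsto_mul' (h : D.IsEnd ε F v) : Tendsto (fun x => ε * x) atBot F := by
  rcases h with ⟨rfl, rfl, -⟩ | ⟨rfl, rfl, -⟩
  · simp only [one_mul]; exact tendsto_id
  · simpa using tendsto_neg_atBot_atTop

theorem neBot (h : D.IsEnd ε F v) : F.NeBot := by
  rcases h with ⟨-, rfl, -⟩ | ⟨-, rfl, -⟩ <;> infer_instance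

theorem integrable (h : D.IsEnd ε F v) (hd : D.Decays w) (t a : ℝ) :
    IntegrableOn (fun y => Real.exp (w * |y|) * ‖D.q (ε * y) t - v‖) (Iic a) := by
  rcases h with ⟨rfl, rfl, rfl⟩ | ⟨rfl, rfl, rfl⟩
  · have := (hd.integrable_neg t a).norm
    simpa [norm_smul, IntegrableOn] using this
  · have h1 : IntegrableOn (fun y => Real.exp (w * |y|) * ‖D.q y t - D.qP‖) (Ici (-a)) := by
      have := (hd.integrable_pos t (-a)).norm
      simpa [norm_smul, IntegrableOn] using this
    simpa using h1.comp_neg_Iic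

theorem tendstoLocallyUniformly_dx (h : D.IsEnd ε F v) (hd : D.Decays w) {m : ℕ} (h1 : 1 ≤ m)
    (h3 : m ≤ 3) : TendstoLocallyUniformly
      (fun x t => Real.exp (w * |x|) • D.dx m x t) (fun _ => 0) F := by
  rcases h with ⟨rfl, rfl, rfl⟩ | ⟨rfl, rfl, rfl⟩
  · exact hd.limit_dx_neg m h1 h3
  · exact hd.limit_dx_pos m h1 h3

theorem tendstoLocallyUniformly_q (h : D.IsEnd ε F v) (hd : D.Decays w) : TendstoLocallyUniformly
    (fun x t => Real.exp (w * |x|) • (D.q x t - v)) (fun _ => 0) F := by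
  rcases h with ⟨rfl, rfl, rfl⟩ | ⟨rfl, rfl, rfl⟩
  · exact hd.limit_neg
  · exact hd.limit_pos

end IsEnd

theorem eventually_norm_le {u : ℝ → ℝ → Vec2} {F : Filter ℝ} {w : ℝ}
    (h : TendstoLocallyUniformly (fun x t => Real.exp (w * |x|) • u x t) (fun _ => 0) F) (T : ℝ)
    {η : ℝ} (hη : 0 < η) :
    ∀ᶠ x in F, ∀ s ∈ Icc (-T) T, Real.exp (w * |x|) * ‖u x s‖ < η := by
  have h1 := (tendstoLocallyUniformlyOn_iff_tendstoUniformlyOn_of_compact isCompact_Icc).1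
    (h.tendstoLocallyUniformlyOn (s := Icc (-T) T))
  filter_upwards [Metric.tendstoUniformlyOn_iff.1 h1 η hη] with x hx s hs
  have := hx s hs
  rwa [dist_zero_left, norm_smul, Real.norm_of_nonneg (Real.exp_pos _).le] at this

/-- The Lipschitz bound transfers the weighted decay from the jet to `E`. As the weight is at least
1, weighted smallness also places the jet inside the ball where the Lipschitz bound is valid. -/
theorem IsEnd.eventually_entrySum_le {ε : ℝ} {F : Filter ℝ} {v : Vec2} {w : ℝ} (h : D.IsEnd ε F v)
    (hw : 0 ≤ w) (hd : D.Decays w) (k : ℂ) (T : ℝ) {η : ℝ} (hη : 0 < η) :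
    ∀ᶠ x in F, ∀ s ∈ Icc (-T) T,
      Real.exp (w * |x|) * entrySum (D.laxE k x s - D.bdryE v k) ≤ η := by
  obtain ⟨C, hC, δ, hδ, hlip⟩ := jetE_lipschitz (D := D) k (v, 0, 0, 0)
  have hm : 0 < min δ (η / C) := by positivity
  filter_upwards [eventually_norm_le (h.tendstoLocallyUniformly_q hd) T hm,
    eventually_norm_le (h.tendstoLocallyUniformly_dx hd (m := 1) (by norm_num) (by norm_num)) T hm,
    eventually_norm_le (h.tendstoLocallyUniformly_dx hd (m := 2) (by norm_num) (by norm_num)) T hm,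
    eventually_norm_le (h.tendstoLocallyUniformly_dx hd (m := 3) (by norm_num) (by norm_num)) T hm]
    with x h0 h1 h2 h3 s hs
  rw [laxE_eq_jetE, bdryE_eq_jetE, dx_zero]
  set p : Vec2 × Vec2 × Vec2 × Vec2 := (D.q x s, D.dx 1 x s, D.dx 2 x s, D.dx 3 x s)
  have he : 1 ≤ Real.exp (w * |x|) := Real.one_le_exp (by positivity)
  have hp : Real.exp (w * |x|) * ‖p - (v, 0, 0, 0)‖ < min δ (η / C) := by
    have : ‖p - (v, 0, 0, 0)‖ =
        max ‖D.q x s - v‖ (max ‖D.dx 1 x s‖ (max ‖D.dx 2 x s‖ ‖D.dx 3 x s‖)) := by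
      simp [p, Prod.norm_def]
    rw [this, mul_max_of_nonneg _ _ (by positivity), mul_max_of_nonneg _ _ (by positivity),
      mul_max_of_nonneg _ _ (by positivity)]
    exact max_lt (h0 s hs) (max_lt (h1 s hs) (max_lt (h2 s hs) (h3 s hs)))
  have h4 := hlip p ((le_mul_of_one_le_left (norm_nonneg _) he).trans_lt
    (hp.trans_le (min_le_left _ _)))
  calc _ ≤ Real.exp (w * |x|) * (C * ‖p - (v, 0, 0, 0)‖) := by gcongr
    _ = C * (Real.exp (w * |x|) * ‖p - (v, 0, 0, 0)‖) := by ring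
    _ ≤ C * (η / C) := by gcongr; exact hp.le.trans (min_le_right _ _)
    _ = η := by field_simp

end Data
end LPD

/-! ### Change of gauge, and spatial solutions normalized at one end -/

namespace LPD

/-- Passing from `γ` to `γ'` multiplies each component by `e^{i(γ_l - γ'_l)}`. This factor is 1 for
the component that tends to 1, and only needs to be bounded for those that tend to 0. The lemma
exchanges the two limit conditions of `IsJost`. -/
theorem tendsto_gauged_of_bounded {Y : Mat3} {F : Filter ℝ} {γ γ' ψ : ℝ → Fin 3 → ℂ} {j : Fin 3}
    {K : ℝ} (hj : ∀ x, γ' x j = γ x j)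
    (hK : ∀ᶠ x in F, ∀ l, ‖Complex.exp (Complex.I * (γ x l - γ' x l))‖ ≤ K)
    (h : Tendsto (fun x => gauged Y (γ x) (ψ x)) F (𝓝 (Pi.single j 1))) :
    Tendsto (fun x => gauged Y (γ' x) (ψ x)) F (𝓝 (Pi.single j 1)) := by
  have key : ∀ x l, gauged Y (γ' x) (ψ x) l =
      Complex.exp (Complex.I * (γ x l - γ' x l)) * gauged Y (γ x) (ψ x) l := by
    intro x l
    simp only [gauged]
    rw [← mul_assoc, ← Complex.exp_add]
    congr 2
    ring
  rw [tendsto_pi_nhds] at h ⊢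
  intro l
  by_cases hl : l = j
  · subst hl
    refine (h l).congr fun x => ?_
    rw [key, hj, sub_self, mul_zero, Complex.exp_zero, one_mul]
  · have h0 := h l
    simp only [Pi.single_eq_of_ne hl] at h0 ⊢
    have h1 : Tendsto (fun x => K * ‖gauged Y (γ x) (ψ x) l‖) F (𝓝 0) := by
      simpa using h0.norm.const_mul K
    refine squeeze_zero_norm' ?_ h1
    filter_upwards [hK] with x hx
    rw [key, norm_mul]
    exact mul_le_mul_of_nonneg_right (hx l) (norm_nonneg _)

/-- When only the scalar phase `θ_j` is removed, the gauge is a fixed linear isomorphism and the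
gauged limit is the first limit condition of `IsJost`. -/
theorem tendsto_gauged_const_iff {Y : Mat3} (hY : IsUnit Y.det) {F : Filter ℝ} {θ : ℝ → Fin 3 → ℂ}
    {ψ : ℝ → Fin 3 → ℂ} {j : Fin 3} :
    Tendsto (fun x => gauged Y (fun _ => θ x j) (ψ x)) F (𝓝 (Pi.single j 1)) ↔
      Tendsto (fun x => Complex.exp (-(Complex.I * θ x j)) • ψ x) F (𝓝 (fun i => Y i j)) := by
  have h1 : ∀ x, gauged Y (fun _ => θ x j) (ψ x) =
      Y⁻¹ *ᵥ (Complex.exp (-(Complex.I * θ x j)) • ψ x) := fun x => by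
    funext l; rw [mulVec_smul]; rfl
  have h2 : (fun i => Y i j) = Y *ᵥ Pi.single j 1 := by
    funext i; simp
  have hc : ∀ M : Mat3, Continuous fun v : Fin 3 → ℂ => M *ᵥ v := fun M =>
    Continuous.matrix_mulVec continuous_const continuous_id
  simp only [h1]
  constructor
  · intro h
    have := ((hc Y).tendsto _).comp h
    rw [← h2] at this
    refine this.congr fun x => ?_
    simp only [Function.comp]
    rw [mulVec_mulVec, mul_nonsing_inv _ hY, one_mulVec]
  · intro h
    have := ((hc Y⁻¹).tendsto _).comp h
    rw [h2, mulVec_mulVec, nonsing_inv_mul _ hY, one_mulVec] at this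
    exact this

theorem gauged_eq (Y : Mat3) (γ ψ : Fin 3 → ℂ) :
    gauged Y γ ψ = diagonal (fun l => Complex.exp (-(Complex.I * γ l))) *ᵥ (Y⁻¹ *ᵥ ψ) := by
  funext l; rw [mulVec_diagonal]; rfl

theorem entrySum_blockQ_le (u : Vec2) : entrySum (Data.blockQ u) ≤ 4 * ‖u‖ := by
  have h0 := EuclideanSpace.norm_eq u
  have h : ∀ i, ‖u i‖ ≤ ‖u‖ := fun i => PiLp.norm_apply_le u i
  simp only [entrySum, Data.blockQ, Fin.sum_univ_three]
  simp
  linarith [h 0, h 1]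

namespace Data
variable {D : Data}

theorem isUnit_det_matY {v : Vec2} {z : ℂ} (hv : ‖v‖ = D.q0) (hvec : D.vec ≠ 0)
    (hz : z ∉ D.exceptional) : IsUnit (D.matY v z).det := by
  rw [det_matY hv hvec (ne_zero_of_not_exceptional hz)]
  exact isUnit_iff_ne_zero.2 (rho_ne_zero hz)

/-! ### Solutions of the spatial equation normalized at one end -/

/-- A choice `sg` of phases that diagonalize the Lax pair near the end, for the `j`-th column. -/
structure Gauging (D : Data) (ε w : ℝ) (z : ℂ) (j : Fin 3) (sg : Fin 3 → Fin 3) : Prop where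
  fix : sg j = j
  im_nonneg : ∀ l, 0 ≤ ε * (D.freq z l - D.freq z (sg l)).im
  im_le : ∀ l m, |(D.freq z (sg l) - D.freq z (sg m)).im| ≤ w

def gaugePhase (D : Data) (z : ℂ) (sg : Fin 3 → Fin 3) (t x : ℝ) : Fin 3 → ℂ :=
  fun l => D.phase z x t (sg l)

/-- The exponents left over by the gauge, in the variable `y = εx`. The condition `im_nonneg` of
`Gauging` says that their real parts are nonpositive. -/
def rate (D : Data) (ε : ℝ) (z : ℂ) (sg : Fin 3 → Fin 3) : Fin 3 → ℂ :=
  fun l => ε * (Complex.I * (D.freq z l - D.freq z (sg l)))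

def coeff (D : Data) (ε : ℝ) (v : Vec2) (z : ℂ) (sg : Fin 3 → Fin 3) (t y : ℝ) : Mat3 :=
  (ε : ℂ) • gaugeConj (D.matY v z) (D.gaugePhase z sg t (ε * y)) (blockQ (D.q (ε * y) t - v))

/-- The solution of the spatial equation that is normalized at the end `-ε∞`. -/
def spatial (D : Data) (ε : ℝ) (v : Vec2) (z : ℂ) (sg : Fin 3 → Fin 3) (j : Fin 3) (t x : ℝ) :
    Fin 3 → ℂ :=
  ungauged (D.matY v z) (D.gaugePhase z sg t x)
    (volterra (D.rate ε z sg) (D.coeff ε v z sg t) (Pi.single j 1) (ε * x))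

/-- Controls the `t`-part of the gauge exponentials; the `x`-part is controlled by the weight. -/
def gaugeBound (D : Data) (z : ℂ) (sg : Fin 3 → Fin 3) (t : ℝ) : ℝ :=
  Real.exp ((∑ l, ∑ m, |(D.disp z (sg l) - D.disp z (sg m)).im|) * |t|)

theorem gaugeBound_pos (z : ℂ) (sg : Fin 3 → Fin 3) (t : ℝ) : 0 < D.gaugeBound z sg t :=
  Real.exp_pos _

section
variable {ε w : ℝ} {F : Filter ℝ} {v : Vec2} {z : ℂ} {j : Fin 3} {sg : Fin 3 → Fin 3}

theorem gaugePhase_eq (t x : ℝ) (l : Fin 3) :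
    D.gaugePhase z sg t x l = D.freq z (sg l) * x + D.disp z (sg l) * t := phase_eq _ _ _ _ _

theorem hasDerivAt_gaugePhase_x (t x : ℝ) (l : Fin 3) :
    HasDerivAt (fun x => D.gaugePhase z sg t x l) (D.freq z (sg l)) x := by
  simp only [gaugePhase_eq]
  simpa using ((Complex.ofRealCLM.hasDerivAt (x := x)).const_mul (D.freq z (sg l))).add_const
    (D.disp z (sg l) * t)

theorem hasDerivAt_gaugePhase_t (t x : ℝ) (l : Fin 3) :
    HasDerivAt (fun t => D.gaugePhase z sg t x l) (D.disp z (sg l)) t := by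
  simp only [gaugePhase_eq]
  simpa using ((Complex.ofRealCLM.hasDerivAt (x := t)).const_mul (D.disp z (sg l))).const_add
    (D.freq z (sg l) * x)

theorem Gauging.norm_exp_le (hg : D.Gauging ε w z j sg) (t x : ℝ) (l m : Fin 3) :
    ‖Complex.exp (-(Complex.I * D.gaugePhase z sg t x l)) *
      Complex.exp (Complex.I * D.gaugePhase z sg t x m)‖ ≤
      D.gaugeBound z sg t * Real.exp (w * |x|) := by
  rw [← Complex.exp_add, Complex.norm_exp, gaugeBound, ← Real.exp_add, Real.exp_le_exp]
  have h1 : (-(Complex.I * D.gaugePhase z sg t x l) + Complex.I * D.gaugePhase z sg t x m).re =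
      (D.freq z (sg l) - D.freq z (sg m)).im * x + (D.disp z (sg l) - D.disp z (sg m)).im * t := by
    simp [gaugePhase_eq]; ring
  rw [h1, add_comm]
  refine add_le_add ?_ ?_
  · refine (le_abs_self _).trans ?_
    rw [abs_mul]
    refine mul_le_mul_of_nonneg_right ?_ (abs_nonneg t)
    refine le_trans ?_ (Finset.single_le_sum (f := fun l => ∑ m, |(D.disp z (sg l) -
      D.disp z (sg m)).im|) (fun _ _ => Finset.sum_nonneg fun _ _ => abs_nonneg _)
      (Finset.mem_univ l))
    exact Finset.single_le_sum (f := fun m => |(D.disp z (sg l) - D.disp z (sg m)).im|)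
      (fun _ _ => abs_nonneg _) (Finset.mem_univ m)
  · refine (le_abs_self _).trans ?_
    rw [abs_mul]
    exact mul_le_mul_of_nonneg_right (hg.im_le l m) (abs_nonneg x)

theorem continuous_q (hsol : D.IsSolution) (t : ℝ) : Continuous fun x => D.q x t :=
  (hsol.contDiff_x t).continuous

theorem continuous_gaugeConj {X : Type*} [TopologicalSpace X] {Y : Mat3} {γ : X → Fin 3 → ℂ}
    {N : X → Mat3} (hγ : ∀ l, Continuous fun x => γ x l) (hN : Continuous N) :
    Continuous fun x => gaugeConj Y (γ x) (N x) := by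
  refine continuous_matrix fun l m => ?_
  have h1 : Continuous fun x => (Y⁻¹ * N x * Y) l m := by
    have : Continuous fun x => Y⁻¹ * N x * Y :=
      (continuous_const.matrix_mul hN).matrix_mul continuous_const
    exact this.matrix_elem l m
  have h2 := hγ l
  have h3 := hγ m
  simp only [gaugeConj, of_apply]
  fun_prop

theorem continuous_blockQ : Continuous blockQ := by
  refine continuous_matrix (f := blockQ) fun l m => ?_
  fin_cases l <;> fin_cases m <;> simp [blockQ] <;> fun_prop

theorem continuous_gaugePhase_x (t : ℝ) (l : Fin 3) :
    Continuous fun x => D.gaugePhase z sg t x l :=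
  continuous_iff_continuousAt.2 fun x => (hasDerivAt_gaugePhase_x t x l).continuousAt

theorem continuous_coeff (hsol : D.IsSolution) (t : ℝ) : Continuous (D.coeff ε v z sg t) := by
  have h0 : Continuous fun y : ℝ => ε * y := by fun_prop
  have h1 : Continuous fun y : ℝ => blockQ (D.q (ε * y) t - v) :=
    continuous_blockQ.comp (((continuous_q hsol t).comp h0).sub continuous_const)
  have h2 : Continuous fun y : ℝ => gaugeConj (D.matY v z) (D.gaugePhase z sg t (ε * y))
      (blockQ (D.q (ε * y) t - v)) :=
    continuous_gaugeConj (fun l => (continuous_gaugePhase_x t l).comp h0) h1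
  exact h2.const_smul (ε : ℂ)

theorem IsEnd.norm_smul_eq (he : D.IsEnd ε F v) (u : Fin 3 → ℂ) : ‖(ε : ℂ) • u‖ = ‖u‖ := by
  rcases he with ⟨rfl, -, -⟩ | ⟨rfl, -, -⟩ <;> simp

/-- The weight `e^{w|y|}` absorbs the growth caused by conjugating with the gauge. Any `C` above the
natural constant is allowed, so that nearby values of `z` can share one majorant. -/
theorem Gauging.dominates (hg : D.Gauging ε w z j sg) (he : D.IsEnd ε F v) (hsol : D.IsSolution)
    (hd : D.Decays w) (t : ℝ) {C : ℝ}
    (hC : D.gaugeBound z sg t * (entrySum (D.matY v z)⁻¹ * entrySum (D.matY v z)) * 4 ≤ C) :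
    Dominates (fun y => C * (Real.exp (w * |y|) * ‖D.q (ε * y) t - v‖)) (D.rate ε z sg)
      (D.coeff ε v z sg t) := by
  have hC0 : 0 ≤ C := le_trans (by
    have := (gaugeBound_pos (D := D) z sg t).le
    have := entrySum_nonneg (D.matY v z)
    have := entrySum_nonneg (D.matY v z)⁻¹
    positivity) hC
  refine ⟨⟨fun y => by positivity, ?_, fun a => (he.integrable hd t a).const_mul C⟩, fun l => ?_,
    fun l m => ((continuous_coeff hsol t).matrix_elem l m).measurable, fun y u => ?_⟩
  · have : Continuous fun y => D.q (ε * y) t :=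
      (continuous_q hsol t).comp (continuous_const.mul continuous_id)
    fun_prop
  · have := hg.im_nonneg l
    rw [rate, Complex.re_ofReal_mul, Complex.mul_re, Complex.I_re, Complex.I_im]
    linarith
  · have h1 : ‖D.coeff ε v z sg t y *ᵥ u‖ =
        ‖gaugeConj (D.matY v z) (D.gaugePhase z sg t (ε * y)) (blockQ (D.q (ε * y) t - v)) *ᵥ u‖ := by
      rw [coeff, smul_mulVec, he.norm_smul_eq]
    rw [h1]
    refine (norm_mulVec_le _ _).trans (mul_le_mul_of_nonneg_right ?_ (norm_nonneg u))
    have h2 := entrySum_gaugeConj_le (Y := D.matY v z) (hg.norm_exp_le t (ε * y))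
      (blockQ (D.q (ε * y) t - v))
    rw [he.abs_mul] at h2
    have h3 := entrySum_blockQ_le (D.q (ε * y) t - v)
    have h4 : 0 ≤ D.gaugeBound z sg t * Real.exp (w * |y|) *
        (entrySum (D.matY v z)⁻¹ * entrySum (D.matY v z)) := by
      have := (gaugeBound_pos (D := D) z sg t).le
      have := entrySum_nonneg (D.matY v z)
      have := entrySum_nonneg (D.matY v z)⁻¹
      positivity
    refine h2.trans ((mul_le_mul_of_nonneg_left h3 h4).trans ?_)
    have h5 : 0 ≤ Real.exp (w * |y|) * ‖D.q (ε * y) t - v‖ := by positivity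
    calc _ = D.gaugeBound z sg t * (entrySum (D.matY v z)⁻¹ * entrySum (D.matY v z)) * 4 *
          (Real.exp (w * |y|) * ‖D.q (ε * y) t - v‖) := by ring
      _ ≤ _ := mul_le_mul_of_nonneg_right hC h5

theorem laxA_sub (k : ℂ) (v : Vec2) (x t : ℝ) :
    D.laxA k x t - (-(Complex.I * k) • matJ + blockQ v) = blockQ (D.q x t - v) := by
  rw [laxA, Qx, dx_zero]
  ext i l
  fin_cases i <;> fin_cases l <;> simp [blockQ] <;> ring

theorem Gauging.hasDerivAt_spatial (hg : D.Gauging ε w z j sg) (he : D.IsEnd ε F v)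
    (hsol : D.IsSolution) (hd : D.Decays w) (hvec : D.vec ≠ 0) (hz : z ∉ D.exceptional) (t x : ℝ) :
    HasDerivAt (D.spatial ε v z sg j t) (D.laxA (D.kz z) x t *ᵥ D.spatial ε v z sg j t x) x := by
  have hY := isUnit_det_matY he.norm_eq hvec hz
  refine hasDerivAt_ungauged hY (bdryA_mul_matY he.norm_eq hvec (ne_zero_of_not_exceptional hz))
    (hasDerivAt_gaugePhase_x t x) ?_
  have hdom := hg.dominates he hsol hd t le_rfl
  have h1 := hdom.hasDerivAt_volterra (continuous_coeff hsol t) (Pi.single j 1) (fun i => by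
    by_cases h : i = j
    · subst h; simp [rate, hg.fix]
    · simp [Pi.single_eq_of_ne h]) (ε * x)
  have h2 : HasDerivAt (fun x : ℝ => ε * x) ε x := by simpa using (hasDerivAt_id x).const_mul ε
  refine (h1.scomp x h2).congr_deriv ?_
  have hεε : (ε : ℂ) * ε = 1 := by exact_mod_cast he.mul_self
  have h3 : ε * (ε * x) = x := by rw [← mul_assoc, he.mul_self, one_mul]
  funext l
  rw [Pi.smul_apply, Complex.real_smul]
  simp only [coeff, rate, h3, smul_mulVec, Pi.smul_apply, smul_eq_mul, laxA_sub]
  linear_combination (Complex.I * (D.freq z l - D.freq z (sg l)) *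
    volterra (D.rate ε z sg) (D.coeff ε v z sg t) (Pi.single j 1) (ε * x) l +
    (gaugeConj (D.matY v z) (D.gaugePhase z sg t x) (blockQ (D.q x t - v)) *ᵥ
    volterra (D.rate ε z sg) (D.coeff ε v z sg t) (Pi.single j 1) (ε * x)) l) * hεε

theorem Gauging.tendsto_spatial (hg : D.Gauging ε w z j sg) (he : D.IsEnd ε F v)
    (hsol : D.IsSolution) (hd : D.Decays w) (hvec : D.vec ≠ 0) (hz : z ∉ D.exceptional) (t : ℝ) :
    Tendsto (fun x => gauged (D.matY v z) (D.gaugePhase z sg t x) (D.spatial ε v z sg j t x)) F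
      (𝓝 (Pi.single j 1)) := by
  simp only [spatial, gauged_ungauged (isUnit_det_matY he.norm_eq hvec hz)]
  exact ((hg.dominates he hsol hd t le_rfl).tendsto_volterra _).comp he.tendsto_mul

/-- In the gauge the difference of the two solutions solves `w' = d w + B w` and vanishes at the
end, so it is zero. Only the spatial equation at one fixed time is used. -/
theorem Gauging.unique (hg : D.Gauging ε w z j sg) (he : D.IsEnd ε F v)
    (hsol : D.IsSolution) (hd : D.Decays w) (hvec : D.vec ≠ 0) (hz : z ∉ D.exceptional) (t : ℝ)
    {ψ φ : ℝ → Fin 3 → ℂ} (hψ : ∀ x, HasDerivAt ψ (D.laxA (D.kz z) x t *ᵥ ψ x) x)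
    (hφ : ∀ x, HasDerivAt φ (D.laxA (D.kz z) x t *ᵥ φ x) x) {c : Fin 3 → ℂ}
    (hψ' : Tendsto (fun x => gauged (D.matY v z) (D.gaugePhase z sg t x) (ψ x)) F (𝓝 c))
    (hφ' : Tendsto (fun x => gauged (D.matY v z) (D.gaugePhase z sg t x) (φ x)) F (𝓝 c))
    (x : ℝ) : ψ x = φ x := by
  have hY := isUnit_det_matY he.norm_eq hvec hz
  have hdom := hg.dominates he hsol hd t le_rfl
  have key : ∀ {χ : ℝ → Fin 3 → ℂ}, (∀ x, HasDerivAt χ (D.laxA (D.kz z) x t *ᵥ χ x) x) → ∀ y,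
      HasDerivAt (fun y => gauged (D.matY v z) (D.gaugePhase z sg t (ε * y)) (χ (ε * y)))
        (fun l => D.rate ε z sg l * gauged (D.matY v z) (D.gaugePhase z sg t (ε * y)) (χ (ε * y)) l
          + (D.coeff ε v z sg t y *ᵥ
            gauged (D.matY v z) (D.gaugePhase z sg t (ε * y)) (χ (ε * y))) l) y := by
    intro χ hχ y
    have h1 := hasDerivAt_gauged hY
      (bdryA_mul_matY he.norm_eq hvec (ne_zero_of_not_exceptional hz))
      (hasDerivAt_gaugePhase_x (D := D) (z := z) (sg := sg) t (ε * y)) (hχ (ε * y))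
    have h2 : HasDerivAt (fun x : ℝ => ε * x) ε y := by simpa using (hasDerivAt_id y).const_mul ε
    refine (h1.scomp y h2).congr_deriv ?_
    funext l
    rw [Pi.smul_apply, Complex.real_smul]
    simp only [coeff, rate, smul_mulVec, Pi.smul_apply, smul_eq_mul, laxA_sub]
    ring
  have h0 := hdom.eq_zero_of_tendsto
    (w := fun y => gauged (D.matY v z) (D.gaugePhase z sg t (ε * y)) (ψ (ε * y)) -
      gauged (D.matY v z) (D.gaugePhase z sg t (ε * y)) (φ (ε * y)))
    (fun y => ((key hψ y).sub (key hφ y)).congr_deriv (by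
      funext l; simp only [mulVec_sub, Pi.sub_apply]; ring))
    (by simpa using (hψ'.comp he.tendsto_mul').sub (hφ'.comp he.tendsto_mul')) (ε * x)
  have h3 : ε * (ε * x) = x := by rw [← mul_assoc, he.mul_self, one_mul]
  simp only [h3] at h0
  rw [← ungauged_gauged (γ := D.gaugePhase z sg t x) hY (ψ x), sub_eq_zero.1 h0,
    ungauged_gauged hY]

/-- In the gauge the temporal equation has a constant diagonal part, which annihilates `e_j` because
`sg` fixes `j`, and a remainder that vanishes at the end locally uniformly in `t`. The limit `e_j`
is therefore stationary. -/
theorem Gauging.tendsto_of_time (hg : D.Gauging ε w z j sg) (hw : 0 ≤ w) (he : D.IsEnd ε F v)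
    (hd : D.Decays w) (hvec : D.vec ≠ 0) (hz : z ∉ D.exceptional)
    {ψ : ℝ → ℝ → Fin 3 → ℂ}
    (hψt : ∀ x t, HasDerivAt (fun s => ψ x s) (D.laxE (D.kz z) x t *ᵥ ψ x t) t)
    (h0 : Tendsto (fun x => gauged (D.matY v z) (D.gaugePhase z sg 0 x) (ψ x 0)) F
      (𝓝 (Pi.single j 1))) (t : ℝ) :
    Tendsto (fun x => gauged (D.matY v z) (D.gaugePhase z sg t x) (ψ x t)) F
      (𝓝 (Pi.single j 1)) := by
  have hY := isUnit_det_matY he.norm_eq hvec hz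
  refine tendsto_of_evolution
    (w := fun x t => gauged (D.matY v z) (D.gaugePhase z sg t x) (ψ x t))
    (D := diagonal fun l => Complex.I * (D.disp z l - D.disp z (sg l)))
    (R := fun x t => gaugeConj (D.matY v z) (D.gaugePhase z sg t x)
      (D.laxE (D.kz z) x t - D.bdryE v (D.kz z))) ?_ ?_ ?_ h0 t
  · funext l
    rw [mulVec_diagonal]
    by_cases h : l = j
    · subst h; simp [hg.fix]
    · simp [Pi.single_eq_of_ne h]
  · intro T η hη
    set G := D.gaugeBound z sg T
    set C := G * (entrySum (D.matY v z)⁻¹ * entrySum (D.matY v z)) + 1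
    have e0 : 0 ≤ G * (entrySum (D.matY v z)⁻¹ * entrySum (D.matY v z)) :=
      mul_nonneg (gaugeBound_pos z sg T).le (mul_nonneg (entrySum_nonneg _) (entrySum_nonneg _))
    have hC : 0 < C := by positivity
    filter_upwards [he.eventually_entrySum_le hw hd (D.kz z) T (η := η / C) (by positivity)]
      with x hx s hs
    have hG : D.gaugeBound z sg s ≤ G := by
      refine Real.exp_le_exp.2 (mul_le_mul_of_nonneg_left ?_ (Finset.sum_nonneg fun _ _ =>
        Finset.sum_nonneg fun _ _ => abs_nonneg _))
      exact (abs_le.2 hs).trans (le_abs_self T)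
    have h1 := entrySum_gaugeConj_le (Y := D.matY v z) (fun l m => (hg.norm_exp_le s x l m).trans
      (mul_le_mul_of_nonneg_right hG (Real.exp_pos _).le))
      (D.laxE (D.kz z) x s - D.bdryE v (D.kz z))
    refine h1.trans ?_
    calc _ = G * (entrySum (D.matY v z)⁻¹ * entrySum (D.matY v z)) *
          (Real.exp (w * |x|) * entrySum (D.laxE (D.kz z) x s - D.bdryE v (D.kz z))) := by ring
      _ ≤ C * (η / C) := mul_le_mul (by simp [C]) (hx s hs)
          (mul_nonneg (Real.exp_pos _).le (entrySum_nonneg _)) hC.le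
      _ = η := by field_simp
  · intro x t
    refine (hasDerivAt_gauged hY (bdryE_mul_matY he.norm_eq hvec (ne_zero_of_not_exceptional hz))
      (hasDerivAt_gaugePhase_t (sg := sg) t x) (hψt x t)).congr_deriv ?_
    funext l
    rw [Pi.add_apply, mulVec_diagonal]

theorem continuous_laxE_time (hsol : D.IsSolution) (k : ℂ) (x : ℝ) :
    Continuous (D.laxE k x) := by
  have h := (continuous_laxE hsol k).comp (Continuous.prodMk_right x)
  simpa only [Function.comp_def] using h

/-- The Volterra solution at time zero is evolved along `ψ_t = Eψ` for each `x` separately. Zero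
curvature restores the spatial equation at all times, and the normalization persists. -/
theorem Gauging.exists_joint (hg : D.Gauging ε w z j sg) (hw : 0 ≤ w) (he : D.IsEnd ε F v)
    (hsol : D.IsSolution) (hd : D.Decays w) (hvec : D.vec ≠ 0) (hz : z ∉ D.exceptional) :
    ∃ ψ : ℝ → ℝ → Fin 3 → ℂ,
      (∀ x t, HasDerivAt (fun y => ψ y t) (D.laxA (D.kz z) x t *ᵥ ψ x t) x) ∧
      (∀ x t, HasDerivAt (fun s => ψ x s) (D.laxE (D.kz z) x t *ᵥ ψ x t) t) ∧
      ∀ t, Tendsto (fun x => gauged (D.matY v z) (D.gaugePhase z sg t x) (ψ x t)) F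
        (𝓝 (Pi.single j 1)) := by
  have hEc := continuous_laxE_time hsol (D.kz z)
  have hex := fun x => exists_linear_solution (hEc x) (D.spatial ε v z sg j 0 x)
  choose ψ hψ0 hψt using hex
  have h1 : ∀ x, HasDerivAt (fun y => ψ y 0) (D.laxA (D.kz z) x 0 *ᵥ ψ x 0) x := fun x => by
    have := hg.hasDerivAt_spatial he hsol hd hvec hz 0 x
    rw [← hψ0] at this
    exact this.congr_of_eventuallyEq (Eventually.of_forall hψ0)
  have h2 := hasDerivAt_space_of_time hsol (D.kz z) hψt h1
  have h3 : Tendsto (fun x => gauged (D.matY v z) (D.gaugePhase z sg 0 x) (ψ x 0)) F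
      (𝓝 (Pi.single j 1)) :=
    (hg.tendsto_spatial he hsol hd hvec hz 0).congr fun x => by rw [hψ0]
  have h4 : ∀ t, Tendsto (fun x => gauged (D.matY v z) (D.gaugePhase z sg t x) (ψ x t)) F
      (𝓝 (Pi.single j 1)) := hg.tendsto_of_time hw he hd hvec hz hψt h3
  exact ⟨ψ, h2, hψt, h4⟩

end

end Data
end LPD

namespace LPD
namespace Data
variable {D : Data}

/-! ### Existence and uniqueness of the Jost eigenfunctions -/

/-- The `j`-th phase is extremal at the end `-ε∞`: the other exponentials do not decay relative to
it. -/
def Extremal (D : Data) (ε : ℝ) (z : ℂ) (j : Fin 3) : Prop :=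
  ∀ l, 0 ≤ ε * (D.freq z l - D.freq z j).im

/-- Under the weight `e^{w|x|}` the `j`-th Jost solution exists and is unique. -/
def Admissible (D : Data) (ε w : ℝ) (z : ℂ) (j : Fin 3) : Prop :=
  D.Extremal ε z j ∨
    ((∀ l, ε * (D.freq z l - D.freq z j).im ≤ 0) ∧ ∀ l m, |(D.freq z l - D.freq z m).im| ≤ w)

section
variable {ε w : ℝ} {F : Filter ℝ} {v : Vec2} {z : ℂ} {j : Fin 3} {sg : Fin 3 → Fin 3}

/-- With one common phase the gauge exponentials cancel in the conjugation, so no weight is needed.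
-/
theorem Extremal.gauging (h : D.Extremal ε z j) : D.Gauging ε 0 z j fun _ => j :=
  ⟨rfl, h, fun _ _ => by simp⟩

/-- Removing every phase makes all rates zero. The price is the growth of the conjugated
perturbation, which the weight pays. -/
theorem gauging_id (h : ∀ l m, |(D.freq z l - D.freq z m).im| ≤ w) : D.Gauging ε w z j id :=
  ⟨rfl, fun _ => by simp, h⟩

theorem IsEnd.eventually_nonpos (he : D.IsEnd ε F v) : ∀ᶠ x in F, ε * x ≤ 0 :=
  he.tendsto_mul.eventually (eventually_le_atBot 0)

theorem eventually_norm_exp_phase_le (he : D.IsEnd ε F v) {a b : Fin 3 → Fin 3}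
    (h : ∀ l, ε * (D.freq z (a l) - D.freq z (b l)).im ≤ 0) (t : ℝ) :
    ∀ᶠ x in F, ∀ l,
      ‖Complex.exp (Complex.I * (D.gaugePhase z a t x l - D.gaugePhase z b t x l))‖ ≤
        Real.exp (∑ l, |(D.disp z (a l) - D.disp z (b l)).im * t|) := by
  filter_upwards [he.eventually_nonpos] with x hx l
  rw [Complex.norm_exp, Real.exp_le_exp]
  have h1 : (Complex.I * (D.gaugePhase z a t x l - D.gaugePhase z b t x l)).re =
      -((D.freq z (a l) - D.freq z (b l)).im * x) - (D.disp z (a l) - D.disp z (b l)).im * t := by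
    simp [gaugePhase_eq]; ring
  have h2 : 0 ≤ (D.freq z (a l) - D.freq z (b l)).im * x := by
    have := mul_nonneg_of_nonpos_of_nonpos (h l) hx
    have e := he.mul_self
    calc 0 ≤ ε * (D.freq z (a l) - D.freq z (b l)).im * (ε * x) := this
      _ = (ε * ε) * ((D.freq z (a l) - D.freq z (b l)).im * x) := by ring
      _ = _ := by rw [e, one_mul]
  have h3 := Finset.single_le_sum (f := fun l => |(D.disp z (a l) - D.disp z (b l)).im * t|)
    (fun _ _ => abs_nonneg _) (Finset.mem_univ l)
  have h4 := neg_abs_le ((D.disp z (a l) - D.disp z (b l)).im * t)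
  rw [h1]
  linarith

variable (D) in
/-- The Jost column at the end `F` with boundary value `v`. -/
def psi (F : Filter ℝ) (v : Vec2) (j : Fin 3) (z : ℂ) : ℝ → ℝ → Fin 3 → ℂ :=
  jost (D.laxA (D.kz z)) (D.laxE (D.kz z)) (D.matY v z) (D.phase z) F j

variable (D) in
def IsPsi (F : Filter ℝ) (v : Vec2) (j : Fin 3) (z : ℂ) (ψ : ℝ → ℝ → Fin 3 → ℂ) : Prop :=
  IsJost (D.laxA (D.kz z)) (D.laxE (D.kz z)) (D.matY v z) (D.phase z) F j ψ

theorem IsPsi.of_gauged (he : D.IsEnd ε F v) (hvec : D.vec ≠ 0) (hz : z ∉ D.exceptional)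
    {ψ : ℝ → ℝ → Fin 3 → ℂ}
    (h1 : ∀ x t, HasDerivAt (fun y => ψ y t) (D.laxA (D.kz z) x t *ᵥ ψ x t) x)
    (h2 : ∀ x t, HasDerivAt (fun s => ψ x s) (D.laxE (D.kz z) x t *ᵥ ψ x t) t)
    (h3 : ∀ t, Tendsto (fun x => gauged (D.matY v z) (D.gaugePhase z (fun _ => j) t x) (ψ x t)) F
      (𝓝 (Pi.single j 1)))
    (h4 : ∀ t, Tendsto (fun x => gauged (D.matY v z) (D.gaugePhase z id t x) (ψ x t)) F
      (𝓝 (Pi.single j 1))) : D.IsPsi F v j z ψ := by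
  refine ⟨h1, h2, fun t => ?_, fun t => ?_⟩
  · exact (tendsto_gauged_const_iff (isUnit_det_matY he.norm_eq hvec hz)
      (θ := fun x => D.phase z x t)).1 (h3 t)
  · refine (h4 t).congr fun x => ?_
    rw [gauged_eq]; rfl

theorem IsPsi.tendsto_const (he : D.IsEnd ε F v) (hvec : D.vec ≠ 0) (hz : z ∉ D.exceptional)
    {ψ : ℝ → ℝ → Fin 3 → ℂ} (h : D.IsPsi F v j z ψ) (t : ℝ) :
    Tendsto (fun x => gauged (D.matY v z) (D.gaugePhase z (fun _ => j) t x) (ψ x t)) F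
      (𝓝 (Pi.single j 1)) :=
  (tendsto_gauged_const_iff (isUnit_det_matY he.norm_eq hvec hz)
      (θ := fun x => D.phase z x t)).2 (h.2.2.1 t)

theorem IsPsi.tendsto_id {ψ : ℝ → ℝ → Fin 3 → ℂ} (h : D.IsPsi F v j z ψ) (t : ℝ) :
    Tendsto (fun x => gauged (D.matY v z) (D.gaugePhase z id t x) (ψ x t)) F
      (𝓝 (Pi.single j 1)) := by
  refine (h.2.2.2 t).congr fun x => ?_
  rw [gauged_eq]; rfl

/-- Each alternative of `Admissible` yields a solution with the limit natural to its gauge. The sign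
condition of the alternative bounds the exponentials relating the two gauges, in the direction
needed to obtain the other limit. -/
theorem exists_isPsi (he : D.IsEnd ε F v) (hsol : D.IsSolution) (hvec : D.vec ≠ 0)
    (hd0 : D.Decays 0) (hd : 0 ≤ w ∧ D.Decays w) (hz : z ∉ D.exceptional)
    (ha : D.Admissible ε w z j) : ∃ ψ, D.IsPsi F v j z ψ := by
  rcases ha with ha | ⟨ha, hb⟩
  · obtain ⟨ψ, h1, h2, h3⟩ := ha.gauging.exists_joint le_rfl he hsol hd0 hvec hz
    have h4 : ∀ t, Tendsto (fun x => gauged (D.matY v z) (D.gaugePhase z id t x) (ψ x t)) F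
        (𝓝 (Pi.single j 1)) := fun t => by
      have hb := eventually_norm_exp_phase_le (z := z) he (a := fun _ => j) (b := id) (fun l => by
        have := ha l
        simp only [Complex.sub_im, id] at this ⊢
        linarith) t
      exact tendsto_gauged_of_bounded (γ := fun x => D.gaugePhase z (fun _ => j) t x)
        (γ' := fun x => D.gaugePhase z id t x) (fun x => rfl) hb (h3 t)
    exact ⟨ψ, IsPsi.of_gauged he hvec hz h1 h2 h3 h4⟩
  · obtain ⟨ψ, h1, h2, h3⟩ := (gauging_id (j := j) hb).exists_joint hd.1 he hsol hd.2 hvec hz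
    have h4 : ∀ t, Tendsto (fun x => gauged (D.matY v z) (D.gaugePhase z (fun _ => j) t x) (ψ x t)) F
        (𝓝 (Pi.single j 1)) := fun t => by
      have hb := eventually_norm_exp_phase_le (z := z) he (a := id) (b := fun _ => j) ha t
      exact tendsto_gauged_of_bounded (γ := fun x => D.gaugePhase z id t x)
        (γ' := fun x => D.gaugePhase z (fun _ => j) t x)
        (fun x => rfl) hb (h3 t)
    exact ⟨ψ, IsPsi.of_gauged he hvec hz h1 h2 h4 h3⟩

theorem isPsi_unique (he : D.IsEnd ε F v) (hsol : D.IsSolution) (hvec : D.vec ≠ 0)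
    (hd0 : D.Decays 0) (hd : 0 ≤ w ∧ D.Decays w) (hz : z ∉ D.exceptional)
    (ha : D.Admissible ε w z j) {ψ φ : ℝ → ℝ → Fin 3 → ℂ} (hψ : D.IsPsi F v j z ψ)
    (hφ : D.IsPsi F v j z φ) : ψ = φ := by
  funext x t
  rcases ha with ha | ⟨-, hb⟩
  · exact ha.gauging.unique he hsol hd0 hvec hz t (fun x => hψ.1 x t) (fun x => hφ.1 x t)
      (hψ.tendsto_const he hvec hz t) (hφ.tendsto_const he hvec hz t) x
  · exact (gauging_id (j := j) hb).unique he hsol hd.2 hvec hz t (fun x => hψ.1 x t)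
      (fun x => hφ.1 x t) (hψ.tendsto_id t) (hφ.tendsto_id t) x

theorem isPsi_psi (h : ∃ ψ, D.IsPsi F v j z ψ) : D.IsPsi F v j z (D.psi F v j z) :=
  Classical.epsilon_spec h

/-- By uniqueness at each fixed time, the joint solution is the Volterra solution for that time. Its
dependence on `z` can thus be read from the Neumann series, without the temporal evolution. -/
theorem psi_eq_spatial (he : D.IsEnd ε F v) (hsol : D.IsSolution) (hvec : D.vec ≠ 0)
    (hd0 : D.Decays 0) (hz : z ∉ D.exceptional) (ha : D.Extremal ε z j) (x t : ℝ) :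
    D.psi F v j z x t = D.spatial ε v z (fun _ => j) j t x := by
  have h := isPsi_psi (exists_isPsi he hsol hvec hd0 ⟨le_rfl, hd0⟩ hz (Or.inl ha))
  exact ha.gauging.unique he hsol hd0 hvec hz t (fun x => h.1 x t)
    (fun x => ha.gauging.hasDerivAt_spatial he hsol hd0 hvec hz t x)
    (h.tendsto_const he hvec hz t) (ha.gauging.tendsto_spatial he hsol hd0 hvec hz t) x

/-! ### The regions of existence -/

/-- `Im λ` changes sign across the circle `|z| = q₀`, whereas `Im k` always has the sign of `Im z`.
The two formulas decide which phase is extremal in which region. -/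
theorem lam_im (hz : z ≠ 0) :
    (D.lam z).im = z.im / 2 * (1 - D.q0 ^ 2 / ‖z‖ ^ 2) := by
  have h : ‖z‖ ^ 2 ≠ 0 := by positivity
  have h1 : ((D.q0 : ℂ) ^ 2 / z).im = -(D.q0 ^ 2 * z.im / ‖z‖ ^ 2) := by
    rw [← Complex.ofReal_pow, Complex.div_im, Complex.normSq_eq_norm_sq, Complex.ofReal_re,
      Complex.ofReal_im]
    ring
  have : D.lam z = ((1 / 2 : ℝ) : ℂ) * (z + (D.q0 : ℂ) ^ 2 / z) := by rw [lam]; push_cast; ring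
  rw [this, Complex.im_ofReal_mul, Complex.add_im, h1]
  ring

theorem kz_im (hz : z ≠ 0) :
    (D.kz z).im = z.im / 2 * (1 + D.q0 ^ 2 / ‖z‖ ^ 2) := by
  have h : D.kz z = z - D.lam z := by rw [kz, lam]; ring
  rw [h, Complex.sub_im, lam_im hz]; ring

theorem ratio_le (hz : z ≠ 0) (h : D.q0 ≤ ‖z‖) : D.q0 ^ 2 / ‖z‖ ^ 2 ≤ 1 := by
  have : 0 ≤ D.q0 := norm_nonneg _
  have h1 : 0 < ‖z‖ := norm_pos_iff.2 hz
  rw [div_le_one (by positivity)]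
  exact pow_le_pow_left₀ this h 2

theorem le_ratio (hz : z ≠ 0) (h : ‖z‖ ≤ D.q0) : 1 ≤ D.q0 ^ 2 / ‖z‖ ^ 2 := by
  have h1 : 0 < ‖z‖ := norm_pos_iff.2 hz
  rw [one_le_div (by positivity)]
  exact pow_le_pow_left₀ (norm_nonneg _) h 2

theorem ratio_nonneg (z : ℂ) : 0 ≤ D.q0 ^ 2 / ‖z‖ ^ 2 := by positivity

theorem extremal_zero (hz : z ≠ 0) (hi : 0 ≤ ε * z.im) (hn : D.q0 ≤ ‖z‖) : D.Extremal ε z 0 := by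
  have h1 := ratio_le hz hn
  intro l
  fin_cases l <;> simp [freq, lam_im hz, kz_im hz] <;> nlinarith

theorem extremal_one (hz : z ≠ 0) (hi : ε * z.im ≤ 0) : D.Extremal ε z 1 := by
  have h1 := ratio_nonneg (D := D) z
  intro l
  fin_cases l <;> simp [freq, lam_im hz, kz_im hz] <;> nlinarith

theorem extremal_two (hz : z ≠ 0) (hi : 0 ≤ ε * z.im) (hn : ‖z‖ ≤ D.q0) : D.Extremal ε z 2 := by
  have h1 := le_ratio hz hn
  intro l
  fin_cases l <;> simp [freq, lam_im hz, kz_im hz] <;> nlinarith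

/-- At real `z` all phases have real frequencies, so each is extremal. On the circle `λ` is real and
`Im k = Im z`: the middle frequency lies on one side of the other two, every column is extremal in
one of the two senses, and `|Im z|` is the weight that is needed. -/
theorem admissible_of_mem_Sigma (hz : z ∈ D.Sigma) (j : Fin 3) :
    D.Admissible ε |z.im| z j := by
  have hz0 := ne_zero_of_not_exceptional hz.2
  rcases hz.1 with h | h
  · left
    intro l
    fin_cases j <;> fin_cases l <;> simp [freq, lam_im hz0, kz_im hz0, h]
  · have h1 : D.q0 ^ 2 / ‖z‖ ^ 2 = 1 := by
      rw [h]; exact div_self (by rw [← h]; positivity)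
    have hl : (D.lam z).im = 0 := by rw [lam_im hz0, h1]; ring
    have hk : (D.kz z).im = z.im := by rw [kz_im hz0, h1]; ring
    have hw : ∀ l m, |(D.freq z l - D.freq z m).im| ≤ |z.im| := by
      intro l m
      fin_cases m <;> fin_cases l <;> simp [freq, hl, hk]
    have : (∀ l, 0 ≤ ε * (D.freq z l - D.freq z j).im) ∨
        (∀ l, ε * (D.freq z l - D.freq z j).im ≤ 0) := by
      rcases le_total 0 (ε * z.im) with hs | hs
      · fin_cases j
        · left; intro l; fin_cases l <;> simp [freq, hl, hk, hs]
        · right; intro l; fin_cases l <;> simp [freq, hl, hk, hs]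
        · left; intro l; fin_cases l <;> simp [freq, hl, hk, hs]
      · fin_cases j
        · right; intro l; fin_cases l <;> simp [freq, hl, hk, hs]
        · left; intro l; fin_cases l <;> simp [freq, hl, hk, hs]
        · right; intro l; fin_cases l <;> simp [freq, hl, hk, hs]
    rcases this with h | h
    · exact Or.inl h
    · exact Or.inr ⟨h, hw⟩

end

end Data
end LPD

namespace LPD
namespace Data
variable {D : Data}

/-! ### Dependence of the Jost eigenfunctions on the spectral parameter -/

section
variable {ε w : ℝ} {F : Filter ℝ} {v : Vec2} {z : ℂ} {j : Fin 3} {sg : Fin 3 → Fin 3}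

theorem differentiableAt_kz (hz : z ≠ 0) : DifferentiableAt ℂ D.kz z := by
  have : D.kz = fun z => (z - (D.q0 : ℂ) ^ 2 / z) / 2 := rfl
  rw [this]
  fun_prop (disch := exact hz)

theorem differentiableAt_lam (hz : z ≠ 0) : DifferentiableAt ℂ D.lam z := by
  have : D.lam = fun z => (z + (D.q0 : ℂ) ^ 2 / z) / 2 := rfl
  rw [this]
  fun_prop (disch := exact hz)

theorem differentiableAt_rho (hz : z ≠ 0) : DifferentiableAt ℂ D.rho z := by
  have : D.rho = fun z => 1 + (D.q0 : ℂ) ^ 2 / z ^ 2 := rfl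
  rw [this]
  fun_prop (disch := exact pow_ne_zero 2 hz)

theorem differentiableAt_freq (hz : z ≠ 0) (l : Fin 3) :
    DifferentiableAt ℂ (fun z => D.freq z l) z := by
  have h1 := differentiableAt_kz (D := D) hz
  have h2 := differentiableAt_lam (D := D) hz
  fin_cases l
  exacts [h2.fun_neg, h1, h2]

theorem differentiableAt_phase (hz : z ≠ 0) (x t : ℝ) (l : Fin 3) :
    DifferentiableAt ℂ (fun z => D.phase z x t l) z := by
  have h1 := differentiableAt_kz (D := D) hz
  have h2 := differentiableAt_lam (D := D) hz
  fin_cases l <;> simp only [phase, Fin.zero_eta, Fin.mk_one, Fin.reduceFinMk, cons_val_zero,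
    cons_val_one, cons_val] <;> fun_prop

theorem differentiableAt_matY (hz : z ≠ 0) (i l : Fin 3) :
    DifferentiableAt ℂ (fun z => D.matY v z i l) z := by
  have h1 : DifferentiableAt ℂ (fun z : ℂ => z⁻¹) z := differentiableAt_inv hz
  fin_cases i <;> fin_cases l <;> simp [matY, div_eq_mul_inv] <;> fun_prop

/-- `Ỹ(z) = Y(z*)*` is holomorphic in `z`, so this formula exhibits the inverse as holomorphic off
the exceptional points. -/
theorem matY_inv (hv : ‖v‖ = D.q0) (hvec : D.vec ≠ 0) (hz : z ∉ D.exceptional) :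
    (D.matY v z)⁻¹ = diagonal ![(D.rho z)⁻¹, 1, (D.rho z)⁻¹] * (D.adjY v z)ᵀ := by
  refine inv_eq_left_inv ?_
  rw [mul_assoc, adjY_transpose_mul_matY hv hvec (ne_zero_of_not_exceptional hz),
    diagonal_mul_diagonal, ← diagonal_one]
  congr 1
  have := rho_ne_zero hz
  funext l
  fin_cases l <;> simp [this]

theorem differentiableAt_adjY (hz : z ≠ 0) (i l : Fin 3) :
    DifferentiableAt ℂ (fun z => D.adjY v z i l) z := by
  have h1 : DifferentiableAt ℂ (fun z : ℂ => z⁻¹) z := differentiableAt_inv hz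
  fin_cases i <;> fin_cases l <;> simp [adjY, matY, div_eq_mul_inv] <;> fun_prop

theorem isOpen_compl_exceptional : IsOpen D.exceptionalᶜ := by
  have : D.exceptional.Finite := by
    simp only [exceptional]
    exact Set.toFinite _
  exact this.isClosed.isOpen_compl

theorem eventually_not_exceptional (hz : z ∉ D.exceptional) : ∀ᶠ y in 𝓝 z, y ∉ D.exceptional :=
  isOpen_compl_exceptional.mem_nhds hz

theorem differentiableAt_matY_inv (hv : ‖v‖ = D.q0) (hvec : D.vec ≠ 0) (hz : z ∉ D.exceptional)
    (i l : Fin 3) : DifferentiableAt ℂ (fun z => (D.matY v z)⁻¹ i l) z := by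
  have h0 := ne_zero_of_not_exceptional hz
  have h1 : DifferentiableAt ℂ (fun z => (![(D.rho z)⁻¹, 1, (D.rho z)⁻¹] : Fin 3 → ℂ) i) z := by
    have := (differentiableAt_rho (D := D) h0).fun_inv (rho_ne_zero hz)
    fin_cases i
    exacts [this, differentiableAt_const _, this]
  refine (h1.mul (differentiableAt_adjY (D := D) (v := v) h0 l i)).congr_of_eventuallyEq ?_
  filter_upwards [eventually_not_exceptional hz] with y hy
  rw [matY_inv hv hvec hy, diagonal_mul, transpose_apply]
  rfl

theorem differentiableAt_coeff (hv : ‖v‖ = D.q0) (hvec : D.vec ≠ 0) (hz : z ∉ D.exceptional)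
    (t y : ℝ) (i l : Fin 3) : DifferentiableAt ℂ (fun z => D.coeff ε v z sg t y i l) z := by
  have h0 := ne_zero_of_not_exceptional hz
  have h1 := fun i l => differentiableAt_matY (D := D) (v := v) h0 i l
  have h2 := fun i l => differentiableAt_matY_inv hv hvec hz i l
  have h3 := fun l => differentiableAt_phase (D := D) h0 (ε * y) t (sg l)
  simp only [coeff, gaugeConj, gaugePhase, Matrix.smul_apply, of_apply, smul_eq_mul, Matrix.mul_apply,
    Finset.sum_mul]
  have h3i := h3 i
  have h3l := h3 l
  refine (((h3i.const_mul _).fun_neg.cexp.mul ?_).mul (h3l.const_mul _).cexp).const_mul _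
  refine DifferentiableAt.fun_sum fun m _ => DifferentiableAt.fun_sum fun n _ => ?_
  exact ((h2 i n).mul_const _).mul (h1 m l)

theorem differentiableAt_rate (hz : z ≠ 0) (l : Fin 3) :
    DifferentiableAt ℂ (fun z => D.rate ε z sg l) z := by
  simp only [rate]
  exact (((differentiableAt_freq hz l).sub (differentiableAt_freq hz (sg l))).const_mul _).const_mul _

/-- A locally uniform constant for `dominates_of_extremal`, hence one majorant for all nearby `z`.
-/
theorem eventually_entrySum_mul_le (hv : ‖v‖ = D.q0) (hvec : D.vec ≠ 0) (hz : z ∉ D.exceptional) :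
    ∃ C, ∀ᶠ y in 𝓝 z, y ∉ D.exceptional ∧
      entrySum (D.matY v y)⁻¹ * entrySum (D.matY v y) * 4 ≤ C := by
  have h0 := ne_zero_of_not_exceptional hz
  have h1 : ContinuousAt (fun y => entrySum (D.matY v y)) z := by
    simp only [entrySum]
    exact tendsto_finsetSum _ fun i _ => tendsto_finsetSum _ fun l _ =>
      (differentiableAt_matY h0 i l).continuousAt.norm
  have h2 : ContinuousAt (fun y => entrySum (D.matY v y)⁻¹) z := by
    simp only [entrySum]
    exact tendsto_finsetSum _ fun i _ => tendsto_finsetSum _ fun l _ =>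
      (differentiableAt_matY_inv hv hvec hz i l).continuousAt.norm
  have h3 := (h2.mul h1).mul_const 4
  refine ⟨entrySum (D.matY v z)⁻¹ * entrySum (D.matY v z) * 4 + 1, ?_⟩
  filter_upwards [eventually_not_exceptional hz,
    h3.eventually (gt_mem_nhds (lt_add_one _))] with y hy1 hy2
  exact ⟨hy1, hy2.le⟩

theorem gaugeBound_const (t : ℝ) : D.gaugeBound z (fun _ => j) t = 1 := by
  simp [gaugeBound]

variable (D) in
/-- Where the Jost column is the solution of a Volterra equation without decay assumptions beyond
integrability. -/
def extremalSet (ε : ℝ) (j : Fin 3) : Set ℂ := {z | z ∉ D.exceptional ∧ D.Extremal ε z j}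

theorem dominates_of_extremal (he : D.IsEnd ε F v) (hsol : D.IsSolution) (hd0 : D.Decays 0)
    (ha : D.Extremal ε z j) (t : ℝ) {C : ℝ}
    (hC : entrySum (D.matY v z)⁻¹ * entrySum (D.matY v z) * 4 ≤ C) :
    Dominates (fun y => C * (Real.exp (0 * |y|) * ‖D.q (ε * y) t - v‖)) (D.rate ε z fun _ => j)
      (D.coeff ε v z (fun _ => j) t) :=
  ha.gauging.dominates he hsol hd0 t (by rw [gaugeBound_const, one_mul]; exact hC)

/-- The extremal set includes boundary points of the regions, so this is continuity up to the
contour; holomorphy is available on open subsets only. -/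
theorem continuousOn_psi (he : D.IsEnd ε F v) (hsol : D.IsSolution) (hvec : D.vec ≠ 0)
    (hd0 : D.Decays 0) (x t : ℝ) (i : Fin 3) :
    ContinuousOn (fun z => D.psi F v j z x t i) (D.extremalSet ε j) := by
  have hcongr : EqOn (fun z => D.psi F v j z x t i)
      (fun z => D.spatial ε v z (fun _ => j) j t x i) (D.extremalSet ε j) := fun z hz =>
    congrFun (psi_eq_spatial he hsol hvec hd0 hz.1 hz.2 x t) i
  refine ContinuousOn.congr (fun z hz => ?_) hcongr
  obtain ⟨C, hC⟩ := eventually_entrySum_mul_le he.norm_eq hvec hz.1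
  obtain ⟨V, hV, hVo, hzV⟩ := eventually_nhds_iff.1 hC
  have h0 := ne_zero_of_not_exceptional hz.1
  have hvol := fun l => continuousOn_volterra_param (K := D.extremalSet ε j ∩ V)
    (fun y hy => dominates_of_extremal he hsol hd0 hy.1.2 t (hV y hy.2).2)
    (fun l y hy => (differentiableAt_rate
      (ne_zero_of_not_exceptional hy.1.1) l).continuousAt.continuousWithinAt)
    (fun s i l y hy => (differentiableAt_coeff he.norm_eq hvec
      hy.1.1 t s i l).continuousAt.continuousWithinAt) (Pi.single j 1) (ε * x) l
  have hin : D.extremalSet ε j ∩ V ∈ 𝓝[D.extremalSet ε j] z :=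
    inter_mem self_mem_nhdsWithin (mem_nhdsWithin_of_mem_nhds (hVo.mem_nhds hzV))
  refine ContinuousWithinAt.mono_of_mem_nhdsWithin ?_ hin
  simp only [spatial, ungauged, mulVec, dotProduct, gaugePhase]
  refine tendsto_finsetSum _ fun l _ => ?_
  exact (differentiableAt_matY h0 i l).continuousAt.continuousWithinAt.mul
    (((differentiableAt_phase h0 x t j).const_mul _).cexp.continuousAt.continuousWithinAt.mul
    (hvol l z ⟨hz, hzV⟩))

theorem differentiableOn_psi (he : D.IsEnd ε F v) (hsol : D.IsSolution) (hvec : D.vec ≠ 0)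
    (hd0 : D.Decays 0) {U : Set ℂ} (hU : IsOpen U) (hUe : U ⊆ D.extremalSet ε j) (x t : ℝ)
    (i : Fin 3) : DifferentiableOn ℂ (fun z => D.psi F v j z x t i) U := by
  have hcongr : EqOn (fun z => D.psi F v j z x t i)
      (fun z => D.spatial ε v z (fun _ => j) j t x i) U := fun z hz =>
    congrFun (psi_eq_spatial he hsol hvec hd0 (hUe hz).1 (hUe hz).2 x t) i
  refine DifferentiableOn.congr (fun z hz => ?_) hcongr
  have hz' := (hUe hz).1
  obtain ⟨C, hC⟩ := eventually_entrySum_mul_le he.norm_eq hvec hz'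
  obtain ⟨V, hV, hVo, hzV⟩ := eventually_nhds_iff.1 hC
  have h0 := ne_zero_of_not_exceptional hz'
  have hvol := fun l => differentiableOn_volterra_param (K := U ∩ V) (hU.inter hVo)
    (fun y hy => dominates_of_extremal he hsol hd0 (hUe hy.1).2 t (hV y hy.2).2)
    (fun l y hy => (differentiableAt_rate
      (ne_zero_of_not_exceptional (hUe hy.1).1) l).differentiableWithinAt)
    (fun s i l y hy => (differentiableAt_coeff he.norm_eq hvec
      (hUe hy.1).1 t s i l).differentiableWithinAt) (Pi.single j 1) (ε * x) l
  have hvol' := fun l => (hvol l).differentiableAt ((hU.inter hVo).mem_nhds ⟨hz, hzV⟩)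
  refine DifferentiableAt.differentiableWithinAt ?_
  simp only [spatial, ungauged, mulVec, dotProduct, gaugePhase]
  exact DifferentiableAt.fun_sum fun l _ => (differentiableAt_matY h0 i l).mul
    (((differentiableAt_phase h0 x t j).const_mul _).cexp.mul (hvol' l))

end

end Data
end LPD

/-! ### Complex conjugation and the adjoint Jost solutions -/

namespace LPD

theorem map_conj_inv (M : Mat3) : (M.map conj)⁻¹ = M⁻¹.map conj := by
  have h : ∀ N : Mat3, N.map conj = Nᴴᵀ := fun N => by ext i j; simp
  rw [h, h, conjTranspose_nonsing_inv, transpose_nonsing_inv]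

theorem map_conj_mulVec (M : Mat3) (ψ : Fin 3 → ℂ) :
    (M.map conj) *ᵥ (fun i => conj (ψ i)) = fun i => conj ((M *ᵥ ψ) i) := by
  funext i
  simp [mulVec, dotProduct]

theorem HasDerivAt.conj_pi {ψ : ℝ → Fin 3 → ℂ} {u : Fin 3 → ℂ} {x : ℝ} (h : HasDerivAt ψ u x) :
    HasDerivAt (fun y i => conj (ψ y i)) (fun i => conj (u i)) x :=
  hasDerivAt_pi.2 fun i => (hasDerivAt_pi.1 h i).star

theorem continuous_conj_pi : Continuous fun (ψ : Fin 3 → ℂ) i => conj (ψ i) :=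
  continuous_pi fun i => Complex.continuous_conj.comp (continuous_apply i)

namespace Data
variable {D : Data}

theorem IsJost.conj {A E : ℝ → ℝ → Mat3} {Y : Mat3} {θ : ℝ → ℝ → Fin 3 → ℂ} {F : Filter ℝ}
    {j : Fin 3} {ψ : ℝ → ℝ → Fin 3 → ℂ} (h : IsJost A E Y θ F j ψ) :
    IsJost (fun x t => (A x t).map conj) (fun x t => (E x t).map conj) (Y.map conj)
      (fun x t l => -conj (θ x t l)) F j (fun x t i => conj (ψ x t i)) := by
  have he : ∀ a : ℂ, Complex.exp (-(Complex.I * -conj a)) = conj (Complex.exp (-(Complex.I * a))) :=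
    fun a => by rw [← Complex.exp_conj]; simp
  refine ⟨fun x t => ?_, fun x t => ?_, fun t => ?_, fun t => ?_⟩
  · rw [map_conj_mulVec]; exact HasDerivAt.conj_pi (h.1 x t)
  · rw [map_conj_mulVec]; exact HasDerivAt.conj_pi (h.2.1 x t)
  · refine ((continuous_conj_pi.tendsto _).comp (h.2.2.1 t)).congr fun x => ?_
    funext i
    simp only [Function.comp, Pi.smul_apply, smul_eq_mul, map_mul, he]
  · have h1 := (continuous_conj_pi.tendsto _).comp (h.2.2.2 t)
    have h2 : (fun i => (starRingEnd ℂ) ((Pi.single j 1 : Fin 3 → ℂ) i)) = Pi.single j 1 := by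
      funext i
      by_cases hi : i = j
      · subst hi; simp
      · simp [Pi.single_eq_of_ne hi]
    rw [h2] at h1
    refine h1.congr fun x => ?_
    funext i
    rw [map_conj_inv, map_conj_mulVec, mulVec_diagonal]
    simp only [Function.comp, mulVec_diagonal, map_mul, he]

section
variable {ε w : ℝ} {F : Filter ℝ} {v : Vec2} {z : ℂ} {j : Fin 3}

variable (D) in
def adjPsi (F : Filter ℝ) (v : Vec2) (j : Fin 3) (z : ℂ) : ℝ → ℝ → Fin 3 → ℂ :=
  jost (D.adjA (D.kz z)) (D.adjE (D.kz z)) (D.adjY v z) (fun x t => -D.phase z x t) F j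

variable (D) in
def IsAdjPsi (F : Filter ℝ) (v : Vec2) (j : Fin 3) (z : ℂ) (ψ : ℝ → ℝ → Fin 3 → ℂ) : Prop :=
  IsJost (D.adjA (D.kz z)) (D.adjE (D.kz z)) (D.adjY v z) (fun x t => -D.phase z x t) F j ψ

theorem IsPsi.conj {ψ : ℝ → ℝ → Fin 3 → ℂ} (h : D.IsPsi F v j (conj z) ψ) :
    D.IsAdjPsi F v j z (fun x t i => conj (ψ x t i)) := by
  have h1 := IsJost.conj h
  have e1 : D.adjA (D.kz z) = fun x t => (D.laxA (D.kz (conj z)) x t).map conj := by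
    rw [kz_conj]; rfl
  have e2 : D.adjE (D.kz z) = fun x t => (D.laxE (D.kz (conj z)) x t).map conj := by
    rw [kz_conj]; rfl
  have e3 : (fun x t => -D.phase z x t) = fun x t l => -conj (D.phase (conj z) x t l) := by
    funext x t l
    rw [phase_conj, Complex.conj_conj, Pi.neg_apply]
  rw [IsAdjPsi, e1, e2, e3]
  exact h1

theorem IsAdjPsi.conj {ψ : ℝ → ℝ → Fin 3 → ℂ} (h : D.IsAdjPsi F v j z ψ) :
    D.IsPsi F v j (conj z) (fun x t i => conj (ψ x t i)) := by
  have h1 := IsJost.conj h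
  have hmap : ∀ M : Mat3, (M.map conj).map conj = M := fun M => by ext i j; simp
  have e1 : D.laxA (D.kz (conj z)) = fun x t => (D.adjA (D.kz z) x t).map conj := by
    funext x t
    rw [adjA, hmap, kz_conj]
  have e2 : D.laxE (D.kz (conj z)) = fun x t => (D.adjE (D.kz z) x t).map conj := by
    funext x t
    rw [adjE, hmap, kz_conj]
  have e3 : D.phase (conj z) = fun x t l => -conj ((-D.phase z x t) l) := by
    funext x t l
    rw [phase_conj, Pi.neg_apply, map_neg, neg_neg]
  have e4 : D.matY v (conj z) = (D.adjY v z).map conj := by rw [adjY, hmap]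
  rw [IsPsi, e1, e2, e3, e4]
  exact h1

theorem not_exceptional_conj (hz : z ∉ D.exceptional) : conj z ∉ D.exceptional := by
  intro h
  apply hz
  simp only [exceptional, mem_insert_iff, mem_singleton_iff] at h ⊢
  rcases h with h | h | h <;> have h' := congrArg conj h <;> simp at h' <;> simp [h']

/-- The data at one end for which the `j`-th Jost column exists. -/
structure Ready (D : Data) (ε w : ℝ) (F : Filter ℝ) (v : Vec2) : Prop where
  isEnd : D.IsEnd ε F v
  sol : D.IsSolution
  vec_ne : D.vec ≠ 0
  decays0 : D.Decays 0
  w_nonneg : 0 ≤ w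
  decays : D.Decays w

theorem Ready.isPsi (h : D.Ready ε w F v) (hz : z ∉ D.exceptional) (ha : D.Admissible ε w z j) :
    D.IsPsi F v j z (D.psi F v j z) :=
  isPsi_psi (exists_isPsi h.isEnd h.sol h.vec_ne h.decays0 ⟨h.w_nonneg, h.decays⟩ hz ha)

theorem Ready.eq_psi (h : D.Ready ε w F v) (hz : z ∉ D.exceptional) (ha : D.Admissible ε w z j)
    {ψ : ℝ → ℝ → Fin 3 → ℂ} (hψ : D.IsPsi F v j z ψ) : ψ = D.psi F v j z :=
  isPsi_unique h.isEnd h.sol h.vec_ne h.decays0 ⟨h.w_nonneg, h.decays⟩ hz ha hψ (h.isPsi hz ha)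

theorem Ready.isAdjPsi (h : D.Ready ε w F v) (hz : z ∉ D.exceptional)
    (ha : D.Admissible ε w (conj z) j) : D.IsAdjPsi F v j z (D.adjPsi F v j z) :=
  Classical.epsilon_spec (p := D.IsAdjPsi F v j z) ⟨_, (h.isPsi (not_exceptional_conj hz) ha).conj⟩

/-- The conjugate of an adjoint Jost column at `z` satisfies the conditions of the Jost column at
`z*`, where that column is unique. -/
theorem Ready.adjPsi_eq (h : D.Ready ε w F v) (hz : z ∉ D.exceptional)
    (ha : D.Admissible ε w (conj z) j) (x t : ℝ) (i : Fin 3) :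
    D.adjPsi F v j z x t i = conj (D.psi F v j (conj z) x t i) := by
  rw [← h.eq_psi (not_exceptional_conj hz) ha (h.isAdjPsi hz ha).conj, Complex.conj_conj]

/-! ### The bilinear pairing -/

theorem hasDerivAt_pairing {A : Mat3} {φ ψ : ℝ → Fin 3 → ℂ} {x : ℝ}
    (hφ : HasDerivAt φ (-Aᵀ *ᵥ φ x) x) (hψ : HasDerivAt ψ (A *ᵥ ψ x) x) :
    HasDerivAt (fun y => φ y ⬝ᵥ ψ y) 0 x := by
  have h : HasDerivAt (fun y => φ y ⬝ᵥ ψ y)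
      (∑ i, ((-Aᵀ *ᵥ φ x) i * ψ x i + φ x i * (A *ᵥ ψ x) i)) x := by
    simp only [dotProduct]
    exact HasDerivAt.fun_sum fun i _ => (hasDerivAt_pi.1 hφ i).mul (hasDerivAt_pi.1 hψ i)
  refine h.congr_deriv ?_
  simp only [mulVec_three, Fin.sum_univ_three, Matrix.neg_apply, transpose_apply]
  ring

theorem pairing_const {A E : ℝ → ℝ → Mat3} {φ ψ : ℝ → ℝ → Fin 3 → ℂ}
    (h1 : ∀ x t, HasDerivAt (fun y => φ y t) (-(A x t)ᵀ *ᵥ φ x t) x)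
    (h2 : ∀ x t, HasDerivAt (fun s => φ x s) (-(E x t)ᵀ *ᵥ φ x t) t)
    (h3 : ∀ x t, HasDerivAt (fun y => ψ y t) (A x t *ᵥ ψ x t) x)
    (h4 : ∀ x t, HasDerivAt (fun s => ψ x s) (E x t *ᵥ ψ x t) t) (x t y s : ℝ) :
    φ x t ⬝ᵥ ψ x t = φ y s ⬝ᵥ ψ y s := by
  have e1 : φ x t ⬝ᵥ ψ x t = φ y t ⬝ᵥ ψ y t :=
    is_const_of_deriv_eq_zero (f := fun x => φ x t ⬝ᵥ ψ x t)
      (fun x => (hasDerivAt_pairing (h1 x t) (h3 x t)).differentiableAt)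
      (fun x => (hasDerivAt_pairing (h1 x t) (h3 x t)).deriv) x y
  rw [e1]
  exact is_const_of_deriv_eq_zero (f := fun t => φ y t ⬝ᵥ ψ y t)
      (fun t => (hasDerivAt_pairing (h2 y t) (h4 y t)).differentiableAt)
      (fun t => (hasDerivAt_pairing (h2 y t) (h4 y t)).deriv) t s

theorem pairing_adj_const {F F' : Filter ℝ} {v v' : Vec2} {j j' : Fin 3}
    {φ ψ : ℝ → ℝ → Fin 3 → ℂ} (hφ : D.IsAdjPsi F v j z φ) (hψ : D.IsPsi F' v' j' z ψ)
    (x t y s : ℝ) : φ x t ⬝ᵥ ψ x t = φ y s ⬝ᵥ ψ y s := by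
  refine pairing_const (A := D.laxA (D.kz z)) (E := D.laxE (D.kz z)) (fun x t => ?_) (fun x t => ?_)
    hψ.1 hψ.2.1 x t y s
  · rw [← adjA_eq]; exact hφ.1 x t
  · rw [← adjE_eq]; exact hφ.2.1 x t

/-- The adjoint gauge carries the opposite phases, so the exponentials cancel and the pairing
becomes a constant bilinear form in the two gauged vectors. -/
theorem pairing_eq {Y Y' : Mat3} {R γ : Fin 3 → ℂ} (hY : IsUnit Y.det) (hY' : IsUnit Y'.det)
    (hR : Y'ᵀ * Y = diagonal R) (φ ψ : Fin 3 → ℂ) :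
    φ ⬝ᵥ ψ = gauged Y' (-γ) φ ⬝ᵥ (diagonal R *ᵥ gauged Y γ ψ) := by
  have h1 : diagonal R *ᵥ gauged Y γ ψ =
      fun l => Complex.exp (-(Complex.I * γ l)) * (Y'ᵀ *ᵥ ψ) l := by
    funext l
    rw [mulVec_diagonal]
    have : Y'ᵀ *ᵥ ψ = diagonal R *ᵥ (Y⁻¹ *ᵥ ψ) := by
      rw [← hR, mulVec_mulVec, mul_assoc, mul_nonsing_inv _ hY, mul_one]
    rw [this, mulVec_diagonal, gauged]
    ring
  have h2 : gauged Y' (-γ) φ ⬝ᵥ (diagonal R *ᵥ gauged Y γ ψ) = (Y'⁻¹ *ᵥ φ) ⬝ᵥ (Y'ᵀ *ᵥ ψ) := by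
    rw [h1]
    simp only [dotProduct, gauged]
    refine Finset.sum_congr rfl fun l _ => ?_
    have := exp_neg_mul_exp (Complex.I * γ l)
    have e : -(Complex.I * (-γ) l) = Complex.I * γ l := by simp
    rw [e]
    linear_combination (Y'⁻¹ *ᵥ φ) l * (Y'ᵀ *ᵥ ψ) l * this
  rw [h2, mulVec_transpose, dotProduct_comm _ (ψ ᵥ* Y'), ← dotProduct_mulVec, mulVec_mulVec,
    mul_nonsing_inv _ hY', one_mulVec, dotProduct_comm]

theorem isUnit_det_adjY (hv : ‖v‖ = D.q0) (hvec : D.vec ≠ 0) (hz : z ∉ D.exceptional) :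
    IsUnit (D.adjY v z).det := by
  have h := isUnit_det_matY (v := v) hv hvec (not_exceptional_conj hz)
  have e : D.adjY v z = (D.matY v (conj z))ᴴᵀ := by ext i j; simp [adjY]
  rw [e, det_transpose, det_conjTranspose]
  exact h.star

/-- The normalization `Ψ̃ᵀ Ψ = R`. -/
def weight (D : Data) (z : ℂ) : Fin 3 → ℂ := ![D.rho z, 1, D.rho z]

/-- The pairing is constant, so its value is read off at the end where both solutions are
normalized. This needs the second limit condition of `IsJost`, the one that controls all components.
-/
theorem IsAdjPsi.pairing (he : D.IsEnd ε F v) (hvec : D.vec ≠ 0) (hz : z ∉ D.exceptional)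
    {i : Fin 3} {φ ψ : ℝ → ℝ → Fin 3 → ℂ} (hφ : D.IsAdjPsi F v i z φ) (hψ : D.IsPsi F v j z ψ)
    (x t : ℝ) : φ x t ⬝ᵥ ψ x t = diagonal (D.weight z) i j := by
  have hY := isUnit_det_matY he.norm_eq hvec hz
  have hY' := isUnit_det_adjY he.norm_eq hvec hz
  have h1 : Tendsto (fun y => gauged (D.adjY v z) (-D.phase z y t) (φ y t)) F
      (𝓝 (Pi.single i 1)) := (hφ.2.2.2 t).congr fun y => by rw [gauged_eq]
  have h2 : Tendsto (fun y => gauged (D.matY v z) (D.phase z y t) (ψ y t)) F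
      (𝓝 (Pi.single j 1)) := (hψ.2.2.2 t).congr fun y => by rw [gauged_eq]
  have hc : Continuous fun p : (Fin 3 → ℂ) × (Fin 3 → ℂ) =>
      p.1 ⬝ᵥ (diagonal (D.weight z) *ᵥ p.2) :=
    continuous_fst.dotProduct (continuous_const.matrix_mulVec continuous_snd)
  have h3 := (hc.tendsto _).comp (h1.prodMk_nhds h2)
  have h4 : ∀ y, ((fun p : (Fin 3 → ℂ) × (Fin 3 → ℂ) => p.1 ⬝ᵥ (diagonal (D.weight z) *ᵥ p.2)) ∘
      fun y => (gauged (D.adjY v z) (-D.phase z y t) (φ y t),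
        gauged (D.matY v z) (D.phase z y t) (ψ y t))) y = φ x t ⬝ᵥ ψ x t := fun y => by
    exact (pairing_eq hY hY' (adjY_transpose_mul_matY he.norm_eq hvec
      (ne_zero_of_not_exceptional hz)) (φ y t) (ψ y t)).symm.trans
      (pairing_adj_const hφ hψ y t x t)
  have := he.neBot
  have h5 := tendsto_nhds_unique (tendsto_const_nhds (f := F)) (h3.congr h4)
  rw [h5]
  by_cases hij : i = j
  · subst hij; simp
  · simp [hij, Ne.symm hij]

end
end Data
end LPD

/-! ### Determinants, cross products and the scattering matrix -/

namespace LPD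

theorem hasDerivAt_det {A : Mat3} {M : ℝ → Mat3} {x : ℝ}
    (h : ∀ i j, HasDerivAt (fun y => M y i j) ((A * M x) i j) x) :
    HasDerivAt (fun y => (M y).det) (A.trace * (M x).det) x := by
  simp only [det_fin_three]
  refine (((((((h 0 0).mul (h 1 1)).mul (h 2 2)).sub (((h 0 0).mul (h 1 2)).mul (h 2 1))).sub
    (((h 0 1).mul (h 1 0)).mul (h 2 2))).add (((h 0 1).mul (h 1 2)).mul (h 2 0))).add
    (((h 0 2).mul (h 1 0)).mul (h 2 1))).sub (((h 0 2).mul (h 1 1)).mul (h 2 0)) |>.congr_deriv ?_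
  simp only [Matrix.mul_apply, Fin.sum_univ_three, trace_fin_three, Pi.mul_apply]
  ring

/-- The cofactor rule; no invertibility is needed. -/
theorem cross_mulVec (N : Mat3) (a b : Fin 3 → ℂ) :
    crossProduct (N *ᵥ a) (N *ᵥ b) = N.adjugateᵀ *ᵥ crossProduct a b := by
  funext i
  rw [mulVec_three, adjugate_fin_three, cross_apply, cross_apply]
  fin_cases i <;> simp [mulVec_three] <;> ring

/-- Cross products of the columns of an adjoint fundamental matrix `N` in terms of the fundamental
matrix `M`. -/
theorem smul_cross_eq {M N : Mat3} {r e : ℂ} (hr : r ≠ 0)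
    (h : Nᵀ * M = diagonal ![r, 1, r]) (hd : M.det = r * e) (a b : Fin 3 → ℂ) :
    e • crossProduct (N *ᵥ a) (N *ᵥ b) = M *ᵥ (diagonal ![1, r, 1] *ᵥ crossProduct a b) := by
  have h1 : N.det * (r * e) = r * r := by
    have := congrArg det h
    rw [det_mul, det_transpose, hd, det_diagonal, Fin.prod_univ_three] at this
    simpa using this
  have h2 : e * N.det = r := mul_left_cancel₀ hr (by linear_combination h1)
  have h3 : Mᵀ * N = diagonal ![r, 1, r] := by
    rw [← diagonal_transpose ![r, 1, r], ← h, transpose_mul, transpose_transpose]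
  -- From `Nᵀ M = R = diag(r, 1, r)` one gets `N⁻ᵗ = M R⁻¹`, and `det N = r/e`. Hence `e adj(N)ᵗ = r
  -- M R⁻¹`, and `r R⁻¹ = diag(1, r, 1)`.
  have h4 : e • N.adjugateᵀ = M * diagonal ![1, r, 1] := by
    have h5 : diagonal ![r, 1, r] * (e • N.adjugate) = r • Mᵀ := by
      rw [← h3, Matrix.mul_smul, mul_assoc, mul_adjugate, Matrix.mul_smul, mul_one, smul_smul, h2]
    have h6 := congrArg (fun X : Mat3 => (diagonal ![1, r, 1] * X)ᵀ) h5
    simp only [← mul_assoc, diagonal_mul_diagonal, transpose_mul, transpose_smul,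
      transpose_transpose, diagonal_transpose, Matrix.mul_smul] at h6
    have h7 : (diagonal fun i => (![1, r, 1] : Fin 3 → ℂ) i * (![r, 1, r] : Fin 3 → ℂ) i) =
        r • (1 : Mat3) := by
      rw [smul_one_eq_diagonal]
      congr 1
      funext i
      fin_cases i <;> simp
    rw [h7, Matrix.mul_smul, mul_one] at h6
    have h8 : r • (e • N.adjugateᵀ) = r • (M * diagonal ![1, r, 1]) := by
      rw [← h6, smul_comm]
    exact smul_right_injective _ hr h8
  rw [cross_mulVec, ← smul_mulVec, h4, mulVec_mulVec]

namespace Data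
variable {D : Data}

variable (D) in
/-- A point of the contour at which all Jost columns exist. -/
structure Regular (z : ℂ) : Prop where
  mem : z ∈ D.Sigma
  sol : D.IsSolution
  vec_ne : D.vec ≠ 0
  decays0 : D.Decays 0
  decays : D.Decays |z.im|

variable (D) in
def psiMat (F : Filter ℝ) (v : Vec2) (z : ℂ) (x t : ℝ) : Mat3 := of fun i j => D.psi F v j z x t i

variable (D) in
def adjMat (F : Filter ℝ) (v : Vec2) (z : ℂ) (x t : ℝ) : Mat3 :=
  of fun i j => D.adjPsi F v j z x t i

theorem matPsiM_eq (z : ℂ) (x t : ℝ) : D.matPsiM z x t = D.psiMat atBot D.qM z x t := by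
  ext i j
  fin_cases j <;> rfl

theorem matPsiP_eq (z : ℂ) (x t : ℝ) : D.matPsiP z x t = D.psiMat atTop D.qP z x t := by
  ext i j
  fin_cases j <;> rfl

namespace Regular
variable {z : ℂ} {ε ε' : ℝ} {F F' : Filter ℝ} {v v' : Vec2}

theorem not_mem (h : D.Regular z) : z ∉ D.exceptional := h.mem.2

theorem rho_ne (h : D.Regular z) : D.rho z ≠ 0 := rho_ne_zero h.not_mem

theorem ne_zero (h : D.Regular z) : z ≠ 0 := ne_zero_of_not_exceptional h.not_mem

theorem reflect (h : D.Regular z) : D.Regular (conj z) := by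
  refine ⟨⟨?_, not_exceptional_conj h.not_mem⟩, h.sol, h.vec_ne, h.decays0, ?_⟩
  · rcases h.mem.1 with h1 | h1
    · left; simp [h1]
    · right; simpa using h1
  · simpa using h.decays

theorem ready (h : D.Regular z) (he : D.IsEnd ε F v) : D.Ready ε |z.im| F v :=
  ⟨he, h.sol, h.vec_ne, h.decays0, abs_nonneg _, h.decays⟩

theorem isPsi (h : D.Regular z) (he : D.IsEnd ε F v) (j : Fin 3) :
    D.IsPsi F v j z (D.psi F v j z) :=
  (h.ready he).isPsi h.not_mem (admissible_of_mem_Sigma h.mem j)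

theorem eq_psi (h : D.Regular z) (he : D.IsEnd ε F v) {j : Fin 3} {ψ : ℝ → ℝ → Fin 3 → ℂ}
    (hψ : D.IsPsi F v j z ψ) : ψ = D.psi F v j z :=
  (h.ready he).eq_psi h.not_mem (admissible_of_mem_Sigma h.mem j) hψ

theorem admissible_conj (h : D.Regular z) (ε : ℝ) (j : Fin 3) :
    D.Admissible ε |z.im| ((starRingEnd ℂ) z) j := by
  simpa using admissible_of_mem_Sigma (ε := ε) h.reflect.mem j

theorem isAdjPsi (h : D.Regular z) (he : D.IsEnd ε F v) (j : Fin 3) :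
    D.IsAdjPsi F v j z (D.adjPsi F v j z) :=
  (h.ready he).isAdjPsi h.not_mem (h.admissible_conj ε j)

theorem adjMat_eq (h : D.Regular z) (he : D.IsEnd ε F v) (x t : ℝ) :
    D.adjMat F v z x t = (D.psiMat F v ((starRingEnd ℂ) z) x t).map (starRingEnd ℂ) := by
  ext i j
  exact (h.ready he).adjPsi_eq h.not_mem (h.admissible_conj ε j) x t i

theorem adjMat_mul_const (h : D.Regular z) (he : D.IsEnd ε F v) (he' : D.IsEnd ε' F' v')
    (x t y s : ℝ) : (D.adjMat F v z x t)ᵀ * D.psiMat F' v' z x t =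
      (D.adjMat F v z y s)ᵀ * D.psiMat F' v' z y s := by
  ext i j
  exact pairing_adj_const (h.isAdjPsi he i) (h.isPsi he' j) x t y s

theorem adjMat_mul_psiMat (h : D.Regular z) (he : D.IsEnd ε F v) (x t : ℝ) :
    (D.adjMat F v z x t)ᵀ * D.psiMat F v z x t = diagonal (D.weight z) := by
  ext i j
  exact (h.isAdjPsi he i).pairing he h.vec_ne h.not_mem (h.isPsi he j) x t

theorem diagonal_weight_inv (h : D.Regular z) :
    diagonal (fun j => D.rhoj j z / D.rho z) * diagonal (D.weight z) = 1 := by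
  have := h.rho_ne
  rw [diagonal_mul_diagonal, ← diagonal_one]
  congr 1
  funext j
  fin_cases j <;> simp [weight, rhoj, this]

/-- The pairing matrix is diagonal with entries `weight`, whose reciprocals are `ρ_j/ρ`. The adjoint
matrix therefore inverts `Ψ` up to a diagonal factor. -/
theorem psiMat_inv (h : D.Regular z) (he : D.IsEnd ε F v) (x t : ℝ) :
    (D.psiMat F v z x t)⁻¹ =
      diagonal (fun j => D.rhoj j z / D.rho z) * (D.adjMat F v z x t)ᵀ := by
  refine inv_eq_left_inv ?_
  rw [mul_assoc, h.adjMat_mul_psiMat he, h.diagonal_weight_inv]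

theorem isUnit_det (h : D.Regular z) (he : D.IsEnd ε F v) (x t : ℝ) :
    IsUnit (D.psiMat F v z x t).det := by
  refine isUnit_det_of_left_inverse
    (B := diagonal (fun j => D.rhoj j z / D.rho z) * (D.adjMat F v z x t)ᵀ) ?_
  rw [mul_assoc, h.adjMat_mul_psiMat he, h.diagonal_weight_inv]

/-- The entries of `S` are pairings of adjoint columns at `+∞` with columns at `-∞`. Their constancy
allows any `(x, t)`, which yields the scattering relation everywhere and not just at the origin. -/
theorem S_eq (h : D.Regular z) (x t : ℝ) : D.S z = diagonal (fun j => D.rhoj j z / D.rho z) *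
    ((D.adjMat atTop D.qP z x t)ᵀ * D.psiMat atBot D.qM z x t) := by
  rw [S, matPsiP_eq, matPsiM_eq, h.psiMat_inv D.isEnd_pos, mul_assoc,
    h.adjMat_mul_const D.isEnd_pos D.isEnd_neg 0 0 x t]

/-- The scattering relation. -/
theorem psi_mul_S (h : D.Regular z) (x t : ℝ) :
    D.psiMat atBot D.qM z x t = D.psiMat atTop D.qP z x t * D.S z := by
  rw [h.S_eq x t, ← mul_assoc _ (D.adjMat atTop D.qP z x t)ᵀ, ← h.psiMat_inv D.isEnd_pos, ← mul_assoc,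
    mul_nonsing_inv _ (h.isUnit_det D.isEnd_pos x t), one_mul]

theorem H_eq (h : D.Regular z) : D.H z = diagonal (fun j => D.rhoj j z / D.rho z) *
    ((D.adjMat atBot D.qM z 0 0)ᵀ * D.psiMat atTop D.qP z 0 0) := by
  rw [H, S, matPsiP_eq, matPsiM_eq, Matrix.mul_inv_rev,
    nonsing_inv_nonsing_inv _ (h.isUnit_det D.isEnd_pos 0 0), h.psiMat_inv D.isEnd_neg, mul_assoc]

theorem s_eq (h : D.Regular z) (j : Fin 3) : D.s j z = D.S z j j := by
  rw [h.S_eq 0 0, diagonal_mul]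
  rfl

theorem h_eq (h : D.Regular z) (j : Fin 3) : D.h j z = D.H z j j := by
  rw [h.H_eq, diagonal_mul]
  rfl

/-- `det Ψ = ρ e^{i(δ₁+δ₂+δ₃)}`. -/
theorem det_psiMat (h : D.Regular z) (he : D.IsEnd ε F v) (x t : ℝ) :
    (D.psiMat F v z x t).det = D.rho z * D.expSum z x t := by
  -- Abel–Liouville: `tr A` equals `i` times the sum of the frequencies, so `f` is constant in `y`.
  set f : ℝ → ℂ := fun y => Complex.exp (-(Complex.I * ∑ l, D.phase z y t l)) *
    (D.psiMat F v z y t).det with hf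
  have hphase : ∀ y, HasDerivAt (fun y : ℝ => ∑ l, D.phase z y t l) (∑ l, D.freq z l) y := fun y => by
    refine HasDerivAt.fun_sum fun l _ => ?_
    exact hasDerivAt_gaugePhase_x (sg := id) t y l
  have hdet : ∀ y, HasDerivAt (fun y => (D.psiMat F v z y t).det)
      ((D.laxA (D.kz z) y t).trace * (D.psiMat F v z y t).det) y := fun y =>
    hasDerivAt_det fun i j => hasDerivAt_pi.1 ((h.isPsi he j).1 y t) i
  have hfd : ∀ y, HasDerivAt f 0 y := fun y => by
    refine ((((hphase y).const_mul Complex.I).fun_neg.cexp).mul (hdet y)).congr_deriv ?_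
    rw [trace_laxA]
    ring
  have hconst : ∀ y, f y = f x := fun y =>
    is_const_of_deriv_eq_zero (fun y => (hfd y).differentiableAt) (fun y => (hfd y).deriv) y x
  have hY := det_matY he.norm_eq h.vec_ne h.ne_zero
  -- `W = e^{-iΩ} Y⁻¹ Ψ` tends to the identity at the end and has determinant `f/ρ`, which fixes the
  -- constant value of `f`.
  set W : ℝ → Mat3 := fun y => of fun l j => gauged (D.matY v z) (D.phase z y t) (D.psi F v j z y t) l
  have hW : Tendsto W F (𝓝 1) := by
    refine tendsto_pi_nhds.2 fun l => tendsto_pi_nhds.2 fun j => ?_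
    have h1 := tendsto_pi_nhds.1 ((h.isPsi he j).2.2.2 t) l
    have h2 : (1 : Mat3) l j = (Pi.single j 1 : Fin 3 → ℂ) l := by
      rw [one_apply, Pi.single_apply]
    rw [h2]
    refine h1.congr fun y => ?_
    simp only [W, of_apply]
    rw [gauged_eq]
  have hWdet : ∀ y, (W y).det = f y / D.rho z := fun y => by
    have e1 : W y = diagonal (fun l => Complex.exp (-(Complex.I * D.phase z y t l))) *
        ((D.matY v z)⁻¹ * D.psiMat F v z y t) := by
      ext l j
      rw [diagonal_mul]
      rfl
    rw [e1, det_mul, det_mul, det_diagonal, det_nonsing_inv, hY, Ring.inverse_eq_inv', ← Complex.exp_sum, hf]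
    simp only [Finset.sum_neg_distrib, Finset.mul_sum]
    ring
  have hlim : Tendsto (fun y => (W y).det) F (𝓝 1) := by
    have hc : Continuous fun M : Mat3 => M.det := Continuous.matrix_det continuous_id
    have := (hc.tendsto 1).comp hW
    rwa [det_one] at this
  have := he.neBot
  have h1 : f x / D.rho z = 1 := by
    refine tendsto_nhds_unique tendsto_const_nhds (hlim.congr fun y => ?_)
    rw [hWdet, hconst]
  have h2 : f x = D.rho z := by
    rw [div_eq_one_iff_eq h.rho_ne] at h1
    exact h1
  have h3 := exp_neg_mul_exp (Complex.I * ∑ l, D.phase z x t l)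
  rw [← h2, hf, expSum]
  linear_combination (-(D.psiMat F v z x t).det) * h3

theorem expSum_ne (x t : ℝ) : D.expSum z x t ≠ 0 := Complex.exp_ne_zero _

theorem det_S (h : D.Regular z) : (D.S z).det = 1 := by
  have h1 := congrArg det (h.psi_mul_S 0 0)
  rw [det_mul, h.det_psiMat D.isEnd_neg, h.det_psiMat D.isEnd_pos] at h1
  have h2 : D.rho z * D.expSum z 0 0 ≠ 0 := mul_ne_zero h.rho_ne (expSum_ne 0 0)
  exact (mul_left_cancel₀ h2 (by rw [mul_one]; exact h1)).symm

/-- The scattering matrix of the adjoint problem. -/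
theorem conj_S_eq (h : D.Regular z) (i j : Fin 3) :
    D.weight z i * (starRingEnd ℂ) (D.S ((starRingEnd ℂ) z) i j) = D.weight z j * D.H z j i := by
  have hr := h.rho_ne
  have e0 : ∀ j, D.weight z j * (D.rhoj j z / D.rho z) = 1 := fun j => by
    fin_cases j <;> simp [weight, rhoj, hr]
  have e1 : ∀ j, (starRingEnd ℂ) (D.rhoj j ((starRingEnd ℂ) z) / D.rho ((starRingEnd ℂ) z)) =
      D.rhoj j z / D.rho z := fun j => by
    fin_cases j <;> simp [rhoj, rho_conj]
  -- Conjugation turns `Ψ̃₊(z*)` into `Ψ₊(z)` and `Ψ₋(z*)` into `Ψ̃₋(z)`, so the pairing that gives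
  -- `S(z*)` becomes the transpose of the one that gives `H(z)`.
  have e2 : (starRingEnd ℂ) (((D.adjMat atTop D.qP ((starRingEnd ℂ) z) 0 0)ᵀ *
        D.psiMat atBot D.qM ((starRingEnd ℂ) z) 0 0) i j) =
      ((D.adjMat atBot D.qM z 0 0)ᵀ * D.psiMat atTop D.qP z 0 0) j i := by
    rw [h.reflect.adjMat_eq D.isEnd_pos, h.adjMat_eq D.isEnd_neg]
    simp [Matrix.mul_apply, Fin.sum_univ_three]
    ring
  rw [h.reflect.S_eq 0 0, h.H_eq, diagonal_mul, diagonal_mul, map_mul, e1, e2, ← mul_assoc, ← mul_assoc,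
    e0, e0]

/-- The adjoint columns at `-∞` in terms of those at `+∞`. -/
theorem adjMat_neg_eq (h : D.Regular z) (x t : ℝ) :
    D.adjMat atBot D.qM z x t = D.adjMat atTop D.qP z x t *
      ((D.S ((starRingEnd ℂ) z)).map (starRingEnd ℂ)) := by
  rw [h.adjMat_eq D.isEnd_neg, h.adjMat_eq D.isEnd_pos, h.reflect.psi_mul_S]
  ext i j
  simp [Matrix.mul_apply, Fin.sum_univ_three]

theorem smul_cross (h : D.Regular z) (x t : ℝ) (a b : Fin 3 → ℂ) :
    D.expSum z x t • crossProduct (D.adjMat atTop D.qP z x t *ᵥ a)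
      (D.adjMat atTop D.qP z x t *ᵥ b) =
      D.psiMat atTop D.qP z x t *ᵥ (diagonal ![1, D.rho z, 1] *ᵥ crossProduct a b) :=
  smul_cross_eq h.rho_ne (h.adjMat_mul_psiMat D.isEnd_pos x t)
    (h.det_psiMat D.isEnd_pos x t) a b

end Regular
end Data
end LPD

namespace LPD
namespace Data
variable {D : Data}

/-! ### The symmetry `z ↦ -q₀²/z` -/

def flipIndex : Fin 3 → Fin 3 := ![2, 1, 0]

def flipCoeff (D : Data) (z : ℂ) : Fin 3 → ℂ := ![Complex.I * z / D.q0, 1, Complex.I * z / D.q0]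

variable {z : ℂ} {F : Filter ℝ} {v : Vec2} {ε : ℝ}

theorem mul_flip_apply (M : Mat3) (z : ℂ) (i j : Fin 3) :
    (M * D.flip z) i j = D.flipCoeff z j * M i (flipIndex j) := by
  rw [Matrix.mul_apply, Fin.sum_univ_three]
  fin_cases j <;> simp [flip, flipCoeff, flipIndex, mul_comm]

theorem flipCoeff_ne (hvec : D.vec ≠ 0) (hz : z ≠ 0) (j : Fin 3) : D.flipCoeff z j ≠ 0 := by
  have := q0_ne hvec
  fin_cases j <;> simp [flipCoeff, hz, this]

theorem flip_inv (hvec : D.vec ≠ 0) (hz : z ≠ 0) :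
    (D.flip z)⁻¹ = of fun i j => if j = flipIndex i then (D.flipCoeff z i)⁻¹ else 0 := by
  have h0 := q0_ne hvec
  refine inv_eq_left_inv ?_
  ext i j
  rw [mul_flip_apply]
  have h := flipCoeff_ne hvec hz
  fin_cases i <;> fin_cases j <;> simp [flipIndex, flipCoeff, hz, h0]

theorem flip_inv_mulVec (hvec : D.vec ≠ 0) (hz : z ≠ 0) (u : Fin 3 → ℂ) (l : Fin 3) :
    ((D.flip z)⁻¹ *ᵥ u) l = (D.flipCoeff z l)⁻¹ * u (flipIndex l) := by
  rw [flip_inv hvec hz]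
  simp [mulVec, dotProduct]

theorem phase_hat_apply (hvec : D.vec ≠ 0) (hz : z ≠ 0) (x t : ℝ) (j : Fin 3) :
    D.phase (D.hat z) x t j = D.phase z x t (flipIndex j) := by
  rw [phase_hat hvec hz]
  fin_cases j <;> simp [flipIndex]

theorem flipIndex_injective : Function.Injective flipIndex := by decide

/-- The involution leaves `k`, hence the Lax pair, unchanged. It exchanges the first and third
phases and multiplies `Y` on the right by `flip`, so the Jost columns are permuted and rescaled. -/
theorem IsPsi.hat (hvec : D.vec ≠ 0) (hz : z ≠ 0) (j : Fin 3) {ψ : ℝ → ℝ → Fin 3 → ℂ}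
    (h : D.IsPsi F v (flipIndex j) z ψ) :
    D.IsPsi F v j (D.hat z) (fun x t => D.flipCoeff z j • ψ x t) := by
  refine ⟨fun x t => ?_, fun x t => ?_, fun t => ?_, fun t => ?_⟩
  · rw [kz_hat hvec hz, mulVec_smul]; exact (h.1 x t).const_smul (D.flipCoeff z j)
  · rw [kz_hat hvec hz, mulVec_smul]; exact (h.2.1 x t).const_smul (D.flipCoeff z j)
  · have h1 := (h.2.2.1 t).const_smul (D.flipCoeff z j)
    have h2 : (fun i => D.matY v (D.hat z) i j) =
        D.flipCoeff z j • fun i => D.matY v z i (flipIndex j) := by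
      funext i
      rw [matY_hat hvec hz, mul_flip_apply]; rfl
    rw [h2]
    refine h1.congr fun x => ?_
    rw [phase_hat_apply hvec hz, smul_comm]
  · have h1 := h.2.2.2 t
    rw [tendsto_pi_nhds] at h1 ⊢
    intro l
    have h2 := (h1 (flipIndex l)).const_mul (D.flipCoeff z j * (D.flipCoeff z l)⁻¹)
    have h3 : D.flipCoeff z j * (D.flipCoeff z l)⁻¹ *
        (Pi.single (flipIndex j) 1 : Fin 3 → ℂ) (flipIndex l) = (Pi.single j 1 : Fin 3 → ℂ) l := by
      by_cases hl : l = j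
      · subst hl
        rw [Pi.single_eq_same, Pi.single_eq_same, mul_inv_cancel₀ (flipCoeff_ne hvec hz _), one_mul]
      · rw [Pi.single_eq_of_ne hl, Pi.single_eq_of_ne (flipIndex_injective.ne hl), mul_zero]
    rw [h3] at h2
    refine h2.congr fun x => ?_
    rw [mulVec_diagonal, mulVec_diagonal, matY_hat hvec hz, Matrix.mul_inv_rev, ← mulVec_mulVec,
      flip_inv_mulVec hvec hz, mulVec_smul, Pi.smul_apply, smul_eq_mul, phase_hat_apply hvec hz]
    ring

theorem hat_hat (hvec : D.vec ≠ 0) (z : ℂ) : D.hat (D.hat z) = z := by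
  have := q0_ne hvec
  by_cases hz : z = 0
  · simp [Data.hat, hz]
  · rw [Data.hat, Data.hat]; field_simp

theorem hat_mem_exceptional (hvec : D.vec ≠ 0) (h : z ∈ D.exceptional) :
    D.hat z ∈ D.exceptional := by
  have h0 := q0_ne hvec
  simp only [exceptional, mem_insert_iff, mem_singleton_iff, Data.hat] at h ⊢
  rcases h with rfl | rfl | rfl
  · simp
  · right; left
    field_simp
    linear_combination -Complex.I_sq
  · right; right
    field_simp
    linear_combination Complex.I_sq

/-- On the circle the involution is `z ↦ -z*`, which preserves `Im z` and therefore the weight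
demanded of the decay. -/
theorem hat_eq_of_norm (hz : ‖z‖ = D.q0) (hz0 : z ≠ 0) : D.hat z = -conj z := by
  rw [Data.hat, div_eq_iff hz0, ← hz, neg_mul, mul_comm (conj z), Complex.mul_conj,
    Complex.normSq_eq_norm_sq]
  push_cast; ring

namespace Regular

theorem hat (h : D.Regular z) : D.Regular (D.hat z) := by
  have hz := h.ne_zero
  have hex : D.hat z ∉ D.exceptional := fun h1 => h.not_mem (by
    have := hat_mem_exceptional h.vec_ne h1
    rwa [hat_hat h.vec_ne] at this)
  rcases h.mem.1 with h1 | h1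
  · have h2 : (D.hat z).im = 0 := by
      have : z = (z.re : ℂ) := Complex.ext rfl (by simpa using h1)
      rw [Data.hat, this, ← Complex.ofReal_pow, ← Complex.ofReal_neg, ← Complex.ofReal_div,
        Complex.ofReal_im]
    refine ⟨⟨Or.inl h2, hex⟩, h.sol, h.vec_ne, h.decays0, ?_⟩
    simpa [h2] using h.decays0
  · have h2 := hat_eq_of_norm h1 hz
    refine ⟨⟨Or.inr ?_, hex⟩, h.sol, h.vec_ne, h.decays0, ?_⟩
    · rw [h2]; simpa using h1
    · rw [h2]; simpa using h.decays

theorem psiMat_hat (h : D.Regular z) (he : D.IsEnd ε F v) (x t : ℝ) :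
    D.psiMat F v (D.hat z) x t = D.psiMat F v z x t * D.flip z := by
  ext i j
  rw [mul_flip_apply]
  have h1 := h.hat.eq_psi he ((h.isPsi he (flipIndex j)).hat h.vec_ne h.ne_zero j)
  simp only [psiMat, of_apply]
  rw [← h1]; rfl

theorem S_hat (h : D.Regular z) (i j : Fin 3) : D.S (D.hat z) i j =
    (D.flipCoeff z i)⁻¹ * (D.flipCoeff z j * D.S z (flipIndex i) (flipIndex j)) := by
  have h1 : D.S (D.hat z) = (D.flip z)⁻¹ * (D.S z * D.flip z) := by
    simp only [S, matPsiP_eq, matPsiM_eq]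
    rw [h.psiMat_hat D.isEnd_pos, h.psiMat_hat D.isEnd_neg, Matrix.mul_inv_rev]
    simp only [mul_assoc]
  have h2 : ∀ j, (D.S (D.hat z)) i j = ((D.flip z)⁻¹ *ᵥ ((D.S z * D.flip z).col j)) i := fun j => by
    rw [h1]; rfl
  rw [h2, flip_inv_mulVec h.vec_ne h.ne_zero, col_apply, mul_flip_apply]

/-! ### Reflection coefficients in terms of `S` and `H` -/

/-- The involution exchanges the indices 1 and 3 of `S` up to factors `iz/q₀`, and conjugation
replaces `S` by `Hᵗ` up to weights. In this way the transformed reflection coefficients in the jump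
matrices become ratios of entries of `S` or of `H` at the single point `z`. -/
theorem hatted_alpha1 (h : D.Regular z) :
    D.hatted D.alpha1 z = Complex.I * z / D.q0 * (D.S z 1 2 / D.S z 2 2) := by
  have h0 := q0_ne h.vec_ne
  have hz := h.ne_zero
  rw [hatted, alpha1, h.S_hat, h.S_hat]
  simp only [flipCoeff, flipIndex, cons_val_zero, cons_val_one]
  field_simp

theorem hatted_alpha2 (h : D.Regular z) : D.hatted D.alpha2 z = D.S z 0 2 / D.S z 2 2 := by
  have h0 := q0_ne h.vec_ne
  have hz := h.ne_zero
  rw [hatted, alpha2, h.S_hat, h.S_hat]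
  simp only [flipCoeff, flipIndex, cons_val_zero, cons_val]
  field_simp

theorem hatted_alpha3 (h : D.Regular z) :
    D.hatted D.alpha3 z = D.q0 / (Complex.I * z) * (D.S z 0 1 / D.S z 1 1) := by
  have h0 := q0_ne h.vec_ne
  have hz := h.ne_zero
  rw [hatted, alpha3, h.S_hat, h.S_hat]
  simp only [flipCoeff, flipIndex, cons_val_zero, cons_val_one, cons_val]
  field_simp

theorem conj_S (h : D.Regular z) (i j : Fin 3) : (starRingEnd ℂ) (D.S ((starRingEnd ℂ) z) i j) =
    D.weight z j / D.weight z i * D.H z j i := by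
  have hw : D.weight z i ≠ 0 := by
    have := h.rho_ne
    fin_cases i <;> simp [weight, this]
  have := h.conj_S_eq i j
  field_simp
  linear_combination this

theorem chi_alpha2 (h : D.Regular z) : chi D.alpha2 z = D.H z 0 2 / D.H z 0 0 := by
  have hr := h.rho_ne
  rw [chi, alpha2, map_div₀, h.conj_S, h.conj_S]
  simp [weight, hr]

theorem chi_alpha3 (h : D.Regular z) : chi D.alpha3 z = D.H z 1 2 / (D.rho z * D.H z 1 1) := by
  have hr := h.rho_ne
  rw [chi, alpha3, map_div₀, h.conj_S, h.conj_S]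
  simp [weight]
  field_simp

theorem hatChi_eq (a : ℂ → ℂ) :
    D.hatChi a z = (starRingEnd ℂ) (D.hatted a ((starRingEnd ℂ) z)) := rfl

theorem hatChi_alpha2 (h : D.Regular z) : D.hatChi D.alpha2 z = D.H z 2 0 / D.H z 2 2 := by
  have hr := h.rho_ne
  rw [hatChi_eq, h.reflect.hatted_alpha2, map_div₀, h.conj_S, h.conj_S]
  simp [weight, hr]

theorem hatChi_alpha3 (h : D.Regular z) : D.hatChi D.alpha3 z =
    Complex.I * D.q0 / (z * D.rho z) * (D.H z 1 0 / D.H z 1 1) := by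
  have hr := h.rho_ne
  have h0 := q0_ne h.vec_ne
  have hz := h.ne_zero
  rw [hatChi_eq, h.reflect.hatted_alpha3, map_mul, map_div₀, map_div₀, h.conj_S, h.conj_S]
  simp [weight]
  field_simp
  linear_combination (-(D.H z 1 0 / D.H z 1 1)) * Complex.I_sq

/-- As `det S = 1`, the entries of `H` are quadratic polynomials in those of `S`; the jump relations
are thereby identities in the entries of `S` alone. -/
theorem H_eq_adjugate (h : D.Regular z) : D.H z = (D.S z).adjugate := by
  rw [H, inv_def, h.det_S, Ring.inverse_one, one_smul]

end Regular
end Data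
end LPD

namespace LPD
namespace Data
variable {D : Data} {z : ℂ}

/-! ### Auxiliary eigenfunctions on the contour -/

namespace Regular

/-- Columns of the adjoint scattering matrix. -/
theorem adjPsiM_eq (h : D.Regular z) (j : Fin 3) (x t : ℝ) : D.adjPsiM j z x t =
    D.adjMat atTop D.qP z x t *ᵥ fun i => D.weight z j / D.weight z i * D.H z j i := by
  have h1 : D.adjPsiM j z x t = (D.adjMat atBot D.qM z x t).col j := rfl
  have h2 : (fun i => D.weight z j / D.weight z i * D.H z j i) =
      ((D.S ((starRingEnd ℂ) z)).map (starRingEnd ℂ)).col j := by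
    funext i
    rw [← h.conj_S]; rfl
  rw [h1, h.adjMat_neg_eq, h2, mulVec_col]

theorem adjPsiP_eq (j : Fin 3) (x t : ℝ) : D.adjPsiP j z x t =
    D.adjMat atTop D.qP z x t *ᵥ Pi.single j 1 := by
  rw [mulVec_single_one]; rfl

/-- The adjoint column at `-∞` is expanded in adjoint columns at `+∞` with coefficients from `H`.
The cofactor rule turns cross products of the latter into columns of `Ψ₊`. The other three auxiliary
functions are treated in the same way. -/
theorem mu1_eq (h : D.Regular z) (x t : ℝ) : D.mu1 z x t =
    D.psiMat atTop D.qP z x t *ᵥ ![0, -D.H z 1 2, D.H z 1 1] := by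
  have hr := h.rho_ne
  rw [mu1, h.adjPsiM_eq, adjPsiP_eq, h.smul_cross]
  congr 1
  funext i
  rw [mulVec_diagonal, cross_apply]
  fin_cases i <;> simp [weight]
  field_simp

theorem mu2_eq (h : D.Regular z) (x t : ℝ) : D.mu2 z x t =
    D.psiMat atTop D.qP z x t *ᵥ ![-D.H z 0 2, 0, D.H z 0 0] := by
  have hr := h.rho_ne
  rw [mu2, h.adjPsiM_eq, adjPsiP_eq, h.smul_cross]
  congr 1
  funext i
  rw [mulVec_diagonal, cross_apply]
  fin_cases i <;> simp [weight, hr]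

theorem mu3_eq (h : D.Regular z) (x t : ℝ) : D.mu3 z x t =
    D.psiMat atTop D.qP z x t *ᵥ ![D.H z 2 2, 0, -D.H z 2 0] := by
  have hr := h.rho_ne
  rw [mu3, h.adjPsiM_eq, adjPsiP_eq, h.smul_cross]
  congr 1
  funext i
  rw [mulVec_diagonal, cross_apply]
  fin_cases i <;> simp [weight, hr]

theorem mu4_eq (h : D.Regular z) (x t : ℝ) : D.mu4 z x t =
    D.psiMat atTop D.qP z x t *ᵥ ![D.H z 1 1, -D.H z 1 0, 0] := by
  have hr := h.rho_ne
  rw [mu4, h.adjPsiM_eq, adjPsiP_eq, h.smul_cross]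
  congr 1
  funext i
  rw [mulVec_diagonal, cross_apply]
  fin_cases i <;> simp [weight]
  field_simp

theorem psiP_eq (j : Fin 3) (x t : ℝ) : D.psiP j z x t =
    D.psiMat atTop D.qP z x t *ᵥ Pi.single j 1 := by
  rw [mulVec_single_one]; rfl

theorem psiM_eq (h : D.Regular z) (j : Fin 3) (x t : ℝ) : D.psiM j z x t =
    D.psiMat atTop D.qP z x t *ᵥ (D.S z).col j := by
  rw [mulVec_col, ← h.psi_mul_S]; rfl

theorem cols_mulVec (M : Mat3) (a b c : Fin 3 → ℂ) :
    cols (M *ᵥ a) (M *ᵥ b) (M *ᵥ c) = M * cols a b c := by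
  ext i j
  fin_cases j <;> rfl

theorem mul_expNegO_mul (M : Mat3) (x t : ℝ) (d : Fin 3 → ℂ) :
    M * D.expNegO z x t * diagonal d = M * diagonal d * D.expNegO z x t := by
  rw [mul_assoc, mul_assoc, expNegO, diagonal_mul_diagonal, diagonal_mul_diagonal]
  simp only [mul_comm]

theorem expNegO_mul_expO (x t : ℝ) : D.expNegO z x t * D.expO z x t = 1 := by
  rw [expNegO, expO, diagonal_mul_diagonal, ← diagonal_one]
  simp only [exp_neg_mul_exp]

/-- The factor `e^{-iΩ}` stands to the right of both matrices, so the dependence on `x` and `t`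
enters only through conjugation and the jump reduces to a constant relation at `z`. -/
theorem jump_of_factor {Ψ M M' L : Mat3} (x t : ℝ) (h : M = M' * (1 - L)) :
    Ψ * M * D.expNegO z x t =
      Ψ * M' * D.expNegO z x t * (1 - D.expO z x t * L * D.expNegO z x t) := by
  rw [h, mul_sub, mul_sub, mul_sub, mul_one, mul_one, sub_mul]
  congr 1
  calc Ψ * (M' * L) * D.expNegO z x t
      = Ψ * M' * 1 * L * D.expNegO z x t := by simp only [mul_assoc, one_mul]
    _ = Ψ * M' * (D.expNegO z x t * D.expO z x t) * L * D.expNegO z x t := by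
        rw [expNegO_mul_expO]
    _ = _ := by simp only [mul_assoc]

/-- On the contour every column of `B_j` is a combination of columns of `Ψ₊`. The normalizing
denominators make the diagonal of the coefficient matrix equal to 1. -/
theorem B1_eq (h : D.Regular z) (h0 : D.s 0 z ≠ 0) (h1 : D.h 1 z ≠ 0) (x t : ℝ) :
    D.B1 x t z = D.psiMat atTop D.qP z x t *
      !![1, 0, 0; D.S z 1 0 / D.S z 0 0, 1, -(D.H z 1 2 / D.H z 1 1);
        D.S z 2 0 / D.S z 0 0, 0, 1] * D.expNegO z x t := by
  rw [B1, Psi1, mul_expNegO_mul, h.psiM_eq, psiP_eq, h.mu1_eq, cols_mulVec, mul_assoc (D.psiMat _ _ _ _ _)]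
  rw [h.s_eq] at h0 ⊢
  rw [h.h_eq] at h1 ⊢
  congr 2
  ext i j
  rw [mul_diagonal]
  fin_cases i <;> fin_cases j <;> simp [cols, h0, h1] <;> field_simp

theorem B2_eq (h : D.Regular z) (h0 : D.s 1 z ≠ 0) (h1 : D.h 0 z ≠ 0) (x t : ℝ) :
    D.B2 x t z = D.psiMat atTop D.qP z x t *
      !![1, D.S z 0 1 / D.S z 1 1, -(D.H z 0 2 / D.H z 0 0); 0, 1, 0;
        0, D.S z 2 1 / D.S z 1 1, 1] * D.expNegO z x t := by
  rw [B2, Psi2, mul_expNegO_mul, h.psiM_eq, psiP_eq, h.mu2_eq, cols_mulVec, mul_assoc (D.psiMat _ _ _ _ _)]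
  rw [h.s_eq] at h0 ⊢
  rw [h.h_eq] at h1 ⊢
  congr 2
  ext i j
  rw [mul_diagonal]
  fin_cases i <;> fin_cases j <;> simp [cols, h0, h1] <;> field_simp

theorem B3_eq (h : D.Regular z) (h0 : D.h 2 z ≠ 0) (h1 : D.s 1 z ≠ 0) (x t : ℝ) :
    D.B3 x t z = D.psiMat atTop D.qP z x t *
      !![1, D.S z 0 1 / D.S z 1 1, 0; 0, 1, 0;
        -(D.H z 2 0 / D.H z 2 2), D.S z 2 1 / D.S z 1 1, 1] * D.expNegO z x t := by
  rw [B3, Psi3, mul_expNegO_mul, h.psiM_eq, psiP_eq, h.mu3_eq, cols_mulVec, mul_assoc (D.psiMat _ _ _ _ _)]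
  rw [h.h_eq] at h0 ⊢
  rw [h.s_eq] at h1 ⊢
  congr 2
  ext i j
  rw [mul_diagonal]
  fin_cases i <;> fin_cases j <;> simp [cols, h0, h1] <;> field_simp

theorem B4_eq (h : D.Regular z) (h0 : D.h 1 z ≠ 0) (h1 : D.s 2 z ≠ 0) (x t : ℝ) :
    D.B4 x t z = D.psiMat atTop D.qP z x t *
      !![1, 0, D.S z 0 2 / D.S z 2 2; -(D.H z 1 0 / D.H z 1 1), 1, D.S z 1 2 / D.S z 2 2;
        0, 0, 1] * D.expNegO z x t := by
  rw [B4, Psi4, mul_expNegO_mul, h.psiM_eq, psiP_eq, h.mu4_eq, cols_mulVec, mul_assoc (D.psiMat _ _ _ _ _)]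
  rw [h.h_eq] at h0 ⊢
  rw [h.s_eq] at h1 ⊢
  congr 2
  ext i j
  rw [mul_diagonal]
  fin_cases i <;> fin_cases j <;> simp [cols, h0, h1] <;> field_simp

theorem H_apply (h : D.Regular z) :
    D.H z 0 0 = D.S z 1 1 * D.S z 2 2 - D.S z 1 2 * D.S z 2 1 ∧
    D.H z 0 2 = D.S z 0 1 * D.S z 1 2 - D.S z 0 2 * D.S z 1 1 ∧
    D.H z 1 0 = D.S z 1 2 * D.S z 2 0 - D.S z 1 0 * D.S z 2 2 ∧
    D.H z 1 1 = D.S z 0 0 * D.S z 2 2 - D.S z 0 2 * D.S z 2 0 ∧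
    D.H z 1 2 = D.S z 0 2 * D.S z 1 0 - D.S z 0 0 * D.S z 1 2 ∧
    D.H z 2 0 = D.S z 1 0 * D.S z 2 1 - D.S z 1 1 * D.S z 2 0 ∧
    D.H z 2 2 = D.S z 0 0 * D.S z 1 1 - D.S z 0 1 * D.S z 1 0 := by
  rw [h.H_eq_adjugate, adjugate_fin_three]
  refine ⟨?_, ?_, ?_, ?_, ?_, ?_, ?_⟩ <;> simp <;> ring

theorem jump1 (h : D.Regular z) (h0 : D.s 0 z ≠ 0) (h1 : D.h 1 z ≠ 0) (h2 : D.s 1 z ≠ 0)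
    (h3 : D.h 0 z ≠ 0) (x t : ℝ) :
    D.B1 x t z = D.B2 x t z * (1 - D.expO z x t * D.L1 z * D.expNegO z x t) := by
  rw [h.B1_eq h0 h1, h.B2_eq h2 h3]
  refine jump_of_factor x t ?_
  rw [h.s_eq] at h0 h2
  rw [h.h_eq] at h1 h3
  have hr := h.rho_ne
  have hz := h.ne_zero
  have hq := q0_ne h.vec_ne
  obtain ⟨e00, e02, e10, e11, e12, e20, e22⟩ := h.H_apply
  have hI := Complex.I_ne_zero
  simp only [L1, h.chi_alpha2, h.chi_alpha3, h.hatted_alpha3, alpha1, alpha2, alpha3]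
  rw [one_fin_three]
  ext i j
  rw [Matrix.mul_apply, Fin.sum_univ_three]
  -- Once denominators are cleared, the entries of `H` are replaced by cofactors of `S`.
  fin_cases i <;> fin_cases j <;> simp <;> field_simp <;>
    (try simp only [e00, e02, e11, e12]) <;> ring

/-- `B₂` and `B₃` share their middle column, so that column of `L₂` is zero. The remaining columns
match directly, without the cofactor relations. -/
theorem jump2 (h : D.Regular z) (h1 : D.h 2 z ≠ 0) (h2 : D.s 1 z ≠ 0)
    (h3 : D.h 0 z ≠ 0) (x t : ℝ) :
    D.B3 x t z = D.B2 x t z * (1 - D.expO z x t * D.L2 z * D.expNegO z x t) := by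
  rw [h.B3_eq h1 h2, h.B2_eq h2 h3]
  refine jump_of_factor x t ?_
  rw [h.s_eq] at h2
  rw [h.h_eq] at h1 h3
  obtain ⟨e00, e02, e10, e11, e12, e20, e22⟩ := h.H_apply
  simp only [L2, h.chi_alpha2, h.hatChi_alpha2]
  rw [one_fin_three]
  ext i j
  rw [Matrix.mul_apply, Fin.sum_univ_three]
  fin_cases i <;> fin_cases j <;> simp

theorem jump3 (h : D.Regular z) (h0 : D.h 2 z ≠ 0) (h1 : D.s 1 z ≠ 0) (h2 : D.h 1 z ≠ 0)
    (h3 : D.s 2 z ≠ 0) (x t : ℝ) :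
    D.B3 x t z = D.B4 x t z * (1 - D.expO z x t * D.L3 z * D.expNegO z x t) := by
  rw [h.B3_eq h0 h1, h.B4_eq h2 h3]
  refine jump_of_factor x t ?_
  rw [h.s_eq] at h1 h3
  rw [h.h_eq] at h0 h2
  have hr := h.rho_ne
  have hz := h.ne_zero
  have hq := q0_ne h.vec_ne
  obtain ⟨e00, e02, e10, e11, e12, e20, e22⟩ := h.H_apply
  have hI := Complex.I_ne_zero
  simp only [L3, h.hatChi_alpha2, h.hatChi_alpha3, h.hatted_alpha1, h.hatted_alpha2,
    h.hatted_alpha3, alpha3]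
  rw [one_fin_three]
  ext i j
  rw [Matrix.mul_apply, Fin.sum_univ_three]
  fin_cases i <;> fin_cases j <;> simp <;> field_simp <;>
    (try simp only [e10, e11, e20, e22, Complex.I_sq]) <;> ring

/-- `B₁` and `B₄` share the middle column and the denominator `h₂₂`, which is why three nonvanishing
conditions suffice. -/
theorem jump4 (h : D.Regular z) (h0 : D.s 0 z ≠ 0) (h1 : D.h 1 z ≠ 0) (h2 : D.s 2 z ≠ 0)
    (x t : ℝ) :
    D.B1 x t z = D.B4 x t z * (1 - D.expO z x t * D.L4 z * D.expNegO z x t) := by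
  rw [h.B1_eq h0 h1, h.B4_eq h1 h2]
  refine jump_of_factor x t ?_
  rw [h.s_eq] at h0 h2
  rw [h.h_eq] at h1
  have hr := h.rho_ne
  have hz := h.ne_zero
  have hq := q0_ne h.vec_ne
  obtain ⟨e00, e02, e10, e11, e12, e20, e22⟩ := h.H_apply
  have hI := Complex.I_ne_zero
  simp only [L4, h.chi_alpha3, h.hatChi_alpha3, h.hatted_alpha1, h.hatted_alpha2, alpha1, alpha2]
  rw [one_fin_three]
  ext i j
  rw [Matrix.mul_apply, Fin.sum_univ_three]
  fin_cases i <;> fin_cases j <;> simp <;> field_simp <;>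
    (try simp only [e10, e11, e12, Complex.I_sq]) <;> ring

end Regular
end Data
end LPD

/-! ### Holomorphy in the regions and continuity up to their boundaries -/

namespace LPD

/-- `f` is holomorphic in `U` and continuous on `K`. -/
def Holo (U K : Set ℂ) (f : ℂ → ℂ) : Prop := DifferentiableOn ℂ f U ∧ ContinuousOn f K

namespace Holo
variable {U K : Set ℂ} {f g : ℂ → ℂ}

theorem mul (hf : Holo U K f) (hg : Holo U K g) : Holo U K fun z => f z * g z :=
  ⟨hf.1.fun_mul hg.1, hf.2.mul hg.2⟩

theorem sub (hf : Holo U K f) (hg : Holo U K g) : Holo U K fun z => f z - g z :=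
  ⟨hf.1.fun_sub hg.1, hf.2.sub hg.2⟩

theorem of_differentiableAt (hUK : U ⊆ K) (h : ∀ z ∈ K, DifferentiableAt ℂ f z) : Holo U K f :=
  ⟨fun z hz => (h z (hUK hz)).differentiableWithinAt,
    fun z hz => (h z hz).continuousAt.continuousWithinAt⟩

theorem dot {φ ψ : ℂ → Fin 3 → ℂ} (hφ : ∀ i, Holo U K fun z => φ z i)
    (hψ : ∀ i, Holo U K fun z => ψ z i) : Holo U K fun z => φ z ⬝ᵥ ψ z :=
  ⟨DifferentiableOn.fun_sum fun i _ => (hφ i).1.mul (hψ i).1,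
    continuousOn_finsetSum _ fun i _ => (hφ i).2.mul (hψ i).2⟩

theorem cross {φ ψ : ℂ → Fin 3 → ℂ} (hφ : ∀ i, Holo U K fun z => φ z i)
    (hψ : ∀ i, Holo U K fun z => ψ z i) (i : Fin 3) :
    Holo U K fun z => crossProduct (φ z) (ψ z) i := by
  simp only [cross_apply]
  fin_cases i
  exacts [((hφ 1).mul (hψ 2)).sub ((hφ 2).mul (hψ 1)), ((hφ 2).mul (hψ 0)).sub ((hφ 0).mul (hψ 2)),
    ((hφ 0).mul (hψ 1)).sub ((hφ 1).mul (hψ 0))]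

theorem analytic (hf : Holo U K f) (hU : IsOpen U) : AnalyticOnNhd ℂ f U :=
  hf.1.analyticOnNhd hU

theorem meromorphicOn (hf : Holo U K f) (hU : IsOpen U) : MeromorphicOn f U := fun z hz =>
  (hf.analytic hU z hz).meromorphicAt

theorem continuousWithinAt (hf : Holo U K f) (hUK : U ⊆ K) {z : ℂ} (hz : z ∈ K) :
    ContinuousWithinAt f U z := (hf.2 z hz).mono hUK

end Holo

namespace Data
variable {D : Data}

/-! ### Regions -/

variable (D) in
/-- The closed sectors adjacent to the regions `U_j`. -/
def sector (a b : ℝ) : Set ℂ := {z | 0 ≤ a * z.im ∧ b * D.q0 ≤ b * ‖z‖} \ D.exceptional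

variable (D) in
def halfPlane (a : ℝ) : Set ℂ := {z | 0 ≤ a * z.im} \ D.exceptional

theorem isClosed_sector_set (a b : ℝ) :
    IsClosed {z : ℂ | 0 ≤ a * z.im ∧ b * D.q0 ≤ b * ‖z‖} := by
  have h1 : Continuous fun z : ℂ => a * z.im := by fun_prop
  have h2 : Continuous fun z : ℂ => b * ‖z‖ := by fun_prop
  exact (isClosed_le continuous_const h1).inter (isClosed_le continuous_const h2)

theorem norm_of_mem_exceptional {z : ℂ} (h : z ∈ D.exceptional) : z = 0 ∨ ‖z‖ = D.q0 := by
  have h0 : |D.q0| = D.q0 := abs_of_nonneg (norm_nonneg _)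
  simp only [exceptional, mem_insert_iff, mem_singleton_iff] at h
  rcases h with rfl | rfl | rfl <;> simp [h0]

theorem not_exceptional_of {z : ℂ} (h1 : z.im ≠ 0) (h2 : ‖z‖ ≠ D.q0) : z ∉ D.exceptional := by
  intro h
  rcases norm_of_mem_exceptional h with rfl | h
  · simp at h1
  · exact h2 h

theorem U1_subset : D.U1 ⊆ D.sector 1 1 := fun z hz =>
  ⟨⟨by linarith [hz.1], by linarith [hz.2]⟩, not_exceptional_of hz.1.ne' hz.2.ne'⟩

theorem U2_subset : D.U2 ⊆ D.sector (-1) 1 := fun z hz =>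
  ⟨⟨by linarith [hz.1], by linarith [hz.2]⟩, not_exceptional_of hz.1.ne hz.2.ne'⟩

theorem U3_subset : D.U3 ⊆ D.sector (-1) (-1) := fun z hz =>
  ⟨⟨by linarith [hz.1], by linarith [hz.2]⟩, not_exceptional_of hz.1.ne hz.2.ne⟩

theorem U4_subset : D.U4 ⊆ D.sector 1 (-1) := fun z hz =>
  ⟨⟨by linarith [hz.1], by linarith [hz.2]⟩, not_exceptional_of hz.1.ne' hz.2.ne⟩

theorem upper_subset : D.upper ⊆ D.halfPlane 1 := fun z hz =>
  ⟨show 0 ≤ 1 * z.im by rw [one_mul]; exact le_of_lt hz.1, hz.2⟩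

theorem lower_subset : D.lower ⊆ D.halfPlane (-1) := fun z hz =>
  ⟨show 0 ≤ -1 * z.im by have : z.im < 0 := hz.1; linarith, hz.2⟩

theorem closure_diff_subset_sector {U : Set ℂ} {a b : ℝ} (h : U ⊆ D.sector a b) :
    closure U \ D.exceptional ⊆ D.sector a b := fun _ hz =>
  ⟨closure_minimal (fun _ hy => (h hy).1) (isClosed_sector_set a b) hz.1, hz.2⟩

theorem closure_diff_subset_halfPlane {U : Set ℂ} {a : ℝ} (h : U ⊆ D.halfPlane a) :
    closure U \ D.exceptional ⊆ D.halfPlane a := fun _ hz =>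
  ⟨closure_minimal (fun _ hy => (h hy).1) (isClosed_le (by fun_prop) (by fun_prop)) hz.1, hz.2⟩

theorem isOpen_U1 : IsOpen D.U1 :=
  (isOpen_lt continuous_const Complex.continuous_im).inter (isOpen_lt continuous_const continuous_norm)

theorem isOpen_U2 : IsOpen D.U2 :=
  (isOpen_lt Complex.continuous_im continuous_const).inter (isOpen_lt continuous_const continuous_norm)

theorem isOpen_U3 : IsOpen D.U3 :=
  (isOpen_lt Complex.continuous_im continuous_const).inter (isOpen_lt continuous_norm continuous_const)

theorem isOpen_U4 : IsOpen D.U4 :=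
  (isOpen_lt continuous_const Complex.continuous_im).inter (isOpen_lt continuous_norm continuous_const)

theorem isOpen_upper : IsOpen D.upper :=
  (isOpen_lt continuous_const Complex.continuous_im).inter isOpen_compl_exceptional

theorem isOpen_lower : IsOpen D.lower :=
  (isOpen_lt Complex.continuous_im continuous_const).inter isOpen_compl_exceptional

section
variable {ε : ℝ} {F : Filter ℝ} {v : Vec2} {j : Fin 3} {U K : Set ℂ} {z : ℂ}

theorem sector_subset_halfPlane (a b : ℝ) : D.sector a b ⊆ D.halfPlane a := fun _ hz =>
  ⟨hz.1.1, hz.2⟩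

theorem sector_one_subset : D.sector ε 1 ⊆ D.extremalSet ε 0 := fun z hz =>
  ⟨hz.2, extremal_zero (ne_zero_of_not_exceptional hz.2) hz.1.1 (by linarith [hz.1.2])⟩

theorem sector_neg_one_subset : D.sector ε (-1) ⊆ D.extremalSet ε 2 := fun z hz =>
  ⟨hz.2, extremal_two (ne_zero_of_not_exceptional hz.2) hz.1.1 (by linarith [hz.1.2])⟩

theorem halfPlane_subset {a : ℝ} (ha : a = -ε) : D.halfPlane a ⊆ D.extremalSet ε 1 := fun z hz =>
  ⟨hz.2, extremal_one (ne_zero_of_not_exceptional hz.2) (by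
    have : 0 ≤ a * z.im := hz.1
    rw [ha] at this
    linarith)⟩

theorem conj_mem_sector {a b : ℝ} (h : z ∈ D.sector a b) : conj z ∈ D.sector (-a) b := by
  refine ⟨⟨?_, ?_⟩, not_exceptional_conj h.2⟩
  · simpa using h.1.1
  · simpa using h.1.2

theorem conj_mem_halfPlane {a : ℝ} (h : z ∈ D.halfPlane a) : conj z ∈ D.halfPlane (-a) :=
  ⟨by simpa using h.1, not_exceptional_conj h.2⟩

variable (D) in
/-- The standing hypotheses. -/
structure Standing : Prop where
  sol : D.IsSolution
  vec_ne : D.vec ≠ 0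
  decays0 : D.Decays 0

namespace Standing

theorem regular (h : D.Standing) (hz : z ∈ D.Sigma) (hd : D.Decays |z.im|) : D.Regular z :=
  ⟨hz, h.sol, h.vec_ne, h.decays0, hd⟩

theorem regular_of_real (h : D.Standing) (hz : z ∉ D.exceptional) (hi : z.im = 0) : D.Regular z :=
  h.regular ⟨Or.inl hi, hz⟩ (by simpa [hi] using h.decays0)

theorem holo_psi (h : D.Standing) (he : D.IsEnd ε F v) (hU : IsOpen U) (hUK : U ⊆ K)
    (hK : K ⊆ D.extremalSet ε j) (x t : ℝ) (i : Fin 3) :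
    Holo U K fun z => D.psi F v j z x t i :=
  ⟨differentiableOn_psi he h.sol h.vec_ne h.decays0 hU (hUK.trans hK) x t i,
    (continuousOn_psi he h.sol h.vec_ne h.decays0 x t i).mono hK⟩

/-- Schwarz reflection: the adjoint column is `z ↦ ψ(z*)*`, so the extremality condition is imposed
at `z*`. -/
theorem holo_adjPsi (h : D.Standing) (he : D.IsEnd ε F v) (hU : IsOpen U) (hUK : U ⊆ K)
    (hK : ∀ z ∈ K, conj z ∈ D.extremalSet ε j) (x t : ℝ) (i : Fin 3) :
    Holo U K fun z => D.adjPsi F v j z x t i := by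
  have hready : D.Ready ε 0 F v := ⟨he, h.sol, h.vec_ne, h.decays0, le_rfl, h.decays0⟩
  have heq : EqOn (fun z => D.adjPsi F v j z x t i)
      (fun z => conj (D.psi F v j (conj z) x t i)) K := fun z hz => by
    have h1 := not_exceptional_conj (hK z hz).1
    rw [Complex.conj_conj] at h1
    exact hready.adjPsi_eq h1 (Or.inl (hK z hz).2) x t i
  constructor
  · refine DifferentiableOn.congr (fun z hz => ?_) (heq.mono hUK)
    have hU' : IsOpen (conj ⁻¹' U) := hU.preimage Complex.continuous_conj
    have hd := differentiableOn_psi (j := j) he h.sol h.vec_ne h.decays0 (U := conj ⁻¹' U) hU'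
      (fun y hy => by simpa using hK _ (hUK hy)) x t i
    have hz' : conj z ∈ conj ⁻¹' U := by simpa using hz
    have hd' := hd.differentiableAt (hU'.mem_nhds hz')
    have := hd'.star_star
    simp only [Complex.star_def, Complex.conj_conj] at this
    exact this.differentiableWithinAt
  · refine ContinuousOn.congr ?_ heq
    exact Complex.continuous_conj.comp_continuousOn
      ((continuousOn_psi he h.sol h.vec_ne h.decays0 x t i).comp
        Complex.continuous_conj.continuousOn hK)

theorem holo_exp_phase (hUK : U ⊆ K) (hK : ∀ z ∈ K, z ∉ D.exceptional) (x t : ℝ) (l : Fin 3) :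
    Holo U K fun z => Complex.exp (-(Complex.I * D.phase z x t l)) :=
  Holo.of_differentiableAt hUK fun z hz => ((differentiableAt_phase
    (ne_zero_of_not_exceptional (hK z hz)) x t l).const_mul _).fun_neg.cexp

theorem holo_expSum (hUK : U ⊆ K) (hK : ∀ z ∈ K, z ∉ D.exceptional) (x t : ℝ) :
    Holo U K fun z => D.expSum z x t :=
  Holo.of_differentiableAt hUK fun z hz => ((DifferentiableAt.fun_sum fun l _ =>
    differentiableAt_phase (ne_zero_of_not_exceptional (hK z hz)) x t l).const_mul _).cexp

theorem holo_rhoj_div (hUK : U ⊆ K) (hK : ∀ z ∈ K, z ∉ D.exceptional) (j : Fin 3) :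
    Holo U K fun z => D.rhoj j z / D.rho z := by
  refine Holo.of_differentiableAt hUK fun z hz => ?_
  have h1 := differentiableAt_rho (D := D) (ne_zero_of_not_exceptional (hK z hz))
  have h2 : DifferentiableAt ℂ (D.rhoj j) z := by
    by_cases hj : j = 1
    · have : D.rhoj j = D.rho := by funext y; simp [rhoj, hj]
      rw [this]; exact h1
    · have : D.rhoj j = fun _ => 1 := by funext y; simp [rhoj, hj]
      rw [this]; exact differentiableAt_const _
  exact h2.fun_div h1 (rho_ne_zero (hK z hz))

theorem holo_s (h : D.Standing) (hU : IsOpen U) (hUK : U ⊆ K) (hK : K ⊆ D.extremalSet 1 j)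
    (hK' : ∀ z ∈ K, conj z ∈ D.extremalSet (-1) j) : Holo U K (D.s j) :=
  (holo_rhoj_div hUK (fun _ hz => (hK hz).1) j).mul
    (Holo.dot (h.holo_adjPsi D.isEnd_pos hU hUK hK' 0 0) (h.holo_psi D.isEnd_neg hU hUK hK 0 0))

theorem holo_h (h : D.Standing) (hU : IsOpen U) (hUK : U ⊆ K) (hK : K ⊆ D.extremalSet (-1) j)
    (hK' : ∀ z ∈ K, conj z ∈ D.extremalSet 1 j) : Holo U K (D.h j) :=
  (holo_rhoj_div hUK (fun _ hz => (hK hz).1) j).mul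
    (Holo.dot (h.holo_adjPsi D.isEnd_neg hU hUK hK' 0 0) (h.holo_psi D.isEnd_pos hU hUK hK 0 0))

/-- Agreement with the entries of `S` is obtained only at real points, where weight zero provides
all Jost columns. -/
theorem continues_s (h : D.Standing) (hU : IsOpen U)
    (hcl : closure U \ D.exceptional ⊆ K) (hK : Holo U K (D.s j)) :
    D.Continues (fun z => D.S z j j) (D.s j) U :=
  ⟨hK.analytic hU, hK.2.mono hcl, fun _ hz hi => (h.regular_of_real hz.2 hi).s_eq j⟩

theorem continues_h (h : D.Standing) (hU : IsOpen U)
    (hcl : closure U \ D.exceptional ⊆ K) (hK : Holo U K (D.h j)) :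
    D.Continues (fun z => D.H z j j) (D.h j) U :=
  ⟨hK.analytic hU, hK.2.mono hcl, fun _ hz hi => (h.regular_of_real hz.2 hi).h_eq j⟩

end Standing
end
end Data
end LPD

/-! ### Columns, meromorphy and boundary values of the matrices `B_j` -/

namespace LPD

section
variable {U K : Set ℂ} {a b c : ℂ → Fin 3 → ℂ}

theorem meromorphicOn_cols (ha : ∀ i, MeromorphicOn (fun z => a z i) U)
    (hb : ∀ i, MeromorphicOn (fun z => b z i) U) (hc : ∀ i, MeromorphicOn (fun z => c z i) U)
    (i j : Fin 3) : MeromorphicOn (fun z => Data.cols (a z) (b z) (c z) i j) U := by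
  fin_cases j
  exacts [ha i, hb i, hc i]

theorem continuousWithinAt_cols {z : ℂ} (ha : ∀ i, ContinuousWithinAt (fun z => a z i) U z)
    (hb : ∀ i, ContinuousWithinAt (fun z => b z i) U z)
    (hc : ∀ i, ContinuousWithinAt (fun z => c z i) U z) :
    ContinuousWithinAt (fun z => Data.cols (a z) (b z) (c z)) U z := by
  refine tendsto_pi_nhds.2 fun i => tendsto_pi_nhds.2 fun j => ?_
  fin_cases j
  exacts [ha i, hb i, hc i]

theorem Holo.meromorphicOn_div {s : ℂ → ℂ} (hs : Holo U K s) (ha : ∀ i, Holo U K fun z => a z i)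
    (hU : IsOpen U) (i : Fin 3) : MeromorphicOn (fun z => ((1 / s z) • a z) i) U := fun z hz => by
  simp only [Pi.smul_apply, smul_eq_mul, one_div]
  exact (hs.meromorphicOn hU z hz).fun_inv.fun_mul ((ha i).meromorphicOn hU z hz)

theorem Holo.continuousWithinAt_div {s : ℂ → ℂ} (hs : Holo U K s)
    (ha : ∀ i, Holo U K fun z => a z i) (hUK : U ⊆ K) {z : ℂ} (hz : z ∈ K) (h0 : s z ≠ 0)
    (i : Fin 3) : ContinuousWithinAt (fun z => ((1 / s z) • a z) i) U z := by
  simp only [Pi.smul_apply, smul_eq_mul, one_div]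
  exact ((hs.continuousWithinAt hUK hz).inv₀ h0).mul ((ha i).continuousWithinAt hUK hz)

theorem cols_mul_diagonal (a b c e d : Fin 3 → ℂ) :
    Data.cols a b c * diagonal e * diagonal d =
      Data.cols (d 0 • e 0 • a) (d 1 • e 1 • b) (d 2 • e 2 • c) := by
  ext i j
  rw [mul_diagonal, mul_diagonal]
  fin_cases j <;> simp [Data.cols] <;> ring

end

namespace Data
variable {D : Data}

theorem B1_cols (x t : ℝ) (z : ℂ) : D.B1 x t z = cols ((1 / D.s 0 z) • D.nuM 0 z x t)
    (D.nuP 1 z x t) ((1 / D.h 1 z) • D.c1 z x t) := by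
  rw [B1, Psi1, expNegO, cols_mul_diagonal]
  simp [nuM, nuP, c1]

theorem B2_cols (x t : ℝ) (z : ℂ) : D.B2 x t z = cols (D.nuP 0 z x t)
    ((1 / D.s 1 z) • D.nuM 1 z x t) ((1 / D.h 0 z) • D.c2 z x t) := by
  rw [B2, Psi2, expNegO, cols_mul_diagonal]
  simp [nuM, nuP, c2]

theorem B3_cols (x t : ℝ) (z : ℂ) : D.B3 x t z = cols ((1 / D.h 2 z) • D.c3 z x t)
    ((1 / D.s 1 z) • D.nuM 1 z x t) (D.nuP 2 z x t) := by
  rw [B3, Psi3, expNegO, cols_mul_diagonal]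
  simp [nuM, nuP, c3]

theorem B4_cols (x t : ℝ) (z : ℂ) : D.B4 x t z = cols ((1 / D.h 1 z) • D.c4 z x t)
    (D.nuP 1 z x t) ((1 / D.s 2 z) • D.nuM 2 z x t) := by
  rw [B4, Psi4, expNegO, cols_mul_diagonal]
  simp [nuM, nuP, c4]

theorem Sigma1_subset : D.Sigma1 ⊆ D.Sigma := fun _ hz => ⟨Or.inl hz.1.1, hz.2⟩

theorem Sigma2_subset : D.Sigma2 ⊆ D.Sigma := fun _ hz => ⟨Or.inr hz.1.1, hz.2⟩

theorem Sigma3_subset : D.Sigma3 ⊆ D.Sigma := fun _ hz => ⟨Or.inl hz.1.1, hz.2⟩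

theorem Sigma4_subset : D.Sigma4 ⊆ D.Sigma := fun _ hz => ⟨Or.inr hz.1.1, hz.2⟩

theorem Sigma1_union_Sigma4_subset : D.Sigma1 ∪ D.Sigma4 ⊆ D.sector 1 1 := by
  rintro z (⟨⟨h1, h2⟩, h3⟩ | ⟨⟨h1, h2⟩, h3⟩)
  · exact ⟨⟨by rw [h1]; norm_num, by linarith⟩, h3⟩
  · exact ⟨⟨by linarith, by linarith⟩, h3⟩

theorem Sigma1_union_Sigma2_subset : D.Sigma1 ∪ D.Sigma2 ⊆ D.sector (-1) 1 := by
  rintro z (⟨⟨h1, h2⟩, h3⟩ | ⟨⟨h1, h2⟩, h3⟩)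
  · exact ⟨⟨by rw [h1]; norm_num, by linarith⟩, h3⟩
  · exact ⟨⟨by linarith, by linarith⟩, h3⟩

theorem Sigma2_union_Sigma3_subset : D.Sigma2 ∪ D.Sigma3 ⊆ D.sector (-1) (-1) := by
  rintro z (⟨⟨h1, h2⟩, h3⟩ | ⟨⟨h1, h2⟩, h3⟩)
  · exact ⟨⟨by linarith, by linarith⟩, h3⟩
  · exact ⟨⟨by rw [h1]; norm_num, by linarith⟩, h3⟩

theorem Sigma3_union_Sigma4_subset : D.Sigma3 ∪ D.Sigma4 ⊆ D.sector 1 (-1) := by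
  rintro z (⟨⟨h1, h2⟩, h3⟩ | ⟨⟨h1, h2⟩, h3⟩)
  · exact ⟨⟨by rw [h1]; norm_num, by linarith⟩, h3⟩
  · exact ⟨⟨by linarith, by linarith⟩, h3⟩

namespace Standing
variable {U K : Set ℂ} {j l : Fin 3}

theorem holo_nuM (h : D.Standing) (hU : IsOpen U) (hUK : U ⊆ K) (hK : K ⊆ D.extremalSet 1 j)
    (x t : ℝ) (i : Fin 3) : Holo U K fun z => D.nuM j z x t i :=
  (holo_exp_phase hUK (fun _ hz => (hK hz).1) x t j).mul (h.holo_psi D.isEnd_neg hU hUK hK x t i)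

theorem holo_nuP (h : D.Standing) (hU : IsOpen U) (hUK : U ⊆ K) (hK : K ⊆ D.extremalSet (-1) j)
    (x t : ℝ) (i : Fin 3) : Holo U K fun z => D.nuP j z x t i :=
  (holo_exp_phase hUK (fun _ hz => (hK hz).1) x t j).mul (h.holo_psi D.isEnd_pos hU hUK hK x t i)

theorem holo_aux (hUK : U ⊆ K) (hK : ∀ z ∈ K, z ∉ D.exceptional) (x t : ℝ)
    {φ ψ : ℂ → Fin 3 → ℂ} (hφ : ∀ i, Holo U K fun z => φ z i) (hψ : ∀ i, Holo U K fun z => ψ z i)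
    (l i : Fin 3) : Holo U K fun z => (Complex.exp (-(Complex.I * D.phase z x t l)) •
      (D.expSum z x t • crossProduct (φ z) (ψ z))) i :=
  (holo_exp_phase hUK hK x t l).mul ((holo_expSum hUK hK x t).mul (Holo.cross hφ hψ i))

theorem neg_subset {a b : ℝ} {A : Set ℂ} (h : D.sector (-a) b ⊆ A) :
    ∀ z ∈ D.sector a b, conj z ∈ A := fun _ hz => h (conj_mem_sector hz)

theorem neg_subset' {a : ℝ} {A : Set ℂ} (h : D.halfPlane (-a) ⊆ A) :
    ∀ z ∈ D.halfPlane a, conj z ∈ A := fun _ hz => h (conj_mem_halfPlane hz)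

theorem one_of_sector {a b ε : ℝ} (h : a = -ε) : D.sector a b ⊆ D.extremalSet ε 1 :=
  (sector_subset_halfPlane a b).trans (halfPlane_subset h)

theorem holo_s0 (h : D.Standing) : Holo D.U1 (D.sector 1 1) (D.s 0) :=
  h.holo_s isOpen_U1 U1_subset sector_one_subset (neg_subset sector_one_subset)

theorem holo_h0 (h : D.Standing) : Holo D.U2 (D.sector (-1) 1) (D.h 0) :=
  h.holo_h isOpen_U2 U2_subset sector_one_subset
    (neg_subset (by rw [neg_neg]; exact sector_one_subset))

theorem holo_h2 (h : D.Standing) : Holo D.U3 (D.sector (-1) (-1)) (D.h 2) :=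
  h.holo_h isOpen_U3 U3_subset sector_neg_one_subset
    (neg_subset (by rw [neg_neg]; exact sector_neg_one_subset))

theorem holo_s2 (h : D.Standing) : Holo D.U4 (D.sector 1 (-1)) (D.s 2) :=
  h.holo_s isOpen_U4 U4_subset sector_neg_one_subset (neg_subset sector_neg_one_subset)

/-- Extremality of the middle phase depends on the sign of `Im z` alone. The coefficient `s₂₂`, like
`h₂₂`, is therefore analytic across the circle and serves the inner and the outer region of its half
plane. -/
theorem holo_s1 (h : D.Standing) (hU : IsOpen U) (hUK : U ⊆ K) (hK : K ⊆ D.halfPlane (-1)) :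
    Holo U K (D.s 1) :=
  h.holo_s hU hUK (hK.trans (halfPlane_subset (by norm_num)))
    fun z hz => neg_subset' (halfPlane_subset (by norm_num)) z (hK hz)

theorem holo_h1 (h : D.Standing) (hU : IsOpen U) (hUK : U ⊆ K) (hK : K ⊆ D.halfPlane 1) :
    Holo U K (D.h 1) :=
  h.holo_h hU hUK (hK.trans (halfPlane_subset (by norm_num)))
    fun z hz => neg_subset' (halfPlane_subset (by norm_num)) z (hK hz)

theorem sector_not_exceptional {a b : ℝ} : ∀ z ∈ D.sector a b, z ∉ D.exceptional :=
  fun _ hz => hz.2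

theorem holo_c1 (h : D.Standing) (x t : ℝ) (i : Fin 3) :
    Holo D.U1 (D.sector 1 1) fun z => D.c1 z x t i :=
  holo_aux U1_subset sector_not_exceptional x t
    (h.holo_adjPsi D.isEnd_pos isOpen_U1 U1_subset (neg_subset sector_one_subset) x t)
    (h.holo_adjPsi D.isEnd_neg isOpen_U1 U1_subset (neg_subset (one_of_sector rfl)) x t) 2 i

theorem holo_c2 (h : D.Standing) (x t : ℝ) (i : Fin 3) :
    Holo D.U2 (D.sector (-1) 1) fun z => D.c2 z x t i :=
  holo_aux U2_subset sector_not_exceptional x t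
    (h.holo_adjPsi D.isEnd_neg isOpen_U2 U2_subset
      (neg_subset (by rw [neg_neg]; exact sector_one_subset)) x t)
    (h.holo_adjPsi D.isEnd_pos isOpen_U2 U2_subset (neg_subset (one_of_sector rfl)) x t) 2 i

theorem holo_c3 (h : D.Standing) (x t : ℝ) (i : Fin 3) :
    Holo D.U3 (D.sector (-1) (-1)) fun z => D.c3 z x t i :=
  holo_aux U3_subset sector_not_exceptional x t
    (h.holo_adjPsi D.isEnd_pos isOpen_U3 U3_subset (neg_subset (one_of_sector rfl)) x t)
    (h.holo_adjPsi D.isEnd_neg isOpen_U3 U3_subset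
      (neg_subset (by rw [neg_neg]; exact sector_neg_one_subset)) x t) 0 i

theorem holo_c4 (h : D.Standing) (x t : ℝ) (i : Fin 3) :
    Holo D.U4 (D.sector 1 (-1)) fun z => D.c4 z x t i :=
  holo_aux U4_subset sector_not_exceptional x t
    (h.holo_adjPsi D.isEnd_neg isOpen_U4 U4_subset (neg_subset (one_of_sector rfl)) x t)
    (h.holo_adjPsi D.isEnd_pos isOpen_U4 U4_subset (neg_subset sector_neg_one_subset) x t) 0 i

theorem meromorphicOn_B1 (h : D.Standing) (x t : ℝ) (i j : Fin 3) :
    MeromorphicOn (fun z => D.B1 x t z i j) D.U1 := by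
  simp only [B1_cols]
  exact meromorphicOn_cols
    (h.holo_s0.meromorphicOn_div (h.holo_nuM isOpen_U1 U1_subset sector_one_subset x t) isOpen_U1)
    (fun i => (h.holo_nuP isOpen_U1 U1_subset (one_of_sector (by norm_num)) x t i).meromorphicOn
      isOpen_U1)
    ((h.holo_h1 isOpen_U1 U1_subset (sector_subset_halfPlane _ _)).meromorphicOn_div
      (h.holo_c1 x t) isOpen_U1) i j

theorem meromorphicOn_B2 (h : D.Standing) (x t : ℝ) (i j : Fin 3) :
    MeromorphicOn (fun z => D.B2 x t z i j) D.U2 := by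
  simp only [B2_cols]
  exact meromorphicOn_cols
    (fun i => (h.holo_nuP isOpen_U2 U2_subset sector_one_subset x t i).meromorphicOn isOpen_U2)
    ((h.holo_s1 isOpen_U2 U2_subset (sector_subset_halfPlane _ _)).meromorphicOn_div
      (h.holo_nuM isOpen_U2 U2_subset (one_of_sector rfl) x t) isOpen_U2)
    (h.holo_h0.meromorphicOn_div (h.holo_c2 x t) isOpen_U2) i j

theorem meromorphicOn_B3 (h : D.Standing) (x t : ℝ) (i j : Fin 3) :
    MeromorphicOn (fun z => D.B3 x t z i j) D.U3 := by
  simp only [B3_cols]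
  exact meromorphicOn_cols (h.holo_h2.meromorphicOn_div (h.holo_c3 x t) isOpen_U3)
    ((h.holo_s1 isOpen_U3 U3_subset (sector_subset_halfPlane _ _)).meromorphicOn_div
      (h.holo_nuM isOpen_U3 U3_subset (one_of_sector rfl) x t) isOpen_U3)
    (fun i => (h.holo_nuP isOpen_U3 U3_subset sector_neg_one_subset x t i).meromorphicOn isOpen_U3)
    i j

theorem meromorphicOn_B4 (h : D.Standing) (x t : ℝ) (i j : Fin 3) :
    MeromorphicOn (fun z => D.B4 x t z i j) D.U4 := by
  simp only [B4_cols]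
  exact meromorphicOn_cols
    ((h.holo_h1 isOpen_U4 U4_subset (sector_subset_halfPlane _ _)).meromorphicOn_div
      (h.holo_c4 x t) isOpen_U4)
    (fun i => (h.holo_nuP isOpen_U4 U4_subset (one_of_sector (by norm_num)) x t i).meromorphicOn
      isOpen_U4)
    (h.holo_s2.meromorphicOn_div (h.holo_nuM isOpen_U4 U4_subset sector_neg_one_subset x t)
      isOpen_U4) i j

variable {z : ℂ}

theorem continuousWithinAt_B1 (h : D.Standing) (x t : ℝ) (hz : z ∈ D.sector 1 1)
    (h0 : D.s 0 z ≠ 0) (h1 : D.h 1 z ≠ 0) : ContinuousWithinAt (D.B1 x t) D.U1 z := by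
  rw [funext (B1_cols (D := D) x t)]
  exact continuousWithinAt_cols
    (h.holo_s0.continuousWithinAt_div (h.holo_nuM isOpen_U1 U1_subset sector_one_subset x t)
      U1_subset hz h0)
    (fun i => (h.holo_nuP isOpen_U1 U1_subset (one_of_sector (by norm_num)) x t
      i).continuousWithinAt U1_subset hz)
    ((h.holo_h1 isOpen_U1 U1_subset (sector_subset_halfPlane _ _)).continuousWithinAt_div
      (h.holo_c1 x t) U1_subset hz h1)

theorem continuousWithinAt_B2 (h : D.Standing) (x t : ℝ) (hz : z ∈ D.sector (-1) 1)
    (h0 : D.s 1 z ≠ 0) (h1 : D.h 0 z ≠ 0) : ContinuousWithinAt (D.B2 x t) D.U2 z := by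
  rw [funext (B2_cols (D := D) x t)]
  exact continuousWithinAt_cols
    (fun i => (h.holo_nuP isOpen_U2 U2_subset sector_one_subset x t i).continuousWithinAt
      U2_subset hz)
    ((h.holo_s1 isOpen_U2 U2_subset (sector_subset_halfPlane _ _)).continuousWithinAt_div
      (h.holo_nuM isOpen_U2 U2_subset (one_of_sector rfl) x t) U2_subset hz h0)
    (h.holo_h0.continuousWithinAt_div (h.holo_c2 x t) U2_subset hz h1)

theorem continuousWithinAt_B3 (h : D.Standing) (x t : ℝ) (hz : z ∈ D.sector (-1) (-1))
    (h0 : D.h 2 z ≠ 0) (h1 : D.s 1 z ≠ 0) : ContinuousWithinAt (D.B3 x t) D.U3 z := by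
  rw [funext (B3_cols (D := D) x t)]
  exact continuousWithinAt_cols
    (h.holo_h2.continuousWithinAt_div (h.holo_c3 x t) U3_subset hz h0)
    ((h.holo_s1 isOpen_U3 U3_subset (sector_subset_halfPlane _ _)).continuousWithinAt_div
      (h.holo_nuM isOpen_U3 U3_subset (one_of_sector rfl) x t) U3_subset hz h1)
    (fun i => (h.holo_nuP isOpen_U3 U3_subset sector_neg_one_subset x t i).continuousWithinAt
      U3_subset hz)

theorem continuousWithinAt_B4 (h : D.Standing) (x t : ℝ) (hz : z ∈ D.sector 1 (-1))
    (h0 : D.h 1 z ≠ 0) (h1 : D.s 2 z ≠ 0) : ContinuousWithinAt (D.B4 x t) D.U4 z := by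
  rw [funext (B4_cols (D := D) x t)]
  exact continuousWithinAt_cols
    ((h.holo_h1 isOpen_U4 U4_subset (sector_subset_halfPlane _ _)).continuousWithinAt_div
      (h.holo_c4 x t) U4_subset hz h0)
    (fun i => (h.holo_nuP isOpen_U4 U4_subset (one_of_sector (by norm_num)) x t
      i).continuousWithinAt U4_subset hz)
    (h.holo_s2.continuousWithinAt_div (h.holo_nuM isOpen_U4 U4_subset sector_neg_one_subset x t)
      U4_subset hz h1)

theorem continues (h : D.Standing) : D.Continues (fun z => D.S z 0 0) (D.s 0) D.U1 ∧
    D.Continues (fun z => D.S z 1 1) (D.s 1) D.lower ∧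
    D.Continues (fun z => D.S z 2 2) (D.s 2) D.U4 ∧
    D.Continues (fun z => D.H z 0 0) (D.h 0) D.U2 ∧
    D.Continues (fun z => D.H z 1 1) (D.h 1) D.upper ∧
    D.Continues (fun z => D.H z 2 2) (D.h 2) D.U3 :=
  ⟨h.continues_s isOpen_U1 (closure_diff_subset_sector U1_subset) h.holo_s0,
    h.continues_s isOpen_lower (closure_diff_subset_halfPlane lower_subset)
      (h.holo_s1 isOpen_lower lower_subset Subset.rfl),
    h.continues_s isOpen_U4 (closure_diff_subset_sector U4_subset) h.holo_s2,
    h.continues_h isOpen_U2 (closure_diff_subset_sector U2_subset) h.holo_h0,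
    h.continues_h isOpen_upper (closure_diff_subset_halfPlane upper_subset)
      (h.holo_h1 isOpen_upper upper_subset Subset.rfl),
    h.continues_h isOpen_U3 (closure_diff_subset_sector U3_subset) h.holo_h2⟩

end Standing
end Data
end LPD

end

theorem lemma1 (D : LPD.Data) (hvec : D.vec ≠ 0) (hsol : D.IsSolution) (hdecay : D.Decays 0) :
    -- the scattering relation on the contour
    (∀ z ∈ D.Sigma, D.Decays |z.im| → ∀ x t, D.matPsiM z x t = D.matPsiP z x t * D.S z) ∧
    -- the diagonal scattering coefficients continue analytically off the contour
    (D.Continues (fun z => D.S z 0 0) (D.s 0) D.U1 ∧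
      D.Continues (fun z => D.S z 1 1) (D.s 1) D.lower ∧
      D.Continues (fun z => D.S z 2 2) (D.s 2) D.U4 ∧
      D.Continues (fun z => D.H z 0 0) (D.h 0) D.U2 ∧
      D.Continues (fun z => D.H z 1 1) (D.h 1) D.upper ∧
      D.Continues (fun z => D.H z 2 2) (D.h 2) D.U3) ∧
    ∀ x t : ℝ,
    -- the columns of `B_j`
    ((∀ z ∈ D.U1, D.B1 x t z = LPD.Data.cols
        ((1 / D.s 0 z) • D.nuM 0 z x t) (D.nuP 1 z x t) ((1 / D.h 1 z) • D.c1 z x t)) ∧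
      (∀ z ∈ D.U2, D.B2 x t z = LPD.Data.cols
        (D.nuP 0 z x t) ((1 / D.s 1 z) • D.nuM 1 z x t) ((1 / D.h 0 z) • D.c2 z x t)) ∧
      (∀ z ∈ D.U3, D.B3 x t z = LPD.Data.cols
        ((1 / D.h 2 z) • D.c3 z x t) ((1 / D.s 1 z) • D.nuM 1 z x t) (D.nuP 2 z x t)) ∧
      (∀ z ∈ D.U4, D.B4 x t z = LPD.Data.cols
        ((1 / D.h 1 z) • D.c4 z x t) (D.nuP 1 z x t) ((1 / D.s 2 z) • D.nuM 2 z x t))) ∧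
    -- `B` is sectionally meromorphic
    (∀ i j, MeromorphicOn (fun z => D.B1 x t z i j) D.U1 ∧
      MeromorphicOn (fun z => D.B2 x t z i j) D.U2 ∧
      MeromorphicOn (fun z => D.B3 x t z i j) D.U3 ∧
      MeromorphicOn (fun z => D.B4 x t z i j) D.U4) ∧
    -- `B` has boundary values on the contour
    ((∀ z ∈ D.Sigma1 ∪ D.Sigma4, D.s 0 z ≠ 0 → D.h 1 z ≠ 0 →
        ContinuousWithinAt (D.B1 x t) D.U1 z) ∧
      (∀ z ∈ D.Sigma1 ∪ D.Sigma2, D.s 1 z ≠ 0 → D.h 0 z ≠ 0 →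
        ContinuousWithinAt (D.B2 x t) D.U2 z) ∧
      (∀ z ∈ D.Sigma2 ∪ D.Sigma3, D.h 2 z ≠ 0 → D.s 1 z ≠ 0 →
        ContinuousWithinAt (D.B3 x t) D.U3 z) ∧
      (∀ z ∈ D.Sigma3 ∪ D.Sigma4, D.h 1 z ≠ 0 → D.s 2 z ≠ 0 →
        ContinuousWithinAt (D.B4 x t) D.U4 z)) ∧
    -- the jump condition on the four parts of the contour
    (∀ z ∈ D.Sigma1, D.s 0 z ≠ 0 → D.h 1 z ≠ 0 → D.s 1 z ≠ 0 → D.h 0 z ≠ 0 →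
      D.B1 x t z = D.B2 x t z * (1 - D.expO z x t * D.L1 z * D.expNegO z x t)) ∧
    (∀ z ∈ D.Sigma2, D.Decays |z.im| → D.h 2 z ≠ 0 → D.s 1 z ≠ 0 → D.h 0 z ≠ 0 →
      D.B3 x t z = D.B2 x t z * (1 - D.expO z x t * D.L2 z * D.expNegO z x t)) ∧
    (∀ z ∈ D.Sigma3, D.h 2 z ≠ 0 → D.s 1 z ≠ 0 → D.h 1 z ≠ 0 → D.s 2 z ≠ 0 →
      D.B3 x t z = D.B4 x t z * (1 - D.expO z x t * D.L3 z * D.expNegO z x t)) ∧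
    (∀ z ∈ D.Sigma4, D.Decays |z.im| → D.s 0 z ≠ 0 → D.h 1 z ≠ 0 → D.s 2 z ≠ 0 →
      D.B1 x t z = D.B4 x t z * (1 - D.expO z x t * D.L4 z * D.expNegO z x t)) := by
  have hs : D.Standing := ⟨hsol, hvec, hdecay⟩
  -- At real points the required weight is zero, so the jumps on `Σ₁` and `Σ₃` need no decay beyond
  -- the standing assumption.
  have hreal : ∀ z ∈ D.Sigma, z.im = 0 → D.Regular z := fun z hz hi => hs.regular_of_real hz.2 hi
  refine ⟨fun z hz hd x t => ?_, hs.continues, fun x t => ⟨⟨fun z _ => LPD.Data.B1_cols x t z,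
    fun z _ => LPD.Data.B2_cols x t z, fun z _ => LPD.Data.B3_cols x t z,
    fun z _ => LPD.Data.B4_cols x t z⟩, fun i j => ⟨hs.meromorphicOn_B1 x t i j,
    hs.meromorphicOn_B2 x t i j, hs.meromorphicOn_B3 x t i j, hs.meromorphicOn_B4 x t i j⟩,
    ⟨fun z hz => hs.continuousWithinAt_B1 x t (LPD.Data.Sigma1_union_Sigma4_subset hz),
    fun z hz => hs.continuousWithinAt_B2 x t (LPD.Data.Sigma1_union_Sigma2_subset hz),
    fun z hz => hs.continuousWithinAt_B3 x t (LPD.Data.Sigma2_union_Sigma3_subset hz),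
    fun z hz => hs.continuousWithinAt_B4 x t (LPD.Data.Sigma3_union_Sigma4_subset hz)⟩,
    fun z hz h0 h1 h2 h3 =>
      (hreal z (LPD.Data.Sigma1_subset hz) hz.1.1).jump1 h0 h1 h2 h3 x t,
    fun z hz hd h0 h1 h2 => (hs.regular (LPD.Data.Sigma2_subset hz) hd).jump2 h0 h1 h2 x t,
    fun z hz h0 h1 h2 h3 =>
      (hreal z (LPD.Data.Sigma3_subset hz) hz.1.1).jump3 h0 h1 h2 h3 x t,
    fun z hz hd h0 h1 h2 => (hs.regular (LPD.Data.Sigma4_subset hz) hd).jump4 h0 h1 h2 x t⟩⟩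
  rw [LPD.Data.matPsiM_eq, LPD.Data.matPsiP_eq]
  exact (hs.regular hz hd).psi_mul_S x t
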